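/- **Setting.** For $t=1,2,\dots$ we observe $\boldsymbol y_t=\boldsymbol\ell_t+\boldsymbol w_t\in\mathbb R^n$ with $\boldsymbol\ell_t=\boldsymbol P\boldsymbol a_t$ and $\boldsymbol w_t=\boldsymbol M_t\boldsymbol\ell_t$, where $\boldsymbol P$ is an $n\times r$ matrix with orthonormal columns and the $\boldsymbol M_t$ are deterministic matrices. $\|\cdot\|$ is the induced $\ell_2$ norm, and $\mathrm{SE}(\hat{\boldsymbol P},\boldsymbol P)=\|(\boldsymbol I-\hat{\boldsymbol P}\hat{\boldsymbol P}')\boldsymbol P\|$. *Signal.* The $\boldsymbol a_t$ are mutually independent, zero mean, with covariance matrix $\boldsymbol\Lambda=\mathrm{diag}(\lambda_1,\dots,\lambda_r)$, $\lambda_1\ge\dots\ge\lambda_r>0$, and $(\boldsymbol a_t)_j^2\le\eta\lambda_j$ almost surely for all $t,j$. Put $\lambda^+=\lambda_1$, $\lambda^-=\lambda_r$, $f=\lambda^+/\lambda^-$, and $\lambda_i=0$ for $i>r$. *Clusters.* For some $1\le g^+<f$, $0\le\chi^+<1$ there is a $g\in[1,g^+]$ such that the $g$-condition-number partition of $\{1,\dots,r\}$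 has gap ratio $\chi\le\chi^+$. Here the partition consists of consecutive index sets $\mathcal G_1,\dots,\mathcal G_\vartheta$ of sizes $r_1,\dots,r_\vartheta\ge1$ with sum $r$ such that, with $r_*=r_1+\dots+r_{k-1}$, $\lambda_{r_*+1}\le g\lambda_{r_*+r_k}$ and $\lambda_{r_*+1}>g\lambda_{r_*+r_k+1}$ for each $k$; further $\lambda_k^+=\max_{i\in\mathcal G_k}\lambda_i$, $\lambda_k^-=\min_{i\in\mathcal G_k}\lambda_i$, $\lambda_{\vartheta+1}^+=0$ and $\chi=\max_{1\le k\le\vartheta}\lambda_{k+1}^+/\lambda_k^-$. *Noise.* $\boldsymbol M_t=\boldsymbol M_{2,t}\boldsymbol M_{1,t}$ with $\|\boldsymbol M_{1,t}\boldsymbol P\|\le q<1$, $\|\boldsymbol M_{2,t}\|\le1$, and, for some $\beta<\alpha$, for every batch $\mathcal J_k=\{(k-1)\alpha+1,\dots,k\alpha\}$, $k\ge1$, and all positive semidefinite $\boldsymbol A_t$, $$\Big\|\frac1\alpha\sum_{t\in\mathcal J_k}\boldsymbol M_{2,t}\boldsymbol A_t\boldsymbol M_{2,t}'\Big\|\le\frac\beta\alpha\max_{t\in\mathcal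 J_k}\|\boldsymbol A_t\| .$$ *Algorithm (Cluster-EVD)* with parameters $\alpha,\hat g,\mathrm{thresh}$. For $k=1,2,\dots$: let $\hat{\boldsymbol G}_{\det}=[\hat{\boldsymbol G}_1,\dots,\hat{\boldsymbol G}_{k-1}]$, $\boldsymbol\Psi_k=\boldsymbol I-\hat{\boldsymbol G}_{\det}\hat{\boldsymbol G}_{\det}'$, $\mathcal M_k=\boldsymbol\Psi_k\big(\frac1\alpha\sum_{t\in\mathcal J_k}\boldsymbol y_t\boldsymbol y_t'\big)\boldsymbol\Psi_k$, with eigenvalues $\hat\lambda_1\ge\hat\lambda_2\ge\cdots\ge\hat\lambda_n$, $\hat\lambda_{n+1}=0$. Let $\hat r_k$ be the first index $s\ge1$ with $\hat\lambda_1\le\hat g\hat\lambda_s$ and either $\hat\lambda_1>\hat g\hat\lambda_{s+1}$ or $\hat\lambda_{s+1}<\mathrm{thresh}$; let $\hat{\boldsymbol G}_k$ be a matrix whose columns are an orthonormal basis of the span of the top $\hat r_k$ eigenvectors of $\mathcal M_k$; stop if $\hat\lambda_{\hat r_k+1}<\mathrm{thresh}$. With $\hat\vartheta$ the number of iterations performed,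 output $\hat{\boldsymbol P}=[\hat{\boldsymbol G}_1,\dots,\hat{\boldsymbol G}_{\hat\vartheta}]$. **Theorem.** In this setting let $\zeta>0$ satisfy $r^2\zeta\le0.0001$ and $r^2\zeta f\le0.01$, and suppose that $$\chi^+\le\min\Big(1-r\zeta-\frac{0.08}{0.25},\ \frac{g^+-0.0001}{1.01g^++0.0001}-0.0001\Big),$$ that $\alpha\ge\alpha_0$, where, with $C=32\cdot16/0.01^2$, $$\alpha_0=C\eta^2\frac{r^2(11\log n+\log\vartheta)}{(r\zeta)^2}\max\big(g^+,\,qg^+,\,q^2f,\,q(r\zeta)f,\,(r\zeta)^2f,\,q\sqrt{fg^+},\,(r\zeta)\sqrt{fg^+}\big)^2,$$ and that for every $k=1,\dots,\vartheta$ $$\frac\beta\alpha\le\Big(\frac{1-r\zeta-\chi^+}2\Big)^2\min\Big(\frac{(r_k\zeta)^2}{4.1(qg^+)^2},\ \frac{r_k\zeta}{q^2f}\Big)$$ (no condition if $q=0$). Run the algorithm with this $\alpha$, $\hat g=1.01g^++0.0001$ and $\mathrm{thresh}=0.95\lambda^-$. Then, with probability at least $1-12n^{-10}$, the algorithm stops,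 its output $\hat{\boldsymbol P}$ has exactly $r$ columns, and $$\mathrm{SE}(\hat{\boldsymbol P},\boldsymbol P)\le r\zeta .$$ Moreover, if every cluster is separated from the next one relative to its own condition number, namely $\frac{\lambda_{k+1}^+}{\lambda_k^-}\le\frac{\lambda_k^+/\lambda_k^--0.0001}{1.01g^++0.0001}-0.0001$ for all $k<\vartheta$, then on the same event all cluster sizes are recovered: $\hat\vartheta=\vartheta$ and $\hat r_k=r_k$ for all $k\le\vartheta$. -/

import Mathlib

open MeasureTheory ProbabilityTheory
open scoped Matrix Matrix.Norms.L2Operator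

noncomputable section

namespace ClusterEVD

/-! In this file `‖A‖` is, for every real matrix `A`, the operator norm induced by the
Euclidean norms.  Time and iterations are numbered from `0`: the data vectors are
`y 0, y 1, …`, the `k`-th iteration (`k = 0, 1, …`) uses the `k`-th batch of `α` vectors, and
`λ_{i+1}` is the entry number `i` of a decreasing list. -/

/-! ### The data -/

/-- The subspace error `‖(I - P̂ P̂') P‖`. -/
def SE {n r : ℕ} {κ : Type*} [Fintype κ] (Phat : Matrix (Fin n) κ ℝ)
    (P : Matrix (Fin n) (Fin r) ℝ) : ℝ :=
  ‖(1 - Phat * Phatᵀ) * P‖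

/-- The data `y_t = ℓ_t + w_t` with `ℓ_t = P a_t`, `w_t = M_t ℓ_t`, `M_t = M_{2,t} M_{1,t}`. -/
def obs {Ω : Type*} {n r : ℕ} {m : ℕ → ℕ} (P : Matrix (Fin n) (Fin r) ℝ)
    (M1 : (t : ℕ) → Matrix (Fin (m t)) (Fin n) ℝ)
    (M2 : (t : ℕ) → Matrix (Fin n) (Fin (m t)) ℝ)
    (a : ℕ → Ω → Fin r → ℝ) (ω : Ω) (t : ℕ) : Fin n → ℝ :=
  P *ᵥ a t ω + (M2 t * M1 t) *ᵥ (P *ᵥ a t ω)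

/-- Largest diagonal entry `λ⁺` of `Λ = diag lam`. -/
def lamMax {r : ℕ} (lam : Fin r → ℝ) : ℝ := ⨆ i, lam i

/-- Smallest diagonal entry `λ⁻` of `Λ = diag lam`. -/
def lamMin {r : ℕ} (lam : Fin r → ℝ) : ℝ := ⨅ i, lam i

/-- The condition number `f = λ⁺ / λ⁻`. -/
def condNum {r : ℕ} (lam : Fin r → ℝ) : ℝ := lamMax lam / lamMin lam

/-- The batch of time instants used by the `k`-th iteration. -/
def batch (α k : ℕ) : Finset ℕ := Finset.Ico (k * α) ((k + 1) * α)

/-- The coefficients `a_t` are independent, zero mean, bounded, with covariance matrix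
`diag lam`, whose (positive) diagonal entries are listed in decreasing order. -/
structure CoeffModel {Ω : Type*} [MeasurableSpace Ω] (μ : Measure Ω) {r : ℕ}
    (lam : Fin r → ℝ) (η : ℝ) (a : ℕ → Ω → Fin r → ℝ) : Prop where
  lam_pos : ∀ i, 0 < lam i
  lam_antitone : Antitone lam
  measurable : ∀ t, Measurable (a t)
  indep : iIndepFun a μ
  mean_zero : ∀ t i, ∫ ω, a t ω i ∂μ = 0
  covariance : ∀ t i j, ∫ ω, a t ω i * a t ω j ∂μ = Matrix.diagonal lam i j
  bounded : ∀ t i, ∀ᵐ ω ∂μ, (a t ω i) ^ 2 ≤ η * lam i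

/-- The assumption on the data-dependency matrices `M_t = M_{2,t} M_{1,t}`.  The inner
dimension `m t` may depend on `t`.  In `average_le`, `c` stands for any upper bound of the
norms `‖A_t‖` over the batch (equivalently, for their maximum). -/
structure CorrModel {n r : ℕ} {m : ℕ → ℕ} (P : Matrix (Fin n) (Fin r) ℝ)
    (M1 : (t : ℕ) → Matrix (Fin (m t)) (Fin n) ℝ)
    (M2 : (t : ℕ) → Matrix (Fin n) (Fin (m t)) ℝ)
    (q : ℝ) (α : ℕ) (β : ℝ) : Prop where
  norm_M1 : ∀ t, ‖M1 t * P‖ ≤ q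
  q_lt_one : q < 1
  norm_M2 : ∀ t, ‖M2 t‖ ≤ 1
  beta_lt : β < α
  average_le : ∀ (k : ℕ) (A : (t : ℕ) → Matrix (Fin (m t)) (Fin (m t)) ℝ) (c : ℝ),
    (∀ t ∈ batch α k, (A t).PosSemidef) → (∀ t ∈ batch α k, ‖A t‖ ≤ c) →
      ‖(1 / (α : ℝ)) • ∑ t ∈ batch α k, M2 t * A t * (M2 t)ᵀ‖ ≤ β / α * c

/-! ### The clusters of eigenvalues -/

/-- The eigenvalues of `Σ = P Λ P'`: the diagonal entries of `Λ`, followed by zeros. -/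
def lamAt {r : ℕ} (lam : Fin r → ℝ) (i : ℕ) : ℝ := if h : i < r then lam ⟨i, h⟩ else 0

/-- The sum of the sizes of the first `k` clusters. -/
def start (size : ℕ → ℕ) (k : ℕ) : ℕ := ∑ j ∈ Finset.range k, size j

/-- The `g`-condition-number partition of the index set into `ϑ` clusters of consecutive
indices, the `k`-th one (`k < ϑ`) having `size k` elements.  All quotients are multiplied out,
since the eigenvalue after the last cluster is `0`. -/
structure IsCondPartition {r : ℕ} (lam : Fin r → ℝ) (g : ℝ) (ϑ : ℕ) (size : ℕ → ℕ) : Prop where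
  size_pos : ∀ k < ϑ, 1 ≤ size k
  ratio_le : ∀ k < ϑ,
    lamAt lam (start size k) ≤ g * lamAt lam (start size k + size k - 1)
  lt_ratio : ∀ k < ϑ,
    g * lamAt lam (start size k + size k) < lamAt lam (start size k)
  total : start size ϑ = r

/-- The `k`-th cluster of indices. -/
def cluster (r : ℕ) (size : ℕ → ℕ) (k : ℕ) : Set (Fin r) :=
  {i | start size k ≤ (i : ℕ) ∧ (i : ℕ) < start size k + size k}

/-- The largest eigenvalue of the `k`-th cluster (`0` after the last cluster). -/
def clusterMax {r : ℕ} (lam : Fin r → ℝ) (size : ℕ → ℕ) (k : ℕ) : ℝ :=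
  sSup (lam '' cluster r size k)

/-- The smallest eigenvalue of the `k`-th cluster. -/
def clusterMin {r : ℕ} (lam : Fin r → ℝ) (size : ℕ → ℕ) (k : ℕ) : ℝ :=
  sInf (lam '' cluster r size k)

/-- The gap ratio `χ`: the maximum over the clusters of `λ_{k+1}⁺ / λ_k⁻`. -/
def gapRatio {r : ℕ} (lam : Fin r → ℝ) (ϑ : ℕ) (size : ℕ → ℕ) : ℝ :=
  ⨆ k : Fin ϑ, clusterMax lam size (k + 1) / clusterMin lam size k

/-- The clustering assumption with bounds `gp` (for `g`) and `χp` (for `χ`). -/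
structure ClusterModel {r : ℕ} (lam : Fin r → ℝ) (gp χp : ℝ) (ϑ : ℕ) (size : ℕ → ℕ) : Prop where
  one_le_gp : 1 ≤ gp
  gp_lt : gp < condNum lam
  chip_nonneg : 0 ≤ χp
  chip_lt : χp < 1
  partition : ∃ g, 1 ≤ g ∧ g ≤ gp ∧ IsCondPartition lam g ϑ size
  gapRatio_le : gapRatio lam ϑ size ≤ χp

/-! ### The algorithm -/

/-- The eigenvalue number `i` (from `0`, in decreasing order, with multiplicity) of a symmetric
matrix; `0` for `i ≥ n`. -/
def eigval {n : ℕ} (M : Matrix (Fin n) (Fin n) ℝ) (i : ℕ) : ℝ := by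
  classical exact
  if h : M.IsHermitian ∧ i < n then
    h.1.eigenvalues₀ ⟨i, by rw [Fintype.card_fin]; exact h.2⟩
  else 0

/-- `G` is a basis matrix for the span of the top `s` eigenvectors of `M`: the first `s`
columns of some orthogonal matrix `V` whose columns are eigenvectors of `M` in the order of
decreasing eigenvalues. -/
def IsTopEigenvectors {n s : ℕ} (M : Matrix (Fin n) (Fin n) ℝ)
    (G : Matrix (Fin n) (Fin s) ℝ) : Prop :=
  Gᵀ * G = 1 ∧
    ∃ V : Matrix (Fin n) (Fin n) ℝ, Vᵀ * V = 1 ∧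
      M * V = V * Matrix.diagonal (fun i : Fin n => eigval M i) ∧
      Submodule.span ℝ (Set.range G.col) = Submodule.span ℝ (V.col '' {i | (i : ℕ) < s})

/-- A subroutine `eigenvectors(M, s)`. -/
def IsEigenvectorRoutine {n : ℕ}
    (eig : Matrix (Fin n) (Fin n) ℝ → (s : ℕ) → Matrix (Fin n) (Fin s) ℝ) : Prop :=
  ∀ (M : Matrix (Fin n) (Fin n) ℝ) (s : ℕ), M.IsHermitian → s ≤ n →
    IsTopEigenvectors M (eig M s)

/-- The size of the cluster found from `M`: the first index `s ≥ 1` such that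
`λ̂₁ / λ̂_s ≤ ĝ` and either `λ̂₁ / λ̂_{s+1} > ĝ` or `λ̂_{s+1} < thresh`. -/
def clusterSize {n : ℕ} (ghat thresh : ℝ) (M : Matrix (Fin n) (Fin n) ℝ) : ℕ :=
  sInf {s | 1 ≤ s ∧ eigval M 0 ≤ ghat * eigval M (s - 1) ∧
    (ghat * eigval M s < eigval M 0 ∨ eigval M s < thresh)}

section algorithm

variable {n : ℕ} (eig : Matrix (Fin n) (Fin n) ℝ → (s : ℕ) → Matrix (Fin n) (Fin s) ℝ)
  (α : ℕ) (ghat thresh : ℝ) (y : ℕ → Fin n → ℝ)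

/-- The empirical covariance matrix of the `k`-th batch. -/
def empCov (k : ℕ) : Matrix (Fin n) (Fin n) ℝ :=
  (1 / (α : ℝ)) • ∑ t ∈ batch α k, Matrix.vecMulVec (y t) (y t)

/-- The matrix `Ψ S Ψ` with `Ψ = I - Π` and `S` the empirical covariance of the `k`-th batch. -/
def projCov (k : ℕ) (Pi : Matrix (Fin n) (Fin n) ℝ) : Matrix (Fin n) (Fin n) ℝ :=
  (1 - Pi) * empCov α y k * (1 - Pi)

/-- `Ĝ_det Ĝ_det'` before the `k`-th iteration, `Ĝ_det` being the concatenation of the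
matrices `Ĝ` of the earlier iterations (so that this is the sum of their `Ĝ Ĝ'`). -/
def detProj : ℕ → Matrix (Fin n) (Fin n) ℝ
  | 0 => 0
  | k + 1 =>
    let M := projCov α y k (detProj k)
    let G := eig M (clusterSize ghat thresh M)
    detProj k + G * Gᵀ

/-- The matrix whose eigenvectors are computed in the `k`-th iteration. -/
def iterCov (k : ℕ) : Matrix (Fin n) (Fin n) ℝ :=
  projCov α y k (detProj eig α ghat thresh y k)

/-- The estimated size of the `k`-th cluster. -/
def rhat (k : ℕ) : ℕ := clusterSize ghat thresh (iterCov eig α ghat thresh y k)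

/-- The estimated basis matrix of the `k`-th cluster. -/
def Ghat (k : ℕ) : Matrix (Fin n) (Fin (rhat eig α ghat thresh y k)) ℝ :=
  eig (iterCov eig α ghat thresh y k) (rhat eig α ghat thresh y k)

/-- The stopping criterion at the end of the `k`-th iteration. -/
def Stop (k : ℕ) : Prop :=
  eigval (iterCov eig α ghat thresh y k) (rhat eig α ghat thresh y k) < thresh

/-- The algorithm performs exactly `K` iterations. -/
def HaltsAfter (K : ℕ) : Prop :=
  ∃ k, K = k + 1 ∧ Stop eig α ghat thresh y k ∧ ∀ j < k, ¬ Stop eig α ghat thresh y j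

/-- The output after `K` iterations: the concatenation of the matrices `Ĝ`. -/
def Phat (K : ℕ) :
    Matrix (Fin n) (Σ k : Fin K, Fin (rhat eig α ghat thresh y k)) ℝ :=
  Matrix.of fun i c => Ghat eig α ghat thresh y c.1 i c.2

end algorithm

/-- The lower bound `α₀` on the number of samples per iteration. -/
def alpha0 (n r ϑ : ℕ) (η ζ q gp f : ℝ) : ℝ :=
  32 * 16 / 0.01 ^ 2 * η ^ 2 *
    ((r : ℝ) ^ 2 * (11 * Real.log n + Real.log ϑ) / (r * ζ) ^ 2) *
    (max gp <| max (q * gp) <| max (q ^ 2 * f) <| max (q * (r * ζ) * f) <|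
      max ((r * ζ) ^ 2 * f) <| max (q * √(f * gp)) ((r * ζ) * √(f * gp))) ^ 2

end ClusterEVD

end

set_option linter.unusedSectionVars false

namespace ClusterEVD

/-! ### Operator norms and quadratic forms -/

section norms

variable {m n k : Type*} [Fintype m] [Fintype n] [Fintype k]
  [DecidableEq m] [DecidableEq n] [DecidableEq k]

/-! Reduction to a deterministic problem. Put N = P Λ^{1/2}, C_t = M_t N and b_t = Λ^{-1/2} a_t, so
that y_t = (N + C_t) b_t. With Σ = P Λ P', averaging y_t y_t' over a batch gives S_k = Σ + N E N' +
F N' + N F' + Q, where E averages b_t b_t' - I, F averages C_t b_t b_t' and Q averages C_t b_t b_t'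
C_t' (`CorrModel.isPerturbation_empCov`). The fluctuations of the three averages are controlled by a
Hoeffding inequality for vectors, applied to matrices in the Frobenius norm
(`measureReal_norm_sum_ge_le`, `CoeffModel.exists_event`). The means of F and Q are small by the
assumption on M_{2,t}, that of F through the Cauchy-Schwarz inequality
(`CorrModel.norm_avg_mul_le`). On the resulting event everything is linear algebra.

Eigenvalues. Let d bound ‖S_k - Σ‖. It involves λ⁺, but still (2ϑ - 1) d ≤ 0.0039 λ⁻. Removing exact
top eigenvectors of the k-th deflated matrix just shifts its spectrum, and passing to the next batch
costs at most 2d, so the eigenvalues seen in each iteration are within 0.0039 λ⁻ of the population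
eigenvalues not yet accounted for; no spectral gap is needed (`IsDeflation.abs_eigval_sub_le`).
Hence the threshold tells nonzero from zero, and exactly r directions are collected. Successive
detected clusters start at population eigenvalues of ratio larger than g⁺, therefore in different
true clusters, so there are at most ϑ iterations (`RunModel.isDeflation`). The detected clusters
need not be the true ones.

Subspace error. The projection I - P P' annihilates every term that begins with N, leaving F N' and
Q. Let Ψ be the projection complementary to the directions already found. Then F N' Ψ is measured by
‖Σ Ψ‖, the size of what remains, instead of λ⁺. Dividing by the smallest detected eigenvalue μ_k of
the current cluster, which is at least ‖Σ Ψ‖ / (1.0143 g⁺), bounds the error of the new directions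
(`IsDeflation.norm_perp_gram_le`, `NoiseModel.step_le`). The part due to the mean of the noise is a
multiple of ρ in each iteration, where ρ ϑ ≤ rζ; most of the rest decays like √(λ⁻ / μ_k), and the
gaps between clusters make this a geometric series (`RunModel.sum_norm_perp_le`). Since the output
has r columns, the roles of P and P̂ can be exchanged (`norm_one_sub_mul_le`).

Cluster sizes. An accuracy of 0.0039 λ⁻ does not match margins of 0.0001, so the top eigenvalue and
the first one past the cluster are estimated anew, relative to λ_k⁻, including the leakage of
earlier clusters through Ψ (`RunModel.size_eq_of_separated`). -/

lemma dotProduct_self_eq_norm_sq (x : n → ℝ) : x ⬝ᵥ x = ‖WithLp.toLp 2 x‖ ^ 2 := by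
  rw [EuclideanSpace.norm_sq_eq]
  simp [dotProduct, sq]

lemma dotProduct_self_nonneg' (x : n → ℝ) : 0 ≤ x ⬝ᵥ x := by
  rw [dotProduct_self_eq_norm_sq]; positivity

lemma dotProduct_self_pos {x : n → ℝ} (hx : x ≠ 0) : 0 < x ⬝ᵥ x := by
  refine lt_of_le_of_ne (dotProduct_self_nonneg' x) (Ne.symm ?_)
  rwa [Ne, dotProduct_self_eq_zero]

lemma dotProduct_le_sqrt (x y : n → ℝ) : x ⬝ᵥ y ≤ √(x ⬝ᵥ x) * √(y ⬝ᵥ y) := by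
  rw [dotProduct_self_eq_norm_sq, dotProduct_self_eq_norm_sq, Real.sqrt_sq (norm_nonneg _),
    Real.sqrt_sq (norm_nonneg _)]
  have := real_inner_le_norm (WithLp.toLp 2 x) (WithLp.toLp 2 y)
  simpa [PiLp.inner_apply, dotProduct, mul_comm] using this

lemma dotProduct_mulVec_self_le (A : Matrix m n ℝ) (x : n → ℝ) :
    (A *ᵥ x) ⬝ᵥ (A *ᵥ x) ≤ ‖A‖ ^ 2 * (x ⬝ᵥ x) := by
  have h := Matrix.l2_opNorm_mulVec A (WithLp.toLp 2 x)
  rw [dotProduct_self_eq_norm_sq, dotProduct_self_eq_norm_sq, ← mul_pow]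
  exact pow_le_pow_left₀ (norm_nonneg _) h 2

lemma norm_le_of_dotProduct_mulVec_self_le (A : Matrix m n ℝ) {c : ℝ} (hc : 0 ≤ c)
    (h : ∀ x : n → ℝ, (A *ᵥ x) ⬝ᵥ (A *ᵥ x) ≤ c ^ 2 * (x ⬝ᵥ x)) : ‖A‖ ≤ c := by
  rw [Matrix.l2_opNorm_def]
  refine ContinuousLinearMap.opNorm_le_bound _ hc fun x => ?_
  have h1 := h (WithLp.ofLp x)
  rw [dotProduct_self_eq_norm_sq, dotProduct_self_eq_norm_sq, ← mul_pow] at h1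
  exact le_of_sq_le_sq h1 (by positivity)

lemma norm_transpose (A : Matrix m n ℝ) : ‖Aᵀ‖ = ‖A‖ := by
  rw [← Matrix.conjTranspose_eq_transpose_of_trivial, Matrix.l2_opNorm_conjTranspose]

lemma norm_transpose_mul_self (A : Matrix m n ℝ) : ‖Aᵀ * A‖ = ‖A‖ ^ 2 := by
  rw [← Matrix.conjTranspose_eq_transpose_of_trivial, Matrix.l2_opNorm_conjTranspose_mul_self, sq]

lemma norm_mul_le_of_le (A : Matrix m n ℝ) (B : Matrix n k ℝ) {a b : ℝ} (hA : ‖A‖ ≤ a)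
    (hB : ‖B‖ ≤ b) : ‖A * B‖ ≤ a * b :=
  (Matrix.l2_opNorm_mul A B).trans
    (mul_le_mul hA hB (norm_nonneg _) ((norm_nonneg _).trans hA))

lemma abs_dotProduct_mulVec_le (A : Matrix n n ℝ) (x : n → ℝ) :
    |x ⬝ᵥ A *ᵥ x| ≤ ‖A‖ * (x ⬝ᵥ x) := by
  have key : ∀ y : n → ℝ, y ⬝ᵥ y = x ⬝ᵥ x → y ⬝ᵥ A *ᵥ x ≤ ‖A‖ * (x ⬝ᵥ x) := by
    intro y hy
    refine (dotProduct_le_sqrt _ _).trans ?_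
    have h2 : √((A *ᵥ x) ⬝ᵥ (A *ᵥ x)) ≤ ‖A‖ * √(x ⬝ᵥ x) := by
      rw [← Real.sqrt_sq (norm_nonneg A), ← Real.sqrt_mul (sq_nonneg _)]
      exact Real.sqrt_le_sqrt (dotProduct_mulVec_self_le A x)
    calc √(y ⬝ᵥ y) * √((A *ᵥ x) ⬝ᵥ (A *ᵥ x)) ≤ √(x ⬝ᵥ x) * (‖A‖ * √(x ⬝ᵥ x)) := by
          rw [hy]; gcongr
      _ = ‖A‖ * (√(x ⬝ᵥ x) * √(x ⬝ᵥ x)) := by ring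
      _ = _ := by rw [Real.mul_self_sqrt (dotProduct_self_nonneg' x)]
  rw [abs_le]
  constructor
  · have := key (-x) (by simp)
    rw [neg_dotProduct] at this
    linarith
  · exact key x rfl

lemma dotProduct_mulVec_transpose (A : Matrix m n ℝ) (x : m → ℝ) (y : n → ℝ) :
    x ⬝ᵥ A *ᵥ y = (Aᵀ *ᵥ x) ⬝ᵥ y := by
  rw [Matrix.dotProduct_mulVec, Matrix.mulVec_transpose]

lemma norm_le_one_of_transpose_mul_self (A : Matrix m n ℝ) (h : Aᵀ * A = 1) : ‖A‖ ≤ 1 := by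
  refine norm_le_of_dotProduct_mulVec_self_le A zero_le_one fun x => ?_
  rw [dotProduct_mulVec_transpose, Matrix.mulVec_mulVec, h]
  simp

lemma norm_le_one_of_isIdempotent (A : Matrix n n ℝ) (hs : Aᵀ = A) (h : A * A = A) :
    ‖A‖ ≤ 1 := by
  have h1 := norm_transpose_mul_self A
  rw [hs, h] at h1
  nlinarith [norm_nonneg A, sq_nonneg (‖A‖ - 1)]

end norms

/-! ### Eigenvalues -/

section eigen

variable {n : ℕ}

/-- The columns of `V` are an orthonormal eigenbasis of `M`, in the order of decreasing
eigenvalues. -/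
structure IsEigenbasis (M V : Matrix (Fin n) (Fin n) ℝ) : Prop where
  orth : Vᵀ * V = 1
  eigen : M * V = V * Matrix.diagonal (fun i : Fin n => eigval M i)

lemma eigval_eq {M : Matrix (Fin n) (Fin n) ℝ} (hM : M.IsHermitian) {i : ℕ} (hi : i < n) :
    eigval M i = hM.eigenvalues₀ ⟨i, by rwa [Fintype.card_fin]⟩ := by
  rw [eigval, dif_pos ⟨hM, hi⟩]

lemma eigval_of_le (M : Matrix (Fin n) (Fin n) ℝ) {i : ℕ} (hi : n ≤ i) : eigval M i = 0 := by
  simp [eigval, Nat.not_lt.mpr hi]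

lemma eigval_anti {M : Matrix (Fin n) (Fin n) ℝ} (hM : M.IsHermitian) {i j : ℕ} (hij : i ≤ j)
    (hj : j < n) : eigval M j ≤ eigval M i := by
  rw [eigval_eq hM hj, eigval_eq hM (hij.trans_lt hj)]
  exact hM.eigenvalues₀_antitone hij

lemma exists_isEigenbasis {M : Matrix (Fin n) (Fin n) ℝ} (hM : M.IsHermitian) :
    ∃ V, IsEigenbasis M V := by
  classical
  -- `eigenvalues` is the sorted list `eigenvalues₀` composed with a choice of equivalence; `e`
  -- undoes that choice, so the columns come in decreasing order.
  let e : Fin n ≃ Fin n :=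
    (finCongr (Fintype.card_fin n).symm).trans (Fintype.equivOfCardEq (Fintype.card_fin _))
  have he : ∀ i : Fin n, hM.eigenvalues (e i) = eigval M i := by
    intro i
    rw [eigval_eq hM i.2, Matrix.IsHermitian.eigenvalues]
    congr 1
    simp [e]
    rfl
  let b := hM.eigenvectorBasis
  let V : Matrix (Fin n) (Fin n) ℝ := Matrix.of fun i j => b (e j) i
  refine ⟨V, ?_, ?_⟩
  · ext i j
    have h := orthonormal_iff_ite.mp b.orthonormal (e i) (e j)
    rw [PiLp.inner_apply] at h
    simp only [Matrix.mul_apply, Matrix.transpose_apply, V, Matrix.of_apply, Matrix.one_apply]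
    simp only [EmbeddingLike.apply_eq_iff_eq] at h
    rw [← h]
    refine Finset.sum_congr rfl fun x _ => ?_
    simp [mul_comm]
  · ext i j
    have h := congrFun (hM.mulVec_eigenvectorBasis (e j)) i
    rw [he] at h
    rw [Matrix.mul_diagonal, Matrix.mul_apply]
    simp only [Matrix.mulVec, dotProduct, Pi.smul_apply, smul_eq_mul] at h
    simp only [V, Matrix.of_apply]
    rw [mul_comm]
    exact h

variable {M V : Matrix (Fin n) (Fin n) ℝ}

lemma IsEigenbasis.orth' (h : IsEigenbasis M V) : V * Vᵀ = 1 :=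
  mul_eq_one_comm.mp h.orth

lemma IsEigenbasis.eq (h : IsEigenbasis M V) :
    M = V * Matrix.diagonal (fun i : Fin n => eigval M i) * Vᵀ := by
  rw [← h.eigen, Matrix.mul_assoc, h.orth', Matrix.mul_one]

lemma dotProduct_self_eq_sum (hV : V * Vᵀ = 1) (x : Fin n → ℝ) :
    x ⬝ᵥ x = ∑ i, (Vᵀ *ᵥ x) i ^ 2 := by
  have : x ⬝ᵥ x = (Vᵀ *ᵥ x) ⬝ᵥ (Vᵀ *ᵥ x) := by
    rw [← dotProduct_mulVec_transpose, Matrix.mulVec_mulVec, hV, Matrix.one_mulVec]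
  rw [this]
  simp [dotProduct, sq]

lemma dotProduct_conj_diagonal {m : Type*} [Fintype m] [DecidableEq m] (W : Matrix (Fin n) m ℝ)
    (d : m → ℝ) (x : Fin n → ℝ) :
    x ⬝ᵥ (W * Matrix.diagonal d * Wᵀ) *ᵥ x = ∑ i, d i * (Wᵀ *ᵥ x) i ^ 2 := by
  rw [← Matrix.mulVec_mulVec, ← Matrix.mulVec_mulVec, dotProduct_mulVec_transpose]
  simp only [dotProduct, Matrix.mulVec_diagonal]
  refine Finset.sum_congr rfl fun i _ => by ring

lemma IsEigenbasis.quadratic_eq (h : IsEigenbasis M V) (x : Fin n → ℝ) :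
    x ⬝ᵥ M *ᵥ x = ∑ i : Fin n, eigval M i * (Vᵀ *ᵥ x) i ^ 2 := by
  conv_lhs => rw [h.eq]
  exact dotProduct_conj_diagonal _ _ _

lemma exists_ne_zero_ker {E F : Type*} [AddCommGroup E] [Module ℝ E] [FiniteDimensional ℝ E]
    [AddCommGroup F] [Module ℝ F] [FiniteDimensional ℝ F] (T : E →ₗ[ℝ] F)
    (h : Module.finrank ℝ F < Module.finrank ℝ E) : ∃ x, x ≠ 0 ∧ T x = 0 := by
  have := LinearMap.ker_ne_bot_of_finrank_lt (f := T) h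
  obtain ⟨x, hx, hx0⟩ := Submodule.exists_mem_ne_zero_of_ne_bot this
  exact ⟨x, hx0, hx⟩

/-- Upper bound of an eigenvalue from the quadratic form on the kernel of a linear map. -/
lemma eigval_le_of_ker (hM : M.IsHermitian) {F : Type*} [AddCommGroup F] [Module ℝ F]
    [FiniteDimensional ℝ F] (T : (Fin n → ℝ) →ₗ[ℝ] F) {i : ℕ} (hi : i < n) {c : ℝ}
    (hT : Module.finrank ℝ F ≤ i)
    (h : ∀ x, T x = 0 → x ⬝ᵥ M *ᵥ x ≤ c * (x ⬝ᵥ x)) : eigval M i ≤ c := by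
  classical
  obtain ⟨V, hV⟩ := exists_isEigenbasis hM
  let R : (Fin n → ℝ) →ₗ[ℝ] ({j : Fin n // i < j} → ℝ) :=
    (LinearMap.funLeft ℝ ℝ (Subtype.val : {j : Fin n // i < j} → Fin n)) ∘ₗ Vᵀ.mulVecLin
  have hcard : Fintype.card {j : Fin n // i < (j : ℕ)} = n - i - 1 := by
    have : Fintype.card {j : Fin n // i < (j : ℕ)} = (Finset.Ioi (⟨i, hi⟩ : Fin n)).card := by
      rw [Fintype.card_subtype]
      congr 1
      ext j
      simp [Fin.lt_def]
    rw [this, Fin.card_Ioi]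
    simp; omega
  -- `T` imposes at most `i` conditions and `R` another `n - i - 1`, so a nonzero vector of the
  -- kernel of `T` lies in the span of the top `i + 1` eigenvectors.
  obtain ⟨x, hx0, hx⟩ := exists_ne_zero_ker (T.prod R) (by
    rw [Module.finrank_prod, Module.finrank_pi, Module.finrank_pi, hcard, Fintype.card_fin]
    omega)
  rw [LinearMap.prod_apply, Function.prod_apply, Prod.mk_eq_zero] at hx
  have hxz : ∀ j : Fin n, i < j → (Vᵀ *ᵥ x) j = 0 := fun j hj => congrFun hx.2 ⟨j, hj⟩
  have h1 := h x hx.1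
  have h2 : eigval M i * (x ⬝ᵥ x) ≤ x ⬝ᵥ M *ᵥ x := by
    rw [hV.quadratic_eq, dotProduct_self_eq_sum hV.orth', Finset.mul_sum]
    refine Finset.sum_le_sum fun j _ => ?_
    rcases lt_or_ge i j with hj | hj
    · simp [hxz j hj]
    · exact mul_le_mul_of_nonneg_right (eigval_anti hM hj hi) (sq_nonneg _)
  exact le_of_mul_le_mul_right (h2.trans h1) (dotProduct_self_pos hx0)

/-- Lower bound of an eigenvalue from the quadratic form on the range of an injective map. -/
lemma le_eigval_of_range (hM : M.IsHermitian) {F : Type*} [AddCommGroup F] [Module ℝ F]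
    [FiniteDimensional ℝ F] (U : F →ₗ[ℝ] (Fin n → ℝ)) (hU : Function.Injective U) {i : ℕ}
    (hi : i < n) {c : ℝ} (hF : i < Module.finrank ℝ F)
    (h : ∀ y, c * (U y ⬝ᵥ U y) ≤ U y ⬝ᵥ M *ᵥ U y) : c ≤ eigval M i := by
  classical
  obtain ⟨V, hV⟩ := exists_isEigenbasis hM
  let R : (Fin n → ℝ) →ₗ[ℝ] (Fin i → ℝ) :=
    (LinearMap.funLeft ℝ ℝ (Fin.castLE hi.le)) ∘ₗ Vᵀ.mulVecLin
  obtain ⟨y, hy0, hy⟩ := exists_ne_zero_ker (R ∘ₗ U) (by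
    rw [Module.finrank_pi, Fintype.card_fin]; exact hF)
  set x := U y with hx
  have hx0 : x ≠ 0 := fun h0 => hy0 (hU (by rw [← hx, h0, map_zero]))
  have hxz : ∀ j : Fin n, (j : ℕ) < i → (Vᵀ *ᵥ x) j = 0 := fun j hj => congrFun hy ⟨j, hj⟩
  have h1 := h y
  rw [← hx] at h1
  have h2 : x ⬝ᵥ M *ᵥ x ≤ eigval M i * (x ⬝ᵥ x) := by
    rw [hV.quadratic_eq, dotProduct_self_eq_sum hV.orth', Finset.mul_sum]
    refine Finset.sum_le_sum fun j _ => ?_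
    rcases lt_or_ge (j : ℕ) i with hj | hj
    · simp [hxz j hj]
    · exact mul_le_mul_of_nonneg_right (eigval_anti hM hj j.2) (sq_nonneg _)
  exact le_of_mul_le_mul_right (h1.trans h2) (dotProduct_self_pos hx0)

lemma quadratic_le_add (A B : Matrix (Fin n) (Fin n) ℝ) (x : Fin n → ℝ) :
    x ⬝ᵥ A *ᵥ x ≤ x ⬝ᵥ B *ᵥ x + ‖A - B‖ * (x ⬝ᵥ x) := by
  have := (abs_le.mp (abs_dotProduct_mulVec_le (A - B) x)).2
  rw [Matrix.sub_mulVec, dotProduct_sub] at this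
  linarith

lemma finrank_pi_fin (s : ℕ) : Module.finrank ℝ (Fin s → ℝ) = s := by
  rw [Module.finrank_pi, Fintype.card_fin]

/-- **Weyl's inequality** (one direction). -/
lemma eigval_le_add_norm_sub {A B : Matrix (Fin n) (Fin n) ℝ} (hA : A.IsHermitian)
    (hB : B.IsHermitian) (i : ℕ) : eigval A i ≤ eigval B i + ‖A - B‖ := by
  rcases lt_or_ge i n with hi | hi
  · obtain ⟨V, hV⟩ := exists_isEigenbasis hB
    refine eigval_le_of_ker hA ((LinearMap.funLeft ℝ ℝ (Fin.castLE hi.le)) ∘ₗ Vᵀ.mulVecLin) hi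
      (finrank_pi_fin i).le fun x hx => ?_
    have hxz : ∀ j : Fin n, (j : ℕ) < i → (Vᵀ *ᵥ x) j = 0 := fun j hj => congrFun hx ⟨j, hj⟩
    refine (quadratic_le_add A B x).trans ?_
    rw [add_mul]
    gcongr
    rw [hV.quadratic_eq, dotProduct_self_eq_sum hV.orth', Finset.mul_sum]
    refine Finset.sum_le_sum fun j _ => ?_
    rcases lt_or_ge (j : ℕ) i with hj | hj
    · simp [hxz j hj]
    · exact mul_le_mul_of_nonneg_right (eigval_anti hB hj j.2) (sq_nonneg _)
  · rw [eigval_of_le _ hi, eigval_of_le _ hi, zero_add]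
    exact norm_nonneg _

lemma eigval_nonneg (hM : M.PosSemidef) (i : ℕ) : 0 ≤ eigval M i := by
  rcases lt_or_ge i n with hi | hi
  · refine le_eigval_of_range hM.1 LinearMap.id Function.injective_id hi
      (by rw [finrank_pi_fin]; exact hi) fun y => ?_
    simpa using hM.dotProduct_mulVec_nonneg y
  · rw [eigval_of_le _ hi]

lemma eigval_anti_of_posSemidef (hM : M.PosSemidef) {i j : ℕ} (hij : i ≤ j) :
    eigval M j ≤ eigval M i := by
  rcases lt_or_ge j n with hj | hj
  · exact eigval_anti hM.1 hij hj
  · rw [eigval_of_le _ hj]; exact eigval_nonneg hM i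

lemma norm_le_eigval_zero (hM : M.PosSemidef) : ‖M‖ ≤ eigval M 0 := by
  obtain ⟨V, hV⟩ := exists_isEigenbasis hM.1
  have hV1 := norm_le_one_of_transpose_mul_self V hV.orth
  have hV2 : ‖Vᵀ‖ ≤ 1 := by rw [norm_transpose]; exact hV1
  have hD : ‖Matrix.diagonal (fun i : Fin n => eigval M i)‖ ≤ eigval M 0 := by
    rw [Matrix.l2_opNorm_diagonal, pi_norm_le_iff_of_nonneg (eigval_nonneg hM 0)]
    intro i
    rw [Real.norm_of_nonneg (eigval_nonneg hM i)]
    exact eigval_anti_of_posSemidef hM (Nat.zero_le _)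
  rw [hV.eq]
  calc _ ≤ (1 * eigval M 0) * 1 :=
        norm_mul_le_of_le _ _ (norm_mul_le_of_le _ _ hV1 hD) hV2
    _ = _ := by ring_nf; rw [← hV.eq]

end eigen

/-! ### Spectral projections and deflation by top eigenvectors -/

section top

variable {n s : ℕ} {M V : Matrix (Fin n) (Fin n) ℝ} {G : Matrix (Fin n) (Fin s) ℝ}

lemma mul_transpose_mulVec_of_mem_span (hG : Gᵀ * G = 1) {x : Fin n → ℝ}
    (hx : x ∈ Submodule.span ℝ (Set.range G.col)) : (G * Gᵀ) *ᵥ x = x := by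
  rw [← Matrix.range_mulVecLin] at hx
  obtain ⟨w, rfl⟩ := hx
  rw [Matrix.mulVecLin_apply, Matrix.mulVec_mulVec, Matrix.mul_assoc, hG, Matrix.mul_one]

/-- Equal spans give equal orthogonal projections, even though the columns of `G` may differ from
those of `V`. Afterwards `M` and `G * Gᵀ` are diagonal in one orthonormal basis. -/
lemma IsTopEigenvectors.exists_basis (h : IsTopEigenvectors M G) :
    ∃ V, IsEigenbasis M V ∧
      G * Gᵀ = V * Matrix.diagonal (fun i : Fin n => if (i : ℕ) < s then (1 : ℝ) else 0) * Vᵀ := by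
  obtain ⟨hG, V, hV, hM, hspan⟩ := h
  have hE : IsEigenbasis M V := ⟨hV, hM⟩
  refine ⟨V, hE, ?_⟩
  have key : G * Gᵀ * V
      = V * Matrix.diagonal (fun i : Fin n => if (i : ℕ) < s then (1 : ℝ) else 0) := by
    ext a i
    have e1 : (G * Gᵀ * V) a i = ((G * Gᵀ) *ᵥ V.col i) a := rfl
    rw [e1, Matrix.mul_diagonal]
    split_ifs with hi
    · rw [mul_transpose_mulVec_of_mem_span hG]
      · simp [Matrix.col]
      · rw [hspan]
        exact Submodule.subset_span ⟨i, hi, rfl⟩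
    · have hperp : ∀ x ∈ Submodule.span ℝ (Set.range G.col), x ⬝ᵥ V.col i = 0 := by
        rw [hspan]
        intro x hx
        induction hx using Submodule.span_induction with
        | mem x hx =>
          obtain ⟨j, hj, rfl⟩ := hx
          have hji : j ≠ i := by rintro rfl; exact hi hj
          have := congrFun (congrFun hV j) i
          rwa [Matrix.one_apply_ne hji] at this
        | zero => simp
        | add x y _ _ hx hy => rw [add_dotProduct, hx, hy, add_zero]
        | smul c x _ hx => rw [smul_dotProduct, hx, smul_zero]
      have h0 : Gᵀ *ᵥ V.col i = 0 := by
        ext j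
        exact hperp (G.col j) (Submodule.subset_span ⟨j, rfl⟩)
      rw [← Matrix.mulVec_mulVec, h0, Matrix.mulVec_zero]
      simp
  rw [← key, Matrix.mul_assoc, hE.orth', Matrix.mul_one]

/-- Products of matrices that are diagonal in the same orthonormal basis. -/
lemma conj_diagonal_mul (hV : Vᵀ * V = 1) (d d' : Fin n → ℝ) :
    (V * Matrix.diagonal d * Vᵀ) * (V * Matrix.diagonal d' * Vᵀ)
      = V * Matrix.diagonal (fun i => d i * d' i) * Vᵀ := by
  rw [← Matrix.diagonal_mul_diagonal]
  calc _ = V * Matrix.diagonal d * (Vᵀ * V) * Matrix.diagonal d' * Vᵀ := by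
        simp only [Matrix.mul_assoc]
    _ = _ := by rw [hV, Matrix.mul_one, Matrix.mul_assoc V]

lemma conj_diagonal_sub (d d' : Fin n → ℝ) :
    (V * Matrix.diagonal d * Vᵀ) - (V * Matrix.diagonal d' * Vᵀ)
      = V * Matrix.diagonal (fun i => d i - d' i) * Vᵀ := by
  rw [← Matrix.sub_mul, ← Matrix.mul_sub, Matrix.diagonal_sub]

lemma norm_conj_diagonal_le (hV : Vᵀ * V = 1) (d : Fin n → ℝ) {c : ℝ} (hc : 0 ≤ c)
    (h : ∀ i, |d i| ≤ c) : ‖V * Matrix.diagonal d * Vᵀ‖ ≤ c := by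
  have hV1 := norm_le_one_of_transpose_mul_self V hV
  have hV2 : ‖Vᵀ‖ ≤ 1 := by rw [norm_transpose]; exact hV1
  have hD : ‖Matrix.diagonal d‖ ≤ c := by
    rw [Matrix.l2_opNorm_diagonal, pi_norm_le_iff_of_nonneg hc]
    exact h
  calc _ ≤ (1 * c) * 1 := norm_mul_le_of_le _ _ (norm_mul_le_of_le _ _ hV1 hD) hV2
    _ = c := by ring

lemma IsEigenbasis.one_eq (h : IsEigenbasis M V) :
    (1 : Matrix (Fin n) (Fin n) ℝ) = V * Matrix.diagonal (fun _ => (1 : ℝ)) * Vᵀ := by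
  rw [Matrix.diagonal_one, Matrix.mul_one, h.orth']

lemma mul_transpose_idem (hG : Gᵀ * G = 1) : G * Gᵀ * (G * Gᵀ) = G * Gᵀ := by
  rw [Matrix.mul_assoc, ← Matrix.mul_assoc Gᵀ, hG, Matrix.one_mul]

lemma mul_transpose_transpose {m k : Type*} [Fintype k] (G : Matrix m k ℝ) :
    (G * Gᵀ)ᵀ = G * Gᵀ := by
  simp [Matrix.transpose_mul]

lemma IsTopEigenvectors.commute (h : IsTopEigenvectors M G) : G * Gᵀ * M = M * (G * Gᵀ) := by
  obtain ⟨V, hV, hG⟩ := h.exists_basis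
  rw [hG, hV.eq, conj_diagonal_mul hV.orth, conj_diagonal_mul hV.orth]
  simp only [mul_comm]

/-- The inverse of `M` on the span of its top eigenvectors. -/
lemma IsTopEigenvectors.exists_inverse (h : IsTopEigenvectors M G) (hM : M.IsHermitian)
    (hs : s ≤ n) (h0 : 0 < eigval M (s - 1)) :
    ∃ R : Matrix (Fin n) (Fin n) ℝ, M * R = G * Gᵀ ∧ R * (G * Gᵀ) = R ∧ (G * Gᵀ) * R = R ∧
      ‖R‖ ≤ (eigval M (s - 1))⁻¹ := by
  obtain ⟨V, hV, hG⟩ := h.exists_basis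
  have hd : ∀ i : Fin n, (i : ℕ) < s → eigval M (s - 1) ≤ eigval M i := fun i hi =>
    eigval_anti hM (by omega) (by omega)
  refine ⟨V * Matrix.diagonal (fun i : Fin n => if (i : ℕ) < s then (eigval M i)⁻¹ else 0) * Vᵀ,
    ?_, ?_, ?_, ?_⟩
  · rw [hG]
    nth_rw 1 [hV.eq]
    rw [conj_diagonal_mul hV.orth]
    congr 3
    ext i
    split_ifs with hi
    · exact mul_inv_cancel₀ (h0.trans_le (hd i hi)).ne'
    · simp
  · rw [hG, conj_diagonal_mul hV.orth]
    congr 3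
    ext i
    split_ifs <;> simp
  · rw [hG, conj_diagonal_mul hV.orth]
    congr 3
    ext i
    split_ifs <;> simp
  · refine norm_conj_diagonal_le hV.orth _ (inv_nonneg.mpr h0.le) fun i => ?_
    split_ifs with hi
    · rw [abs_of_nonneg (inv_nonneg.mpr (h0.le.trans (hd i hi)))]
      exact inv_anti₀ h0 (hd i hi)
    · simpa using h0.le

/-- Deflating the top `s` eigenvectors shifts the eigenvalues by `s`. -/
lemma IsTopEigenvectors.eigval_deflate (h : IsTopEigenvectors M G) (hM : M.PosSemidef)
    (i : ℕ) :
    eigval ((1 - G * Gᵀ) * M * (1 - G * Gᵀ)) i = eigval M (s + i) := by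
  rcases lt_or_ge i n with hi | hi
  swap
  · rw [eigval_of_le _ hi, eigval_of_le _ (by omega)]
  obtain ⟨V, hV, hG⟩ := h.exists_basis
  set B := (1 - G * Gᵀ) * M * (1 - G * Gᵀ) with hB
  have hBpsd : B.PosSemidef := by
    have := hM.mul_mul_conjTranspose_same (1 - G * Gᵀ)
    rwa [Matrix.conjTranspose_eq_transpose_of_trivial, Matrix.transpose_sub,
      mul_transpose_transpose, Matrix.transpose_one] at this
  have hBV : B = V * Matrix.diagonal
      (fun j : Fin n => if (j : ℕ) < s then 0 else eigval M j) * Vᵀ := by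
    rw [hB, hG, hV.one_eq, conj_diagonal_sub]
    conv_lhs => rw [hV.eq]
    rw [conj_diagonal_mul hV.orth, conj_diagonal_mul hV.orth]
    congr 3
    ext j
    split_ifs <;> simp
  -- In the basis `V` the first `s` diagonal entries are replaced by zeros, which move to the end of
  -- the list because the other entries are nonnegative. The upper bound annihilates the coordinates
  -- `s, …, s + i - 1`; the lower bound tests on the span of the columns `s, …, s + i`.
  apply le_antisymm
  · have hT : Module.finrank ℝ (Fin i → ℝ) ≤ i := (finrank_pi_fin i).le
    let f : Fin i → (Fin n → ℝ) →ₗ[ℝ] ℝ := fun j =>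
      if hj : s + j < n then (LinearMap.proj ⟨s + j, hj⟩) ∘ₗ Vᵀ.mulVecLin else 0
    refine eigval_le_of_ker hBpsd.1 (LinearMap.pi f) hi hT fun x hx => ?_
    have hxz : ∀ j : Fin n, s ≤ (j : ℕ) → (j : ℕ) < s + i → (Vᵀ *ᵥ x) j = 0 := by
      intro j h1 h2
      have h3 := congrFun hx ⟨j - s, by omega⟩
      have h4 : s + ((j : ℕ) - s) = j := by omega
      simp only [LinearMap.pi_apply, f, h4, j.2, dif_pos, Pi.zero_apply] at h3
      exact h3
    rw [hBV, dotProduct_conj_diagonal, dotProduct_self_eq_sum hV.orth', Finset.mul_sum]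
    refine Finset.sum_le_sum fun j _ => ?_
    split_ifs with hj
    · rw [zero_mul]; exact mul_nonneg (eigval_nonneg hM _) (sq_nonneg _)
    · rcases lt_or_ge (j : ℕ) (s + i) with hj2 | hj2
      · rw [hxz j (by omega) hj2]; simp
      · exact mul_le_mul_of_nonneg_right (eigval_anti_of_posSemidef hM hj2) (sq_nonneg _)
  · rcases lt_or_ge (s + i) n with hsi | hsi
    swap
    · rw [eigval_of_le _ hsi]; exact eigval_nonneg hBpsd i
    let e : Fin (i + 1) → Fin n := fun j => ⟨s + j, by omega⟩
    have he : Function.Injective e := by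
      intro a b hab
      simp only [e, Fin.mk.injEq] at hab
      ext; omega
    let W : Matrix (Fin n) (Fin (i + 1)) ℝ := V.submatrix id e
    have hVW : Vᵀ * W = (1 : Matrix (Fin n) (Fin n) ℝ).submatrix id e := by
      rw [← hV.orth]; rfl
    have hW : Wᵀ * W = 1 := by
      have : Wᵀ * W = (Vᵀ * V).submatrix e e := rfl
      rw [this, hV.orth, Matrix.submatrix_one _ he]
    refine le_eigval_of_range hBpsd.1 W.mulVecLin (fun x y hxy => ?_) hi
      (by rw [finrank_pi_fin]; omega) fun y => ?_
    · have := congrArg (Wᵀ *ᵥ ·) hxy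
      simpa [Matrix.mulVec_mulVec, hW] using this
    · rw [hBV, dotProduct_conj_diagonal, dotProduct_self_eq_sum hV.orth', Finset.mul_sum]
      refine Finset.sum_le_sum fun j _ => ?_
      rw [Matrix.mulVecLin_apply, Matrix.mulVec_mulVec, hVW]
      split_ifs with hj
      · have : ((1 : Matrix (Fin n) (Fin n) ℝ).submatrix id e *ᵥ y) j = 0 := by
          rw [Matrix.mulVec, dotProduct]
          refine Finset.sum_eq_zero fun l _ => ?_
          rw [Matrix.submatrix_apply, Matrix.one_apply_ne, zero_mul]
          intro h
          have : (j : ℕ) = s + l := congrArg Fin.val h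
          omega
        rw [this]; simp
      · rcases lt_or_ge (s + i) (j : ℕ) with hj2 | hj2
        · have : ((1 : Matrix (Fin n) (Fin n) ℝ).submatrix id e *ᵥ y) j = 0 := by
            rw [Matrix.mulVec, dotProduct]
            refine Finset.sum_eq_zero fun l _ => ?_
            rw [Matrix.submatrix_apply, Matrix.one_apply_ne, zero_mul]
            intro h
            have : (j : ℕ) = s + l := congrArg Fin.val h
            omega
          rw [this]; simp
        · exact mul_le_mul_of_nonneg_right (eigval_anti_of_posSemidef hM hj2) (sq_nonneg _)

end top

/-! ### Distance between the ranges of two matrices with orthonormal columns -/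

lemma dotProduct_one_sub_mul_mulVec {n : ℕ} {κ ι : Type*} [Fintype κ] [DecidableEq κ]
    [Fintype ι] [DecidableEq ι] (A : Matrix (Fin n) κ ℝ) (B : Matrix (Fin n) ι ℝ)
    (hA : Aᵀ * A = 1) (hB : Bᵀ * B = 1) (x : κ → ℝ) :
    (((1 - B * Bᵀ) * A) *ᵥ x) ⬝ᵥ (((1 - B * Bᵀ) * A) *ᵥ x)
      = x ⬝ᵥ x - ((Bᵀ * A) *ᵥ x) ⬝ᵥ ((Bᵀ * A) *ᵥ x) := by
  have e1 : ((1 - B * Bᵀ) * A)ᵀ * ((1 - B * Bᵀ) * A) = 1 - (Bᵀ * A)ᵀ * (Bᵀ * A) := by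
    simp only [Matrix.transpose_mul, Matrix.transpose_sub, Matrix.transpose_transpose,
      Matrix.sub_mul, Matrix.mul_sub, Matrix.one_mul, Matrix.mul_assoc, hA]
    rw [← Matrix.mul_assoc Bᵀ B (Bᵀ * A), hB, Matrix.one_mul]
    abel_nf
  rw [dotProduct_mulVec_transpose, Matrix.mulVec_mulVec, e1, Matrix.sub_mulVec,
    sub_dotProduct, dotProduct_mulVec_transpose (Bᵀ * A), Matrix.mulVec_mulVec,
    Matrix.one_mulVec]

/-- For two matrices with the same number of orthonormal columns the distance of the
ranges is symmetric. -/
lemma norm_one_sub_mul_le {n : ℕ} {κ ι : Type*} [Fintype κ] [DecidableEq κ] [Fintype ι]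
    [DecidableEq ι] (hcard : Fintype.card κ = Fintype.card ι) (A : Matrix (Fin n) κ ℝ)
    (B : Matrix (Fin n) ι ℝ)
    (hA : Aᵀ * A = 1) (hB : Bᵀ * B = 1) {d : ℝ} (hd : 0 ≤ d) (hd1 : d < 1)
    (h : ‖(1 - B * Bᵀ) * A‖ ≤ d) : ‖(1 - A * Aᵀ) * B‖ ≤ d := by
  set T := Bᵀ * A with hT
  have hT2 : Aᵀ * B = Tᵀ := by rw [hT, Matrix.transpose_mul, Matrix.transpose_transpose]
  have hd2 : 0 < 1 - d ^ 2 := by nlinarith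
  have lower : ∀ x, (1 - d ^ 2) * (x ⬝ᵥ x) ≤ (T *ᵥ x) ⬝ᵥ (T *ᵥ x) := by
    intro x
    have h1 := dotProduct_mulVec_self_le ((1 - B * Bᵀ) * A) x
    rw [dotProduct_one_sub_mul_mulVec A B hA hB] at h1
    have h2 : ‖(1 - B * Bᵀ) * A‖ ^ 2 * (x ⬝ᵥ x) ≤ d ^ 2 * (x ⬝ᵥ x) :=
      mul_le_mul_of_nonneg_right (pow_le_pow_left₀ (norm_nonneg _) h 2)
        (dotProduct_self_nonneg' x)
    linarith
  have hinj : Function.Injective T.mulVecLin := by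
    rw [injective_iff_map_eq_zero]
    intro x hx
    by_contra hx0
    have h1 := lower x
    rw [Matrix.mulVecLin_apply] at hx
    rw [hx, zero_dotProduct] at h1
    nlinarith [dotProduct_self_pos hx0]
  -- The bound `d < 1` makes `T = Bᵀ * A` injective, hence bijective as both column counts agree.
  -- Writing `x = T z` transfers the lower bound on the singular values from `T` to `Tᵀ`.
  have hsurj : Function.Surjective T.mulVecLin :=
    (LinearMap.injective_iff_surjective_of_finrank_eq_finrank (by
      rw [Module.finrank_pi, Module.finrank_pi, hcard])).mp hinj
  refine norm_le_of_dotProduct_mulVec_self_le _ hd fun x => ?_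
  rw [dotProduct_one_sub_mul_mulVec B A hB hA, hT2]
  obtain ⟨z, hz⟩ := hsurj x
  rw [Matrix.mulVecLin_apply] at hz
  have h1 := lower z
  rw [hz] at h1
  have h2 : (x ⬝ᵥ x) ≤ √((Tᵀ *ᵥ x) ⬝ᵥ (Tᵀ *ᵥ x)) * √(z ⬝ᵥ z) := by
    calc x ⬝ᵥ x = x ⬝ᵥ T *ᵥ z := by rw [hz]
      _ = (Tᵀ *ᵥ x) ⬝ᵥ z := dotProduct_mulVec_transpose _ _ _
      _ ≤ _ := dotProduct_le_sqrt _ _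
  have hx := dotProduct_self_nonneg' x
  have hz0 := dotProduct_self_nonneg' z
  have ht := dotProduct_self_nonneg' (Tᵀ *ᵥ x)
  have h3 : (x ⬝ᵥ x) ^ 2 ≤ ((Tᵀ *ᵥ x) ⬝ᵥ (Tᵀ *ᵥ x)) * (z ⬝ᵥ z) := by
    have := pow_le_pow_left₀ hx h2 2
    rwa [mul_pow, Real.sq_sqrt ht, Real.sq_sqrt hz0] at this
  rcases hx.eq_or_lt with h0 | h0
  · rw [← h0]; nlinarith
  · have h4 : (1 - d ^ 2) * (x ⬝ᵥ x) ^ 2 ≤ ((Tᵀ *ᵥ x) ⬝ᵥ (Tᵀ *ᵥ x)) * (x ⬝ᵥ x) := by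
      calc _ ≤ (1 - d ^ 2) * (((Tᵀ *ᵥ x) ⬝ᵥ (Tᵀ *ᵥ x)) * (z ⬝ᵥ z)) := by gcongr
        _ = ((Tᵀ *ᵥ x) ⬝ᵥ (Tᵀ *ᵥ x)) * ((1 - d ^ 2) * (z ⬝ᵥ z)) := by ring
        _ ≤ _ := by gcongr
    have h5 : (1 - d ^ 2) * (x ⬝ᵥ x) ≤ (Tᵀ *ᵥ x) ⬝ᵥ (Tᵀ *ᵥ x) := by
      refine le_of_mul_le_mul_right ?_ h0
      linarith [h4, sq (x ⬝ᵥ x)]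
    linarith

/-! ### A Hoeffding inequality for vectors -/

section hoeffding

lemma hasSum_cosh_mul (c x : ℝ) :
    HasSum (fun k : ℕ => c ^ (2 * k) * (x ^ 2) ^ k / (2 * k).factorial) (Real.cosh (c * x)) := by
  have := Real.hasSum_cosh (c * x)
  convert this using 2 with k
  rw [mul_pow, ← pow_mul x]

/-- The power series of cosh(c‖·‖) in the squared norm has nonnegative coefficients, so the function
is convex in ‖·‖². The value ‖x + u‖² is at most a convex combination of (‖x‖ + B)² and (‖x‖ - B)²
with weights affine in ⟨x, u⟩. The resulting bound is affine in `u`, which is what makes it useful: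
its linear part has mean zero. For `x = 0` the quotient is read as zero. -/
lemma cosh_norm_add_le {E : Type*} [NormedAddCommGroup E] [InnerProductSpace ℝ E] (x u : E)
    {B c : ℝ} (hB : 0 < B) (hu : ‖u‖ ≤ B) (hc : 0 ≤ c) :
    Real.cosh (c * ‖x + u‖) ≤ Real.cosh (c * ‖x‖) * Real.cosh (c * B) +
      Real.sinh (c * ‖x‖) * Real.sinh (c * B) / (‖x‖ * B) * inner ℝ x u := by
  rcases eq_or_ne x 0 with rfl | hx
  · simp only [zero_add, norm_zero, mul_zero, Real.cosh_zero, one_mul, inner_zero_left, add_zero]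
    rw [Real.cosh_le_cosh, abs_of_nonneg (by positivity), abs_of_nonneg (by positivity)]
    gcongr
  have ha : 0 < ‖x‖ := norm_pos_iff.mpr hx
  set a := ‖x‖ with hadef
  set p : ℝ := inner ℝ x u with hp
  have hpabs : |p| ≤ a * B := (abs_real_inner_le_norm x u).trans (by gcongr)
  have hs : ‖x + u‖ ^ 2 ≤ a ^ 2 + 2 * p + B ^ 2 := by
    rw [norm_add_sq_real]
    have : ‖u‖ ^ 2 ≤ B ^ 2 := pow_le_pow_left₀ (norm_nonneg _) hu 2
    linarith
  set θ : ℝ := (1 + p / (a * B)) / 2 with hθ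
  have hab : 0 < a * B := mul_pos ha hB
  have h1 : |p / (a * B)| ≤ 1 := by
    rw [abs_div, abs_of_pos hab, div_le_one hab]; exact hpabs
  have hθ0 : 0 ≤ θ := by have := (abs_le.mp h1).1; rw [hθ]; linarith
  have hθ1 : 0 ≤ 1 - θ := by have := (abs_le.mp h1).2; rw [hθ]; linarith
  have hcomb : a ^ 2 + 2 * p + B ^ 2 = θ * (a + B) ^ 2 + (1 - θ) * (a - B) ^ 2 := by
    rw [hθ]; field_simp; ring
  have hle := hasSum_le (f := fun k : ℕ => c ^ (2 * k) * (‖x + u‖ ^ 2) ^ k / (2 * k).factorial)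
    (g := fun k : ℕ => θ * (c ^ (2 * k) * ((a + B) ^ 2) ^ k / (2 * k).factorial)
      + (1 - θ) * (c ^ (2 * k) * ((a - B) ^ 2) ^ k / (2 * k).factorial))
    (fun k => by
      have h2 : (‖x + u‖ ^ 2) ^ k ≤ θ * ((a + B) ^ 2) ^ k + (1 - θ) * ((a - B) ^ 2) ^ k := by
        refine (pow_le_pow_left₀ (sq_nonneg _) (hs.trans hcomb.le) k).trans ?_
        exact (convexOn_pow k).2 (Set.mem_Ici.mpr (sq_nonneg (a + B)))
          (Set.mem_Ici.mpr (sq_nonneg (a - B))) hθ0 hθ1 (by ring)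
      calc _ = c ^ (2 * k) / (2 * k).factorial * (‖x + u‖ ^ 2) ^ k := by ring
        _ ≤ c ^ (2 * k) / (2 * k).factorial *
            (θ * ((a + B) ^ 2) ^ k + (1 - θ) * ((a - B) ^ 2) ^ k) := by
          gcongr
        _ = _ := by ring)
    (hasSum_cosh_mul c ‖x + u‖)
    (((hasSum_cosh_mul c (a + B)).mul_left θ).add ((hasSum_cosh_mul c (a - B)).mul_left (1 - θ)))
  refine hle.trans (le_of_eq ?_)
  rw [mul_add, mul_sub, Real.cosh_add, Real.cosh_sub, hθ]
  ring

variable {Ω : Type*} [MeasurableSpace Ω] {μ : Measure Ω} [IsProbabilityMeasure μ] {ι : Type*}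
  [Fintype ι]

lemma integral_inner_eq_zero_of_indepFun {Y X : Ω → EuclideanSpace ℝ ι} (h : IndepFun Y X μ) (hYi : ∀ i, Integrable (fun ω => Y ω i) μ)
    (hXi : ∀ i, Integrable (fun ω => X ω i) μ) (h0 : ∀ i, ∫ ω, X ω i ∂μ = 0) :
    Integrable (fun ω => inner ℝ (Y ω) (X ω)) μ ∧ ∫ ω, inner ℝ (Y ω) (X ω) ∂μ = 0 := by
  have hm : ∀ i : ι, Measurable fun x : EuclideanSpace ℝ ι => x i := fun i => by fun_prop
  have hind : ∀ i, IndepFun (fun ω => Y ω i) (fun ω => X ω i) μ := fun i =>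
    h.comp (hm i) (hm i)
  have hint : ∀ i, Integrable (fun ω => Y ω i * X ω i) μ := fun i =>
    (hind i).integrable_mul (hYi i) (hXi i)
  have heq : (fun ω => inner ℝ (Y ω) (X ω)) = fun ω => ∑ i, Y ω i * X ω i := by
    ext ω
    rw [PiLp.inner_apply]
    exact Finset.sum_congr rfl fun i _ => by simp [mul_comm]
  rw [heq]
  refine ⟨integrable_finsetSum _ fun i _ => hint i, ?_⟩
  rw [integral_finsetSum _ fun i _ => hint i]
  refine Finset.sum_eq_zero fun i _ => ?_
  have := (hind i).integral_mul_eq_mul_integral (hYi i).aestronglyMeasurable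
    (hXi i).aestronglyMeasurable
  simp only [Pi.mul_apply] at this
  rw [this, h0 i, mul_zero]

lemma norm_sum_le_of_ae {X : ℕ → Ω → EuclideanSpace ℝ ι} {B : ℝ}
    (hb : ∀ t, ∀ᵐ ω ∂μ, ‖X t ω‖ ≤ B) (s : Finset ℕ) :
    ∀ᵐ ω ∂μ, ‖∑ t ∈ s, X t ω‖ ≤ s.card * B := by
  filter_upwards [ae_all_iff.mpr hb] with ω hω
  refine (norm_sum_le _ _).trans ?_
  refine (Finset.sum_le_sum fun t _ => hω t).trans ?_
  simp

lemma integrable_cosh_norm_sum {X : ℕ → Ω → EuclideanSpace ℝ ι} {B : ℝ} (hB : 0 < B)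
    (hm : ∀ t, Measurable (X t)) (hb : ∀ t, ∀ᵐ ω ∂μ, ‖X t ω‖ ≤ B) {c : ℝ} (hc : 0 ≤ c)
    (s : Finset ℕ) : Integrable (fun ω => Real.cosh (c * ‖∑ t ∈ s, X t ω‖)) μ := by
  have hS : Measurable fun ω => ∑ t ∈ s, X t ω := Finset.measurable_sum s fun t _ => hm t
  refine Integrable.of_bound
    (Real.measurable_cosh.comp (hS.norm.const_mul c)).aestronglyMeasurable
    (Real.cosh (c * (s.card * B))) ?_
  filter_upwards [norm_sum_le_of_ae hb s] with ω hω
  rw [Real.norm_of_nonneg (Real.cosh_pos _).le, Real.cosh_le_cosh,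
    abs_of_nonneg (by positivity), abs_of_nonneg (by positivity)]
  gcongr

/-- Adding one summand multiplies the expectation by at most cosh(cB). In the bound of
`cosh_norm_add_le` the inner product is taken between a function of the previous sum and an
independent centred vector, so it integrates to zero. -/
lemma integral_cosh_norm_sum_le {X : ℕ → Ω → EuclideanSpace ℝ ι} {B : ℝ} (hB : 0 < B)
    (hm : ∀ t, Measurable (X t)) (hb : ∀ t, ∀ᵐ ω ∂μ, ‖X t ω‖ ≤ B) (hind : iIndepFun X μ)
    (h0 : ∀ t i, ∫ ω, X t ω i ∂μ = 0) {c : ℝ} (hc : 0 ≤ c) (s : Finset ℕ) :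
    ∫ ω, Real.cosh (c * ‖∑ t ∈ s, X t ω‖) ∂μ ≤ Real.cosh (c * B) ^ s.card := by
  classical
  induction s using Finset.induction_on with
  | empty => simp
  | insert t s hts ih =>
    rw [Finset.card_insert_of_notMem hts]
    set S : Ω → EuclideanSpace ℝ ι := fun ω => ∑ t ∈ s, X t ω with hS
    have hSm : Measurable S := Finset.measurable_sum s fun t _ => hm t
    let κ : EuclideanSpace ℝ ι → ℝ := fun x =>
      Real.sinh (c * ‖x‖) * Real.sinh (c * B) / (‖x‖ * B)
    have hκm : Measurable fun x : EuclideanSpace ℝ ι => κ x • x := by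
      have : Measurable κ := by
        refine Measurable.div ?_ (measurable_norm.mul_const B)
        exact (Real.measurable_sinh.comp (measurable_norm.const_mul c)).mul_const _
      exact this.smul measurable_id
    have hSX : IndepFun S (X t) μ := by
      have := hind.indepFun_finsetSum_of_notMem hm hts
      convert this using 1
      ext ω; simp [hS]
    have hYX : IndepFun (fun ω => κ (S ω) • S ω) (X t) μ := hSX.comp hκm measurable_id
    have hYbd : ∀ᵐ ω ∂μ, ‖κ (S ω) • S ω‖ ≤
        Real.sinh (c * (s.card * B)) * Real.sinh (c * B) / B := by
      filter_upwards [norm_sum_le_of_ae hb s] with ω hω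
      have hsB : 0 ≤ Real.sinh (c * B) := Real.sinh_nonneg_iff.mpr (by positivity)
      have hsn : 0 ≤ Real.sinh (c * ‖S ω‖) := Real.sinh_nonneg_iff.mpr (by positivity)
      have hle : Real.sinh (c * ‖S ω‖) ≤ Real.sinh (c * (s.card * B)) :=
        Real.sinh_le_sinh.mpr (by gcongr)
      rw [norm_smul, Real.norm_of_nonneg (by positivity)]
      calc κ (S ω) * ‖S ω‖ ≤ Real.sinh (c * ‖S ω‖) * Real.sinh (c * B) / B := by
            rcases eq_or_ne (‖S ω‖) 0 with h | h
            · rw [h]; simp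
            · refine le_of_eq ?_
              simp only [κ]; field_simp
        _ ≤ _ := by gcongr
    have hcoord : ∀ (x : EuclideanSpace ℝ ι) i, ‖x i‖ ≤ ‖x‖ := fun x i => PiLp.norm_apply_le x i
    have hYi : ∀ i, Integrable (fun ω => (κ (S ω) • S ω) i) μ := fun i => by
      have hmi : Measurable fun x : EuclideanSpace ℝ ι => x i := by fun_prop
      refine Integrable.of_bound (hmi.comp (hκm.comp hSm)).aestronglyMeasurable
        (Real.sinh (c * (s.card * B)) * Real.sinh (c * B) / B) ?_
      filter_upwards [hYbd] with ω hω
      exact (hcoord _ i).trans hω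
    have hXi : ∀ i, Integrable (fun ω => X t ω i) μ := fun i => by
      have hmi : Measurable fun x : EuclideanSpace ℝ ι => x i := by fun_prop
      refine Integrable.of_bound (hmi.comp (hm t)).aestronglyMeasurable B ?_
      filter_upwards [hb t] with ω hω
      exact (hcoord _ i).trans hω
    obtain ⟨hI, hI0⟩ := integral_inner_eq_zero_of_indepFun hYX hYi hXi (h0 t)
    have hI1 : Integrable (fun ω => Real.cosh (c * ‖S ω‖) * Real.cosh (c * B)) μ :=
      (integrable_cosh_norm_sum hB hm hb hc s).mul_const _
    calc ∫ ω, Real.cosh (c * ‖∑ t ∈ insert t s, X t ω‖) ∂μ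
        ≤ ∫ ω, (Real.cosh (c * ‖S ω‖) * Real.cosh (c * B) + inner ℝ (κ (S ω) • S ω) (X t ω)) ∂μ := by
          refine integral_mono_ae (integrable_cosh_norm_sum hB hm hb hc _) (hI1.add hI) ?_
          filter_upwards [hb t] with ω hω
          rw [Finset.sum_insert hts, add_comm]
          refine (cosh_norm_add_le (S ω) (X t ω) hB hω hc).trans (le_of_eq ?_)
          rw [real_inner_smul_left]
      _ = (∫ ω, Real.cosh (c * ‖S ω‖) ∂μ) * Real.cosh (c * B) := by
          rw [integral_add hI1 hI, hI0, add_zero, integral_mul_const]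
      _ ≤ Real.cosh (c * B) ^ s.card * Real.cosh (c * B) :=
          mul_le_mul_of_nonneg_right ih (Real.cosh_pos _).le
      _ = _ := (pow_succ _ _).symm

/-- **Hoeffding's inequality** for sums of independent bounded vectors (Pinelis). -/
lemma measureReal_norm_sum_ge_le {X : ℕ → Ω → EuclideanSpace ℝ ι} {B : ℝ} (hB : 0 < B)
    (hm : ∀ t, Measurable (X t)) (hb : ∀ t, ∀ᵐ ω ∂μ, ‖X t ω‖ ≤ B) (hind : iIndepFun X μ)
    (h0 : ∀ t i, ∫ ω, X t ω i ∂μ = 0) (s : Finset ℕ) {ε : ℝ} (hε : 0 ≤ ε) :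
    μ.real {ω | s.card * (ε * B) ≤ ‖∑ t ∈ s, X t ω‖} ≤ 2 * Real.exp (-(s.card * ε ^ 2 / 2)) := by
  -- This choice optimizes the exponent in cosh(cB)^N ≤ exp(N(cB)²/2) against the Markov level
  -- exp(cNεB) / 2.
  set c : ℝ := ε / B with hcdef
  have hc : 0 ≤ c := by positivity
  have hcB : c * B = ε := by rw [hcdef]; field_simp
  set N : ℝ := (s.card : ℝ) with hN
  have hN0 : 0 ≤ N := by positivity
  have hI := integrable_cosh_norm_sum hB hm hb hc s
  have hmarkov := mul_meas_ge_le_integral_of_nonneg (μ := μ)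
    (Filter.Eventually.of_forall fun ω => (Real.cosh_pos (c * ‖∑ t ∈ s, X t ω‖)).le) hI
    (Real.exp (N * ε ^ 2) / 2)
  have hsub : {ω | N * (ε * B) ≤ ‖∑ t ∈ s, X t ω‖} ⊆
      {ω | Real.exp (N * ε ^ 2) / 2 ≤ Real.cosh (c * ‖∑ t ∈ s, X t ω‖)} := by
    intro ω hω
    rw [Set.mem_ofPred_eq] at hω ⊢
    have h1 : N * ε ^ 2 ≤ c * ‖∑ t ∈ s, X t ω‖ := by
      calc N * ε ^ 2 = c * (N * (ε * B)) := by rw [← hcB]; ring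
        _ ≤ _ := by gcongr
    have h2 := Real.exp_le_exp.mpr h1
    rw [Real.cosh_eq]
    have := Real.exp_pos (-(c * ‖∑ t ∈ s, X t ω‖))
    linarith
  have h3 : Real.cosh (c * B) ^ s.card ≤ Real.exp (N * ε ^ 2 / 2) := by
    rw [hcB]
    calc Real.cosh ε ^ s.card ≤ Real.exp (ε ^ 2 / 2) ^ s.card :=
          pow_le_pow_left₀ (Real.cosh_pos _).le (Real.cosh_le_exp_half_sq ε) _
      _ = _ := by rw [← Real.exp_nat_mul]; congr 1; rw [← hN]; ring
  have h4 := integral_cosh_norm_sum_le hB hm hb hind h0 hc s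
  have h5 : μ.real {ω | N * (ε * B) ≤ ‖∑ t ∈ s, X t ω‖} * (Real.exp (N * ε ^ 2) / 2) ≤
      Real.exp (N * ε ^ 2 / 2) := by
    calc _ ≤ μ.real {ω | Real.exp (N * ε ^ 2) / 2 ≤ Real.cosh (c * ‖∑ t ∈ s, X t ω‖)} *
          (Real.exp (N * ε ^ 2) / 2) := by
          exact mul_le_mul_of_nonneg_right (measureReal_mono hsub (measure_ne_top μ _))
            (by positivity)
      _ ≤ _ := by rw [mul_comm]; exact hmarkov.trans (h4.trans h3)
  have h6 : Real.exp (N * ε ^ 2 / 2) =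
      2 * Real.exp (-(N * ε ^ 2 / 2)) * (Real.exp (N * ε ^ 2) / 2) := by
    have : Real.exp (N * ε ^ 2 / 2) = Real.exp (-(N * ε ^ 2 / 2)) * Real.exp (N * ε ^ 2) := by
      rw [← Real.exp_add]; congr 1; ring
    rw [this]; ring
  rw [h6] at h5
  exact le_of_mul_le_mul_right h5 (by positivity)

end hoeffding

/-! ### Concentration of weighted empirical covariances -/

section frobenius

variable {m n k l : Type*} [Fintype m] [Fintype n] [Fintype k] [Fintype l]
  [DecidableEq m] [DecidableEq n] [DecidableEq k] [DecidableEq l]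

/-- A matrix as a vector, so that the Euclidean norm is the Frobenius norm. -/
noncomputable def flatten (X : Matrix m n ℝ) : EuclideanSpace ℝ (m × n) :=
  WithLp.toLp 2 fun p => X p.1 p.2

lemma flatten_apply (X : Matrix m n ℝ) (p : m × n) : flatten X p = X p.1 p.2 := rfl

lemma flatten_sum {ι : Type*} (s : Finset ι) (X : ι → Matrix m n ℝ) :
    flatten (∑ t ∈ s, X t) = ∑ t ∈ s, flatten (X t) := by
  ext p
  simp [flatten_apply, Matrix.sum_apply]

lemma norm_flatten_sq (X : Matrix m n ℝ) : ‖flatten X‖ ^ 2 = ∑ j, ∑ i, X i j ^ 2 := by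
  rw [EuclideanSpace.norm_sq_eq, Fintype.sum_prod_type, Finset.sum_comm]
  simp [flatten_apply]

lemma norm_flatten_transpose (X : Matrix m n ℝ) : ‖flatten Xᵀ‖ = ‖flatten X‖ := by
  rw [← sq_eq_sq₀ (norm_nonneg _) (norm_nonneg _), norm_flatten_sq, norm_flatten_sq,
    Finset.sum_comm]
  rfl

/-- This is how the tail bound for Euclidean vectors reaches operator norms. The price is the factor
`r` in the almost sure bound of the summands, which accounts for the r² in the sample size. -/
lemma norm_le_norm_flatten (X : Matrix m n ℝ) : ‖X‖ ≤ ‖flatten X‖ := by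
  refine norm_le_of_dotProduct_mulVec_self_le X (norm_nonneg _) fun x => ?_
  rw [norm_flatten_sq, Finset.sum_comm, Finset.sum_mul]
  refine Finset.sum_le_sum fun i _ => ?_
  have := Finset.sum_mul_sq_le_sq_mul_sq Finset.univ (fun j => X i j) x
  simpa [Matrix.mulVec, dotProduct, sq] using this

lemma norm_flatten_mul_le (A : Matrix m n ℝ) (X : Matrix n k ℝ) :
    ‖flatten (A * X)‖ ≤ ‖A‖ * ‖flatten X‖ := by
  refine le_of_sq_le_sq ?_ (by positivity)
  rw [mul_pow, norm_flatten_sq, norm_flatten_sq, Finset.mul_sum]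
  refine Finset.sum_le_sum fun j _ => ?_
  have := dotProduct_mulVec_self_le A (fun i => X i j)
  simpa [Matrix.mulVec, dotProduct, sq, Matrix.mul_apply] using this

lemma norm_flatten_mul_mul_transpose_le (A : Matrix m n ℝ) (X : Matrix n k ℝ)
    (B : Matrix l k ℝ) : ‖flatten (A * X * Bᵀ)‖ ≤ ‖A‖ * ‖B‖ * ‖flatten X‖ := by
  rw [← norm_flatten_transpose, Matrix.transpose_mul, Matrix.transpose_transpose,
    Matrix.transpose_mul]
  calc _ ≤ ‖B‖ * ‖flatten (Xᵀ * Aᵀ)‖ := norm_flatten_mul_le _ _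
    _ = ‖B‖ * ‖flatten (A * X)‖ := by rw [← norm_flatten_transpose (A * X), Matrix.transpose_mul]
    _ ≤ ‖B‖ * (‖A‖ * ‖flatten X‖) := by gcongr; exact norm_flatten_mul_le _ _
    _ = _ := by ring

end frobenius

section whitening

variable {r : ℕ} (lam : Fin r → ℝ)

/-- The coefficients rescaled to unit variance. -/
noncomputable def whiten (x : Fin r → ℝ) : Fin r → ℝ := fun i => x i / √(lam i)

/-- The deviation `b b' - I` of the rescaled coefficients. -/
noncomputable def whitenDev (x : Fin r → ℝ) : Matrix (Fin r) (Fin r) ℝ :=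
  Matrix.vecMulVec (whiten lam x) (whiten lam x) - 1

variable {lam}

/-- With X = ‖b‖² the squared Frobenius norm of b b' - I is X² - 2X + r. This is convex in X, and X
lies in [0, ηr]; at both endpoints the value is at most (ηr)². -/
lemma norm_flatten_whitenDev_le (hlam : ∀ i, 0 < lam i) {η : ℝ} (hη : 1 ≤ η) (hr : 2 ≤ r)
    {x : Fin r → ℝ} (hx : ∀ i, x i ^ 2 ≤ η * lam i) :
    ‖flatten (whitenDev lam x)‖ ≤ η * r := by
  refine le_of_sq_le_sq ?_ (by positivity)
  set b := whiten lam x with hb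
  have hbi : ∀ i, b i ^ 2 ≤ η := fun i => by
    rw [hb, whiten, div_pow, Real.sq_sqrt (hlam i).le, div_le_iff₀ (hlam i)]
    exact hx i
  set X := ∑ i, b i ^ 2 with hX
  have hX0 : 0 ≤ X := Finset.sum_nonneg fun i _ => sq_nonneg _
  have hX1 : X ≤ η * r := by
    calc X ≤ ∑ _i : Fin r, η := Finset.sum_le_sum fun i _ => hbi i
      _ = _ := by simp [mul_comm]
  have hrow : ∀ j, ∑ i, (whitenDev lam x) i j ^ 2 = b j ^ 2 * X - 2 * b j ^ 2 + 1 := by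
    intro j
    have : ∀ i, (whitenDev lam x) i j ^ 2
        = b j ^ 2 * b i ^ 2 + (if i = j then - 2 * b j ^ 2 + 1 else 0) := by
      intro i
      rw [whitenDev, Matrix.sub_apply, Matrix.vecMulVec_apply, ← hb, Matrix.one_apply]
      split_ifs with h
      · rw [h]; ring
      · ring
    simp_rw [this]
    rw [Finset.sum_add_distrib, ← Finset.mul_sum, ← hX]
    simp
    ring
  have htot : ‖flatten (whitenDev lam x)‖ ^ 2 = X * X - 2 * X + r := by
    rw [norm_flatten_sq]
    simp_rw [hrow]
    rw [Finset.sum_add_distrib, Finset.sum_sub_distrib, ← Finset.sum_mul, ← Finset.mul_sum, ← hX]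
    simp
  rw [htot]
  have hr' : (2 : ℝ) ≤ r := by exact_mod_cast hr
  have h2 : 2 ≤ η * r := by nlinarith
  nlinarith [mul_nonneg hX0 (sub_nonneg.mpr hX1), mul_nonneg (sub_nonneg.mpr h2) (sub_nonneg.mpr hX1)]

lemma measurable_whitenDev (i j : Fin r) : Measurable fun x => whitenDev lam x i j := by
  simp only [whitenDev, Matrix.sub_apply, Matrix.vecMulVec_apply, whiten]
  fun_prop

variable {Ω : Type*} [MeasurableSpace Ω] {μ : Measure Ω} [IsProbabilityMeasure μ] {η : ℝ}
  {a : ℕ → Ω → Fin r → ℝ}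

lemma CoeffModel.measurable_coord (ha : CoeffModel μ lam η a) (t : ℕ) (i : Fin r) :
    Measurable fun ω => a t ω i :=
  (measurable_pi_apply i).comp (ha.measurable t)

lemma CoeffModel.integrable_mul (ha : CoeffModel μ lam η a) (t : ℕ) (i j : Fin r) :
    Integrable (fun ω => a t ω i * a t ω j) μ := by
  refine Integrable.of_bound ((ha.measurable_coord t i).mul
    (ha.measurable_coord t j)).aestronglyMeasurable (η * lam i + η * lam j) ?_
  filter_upwards [ha.bounded t i, ha.bounded t j] with ω hi hj
  rw [Real.norm_eq_abs, abs_le]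
  constructor <;> nlinarith [sq_nonneg (a t ω i + a t ω j), sq_nonneg (a t ω i - a t ω j),
    sq_nonneg (a t ω i), sq_nonneg (a t ω j)]

lemma CoeffModel.one_le_eta (ha : CoeffModel μ lam η a) (i : Fin r) : 1 ≤ η := by
  have h1 := ha.covariance 0 i i
  rw [Matrix.diagonal_apply_eq] at h1
  have h2 : ∫ ω, a 0 ω i * a 0 ω i ∂μ ≤ ∫ _, η * lam i ∂μ := by
    refine integral_mono_ae (ha.integrable_mul 0 i i) (integrable_const _) ?_
    filter_upwards [ha.bounded 0 i] with ω h
    rw [← sq]; exact h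
  rw [h1, integral_const, probReal_univ, one_smul] at h2
  have := ha.lam_pos i
  nlinarith

lemma CoeffModel.integral_whitenDev (ha : CoeffModel μ lam η a) (t : ℕ) (i j : Fin r) :
    Integrable (fun ω => whitenDev lam (a t ω) i j) μ ∧
      ∫ ω, whitenDev lam (a t ω) i j ∂μ = 0 := by
  have heq : (fun ω => whitenDev lam (a t ω) i j) = fun ω =>
      a t ω i * a t ω j * (√(lam i) * √(lam j))⁻¹ - (1 : Matrix (Fin r) (Fin r) ℝ) i j := by
    ext ω
    simp only [whitenDev, Matrix.sub_apply, Matrix.vecMulVec_apply, whiten]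
    rw [div_mul_div_comm, div_eq_mul_inv]
  have hI := (ha.integrable_mul t i j).mul_const (√(lam i) * √(lam j))⁻¹
  rw [heq]
  refine ⟨hI.sub (integrable_const _), ?_⟩
  rw [integral_sub hI (integrable_const _), integral_mul_const, ha.covariance t i j,
    integral_const, probReal_univ, one_smul]
  rcases eq_or_ne i j with rfl | hij
  · rw [Matrix.diagonal_apply_eq, Matrix.one_apply_eq, Real.mul_self_sqrt (ha.lam_pos i).le,
      mul_inv_cancel₀ (ha.lam_pos i).ne', sub_self]
  · rw [Matrix.diagonal_apply_ne _ hij, Matrix.one_apply_ne hij]; simp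

variable {m k : Type*} [Fintype m] [Fintype k] [DecidableEq m] [DecidableEq k]

lemma measurable_flatten_conj (A : Matrix m (Fin r) ℝ) (B : Matrix k (Fin r) ℝ) :
    Measurable fun x => flatten (A * whitenDev lam x * Bᵀ) := by
  have h : Measurable fun x : Fin r → ℝ =>
      fun p : m × k => (A * whitenDev lam x * Bᵀ) p.1 p.2 := by
    refine measurable_pi_lambda _ fun p => ?_
    simp only [Matrix.mul_apply]
    refine Finset.measurable_sum _ fun j _ => Measurable.mul_const ?_ _
    exact Finset.measurable_sum _ fun i _ => (measurable_whitenDev i j).const_mul _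
  exact (PiLp.continuous_toLp 2 _).measurable.comp h

/-- Concentration of the weighted empirical covariance of the rescaled coefficients. -/
lemma CoeffModel.concentration (ha : CoeffModel μ lam η a) (hr : 2 ≤ r)
    {p₁ p₂ : ℝ} (A : ℕ → Matrix m (Fin r) ℝ) (B : ℕ → Matrix k (Fin r) ℝ)
    (hA : ∀ t, ‖A t‖ ≤ p₁) (hB : ∀ t, ‖B t‖ ≤ p₂) (s : Finset ℕ) {ε : ℝ} (hε : 0 ≤ ε) :
    MeasurableSet {ω | s.card * (ε * (p₁ * p₂)) <
        ‖flatten (∑ t ∈ s, A t * whitenDev lam (a t ω) * (B t)ᵀ)‖} ∧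
    μ.real {ω | s.card * (ε * (p₁ * p₂)) <
        ‖flatten (∑ t ∈ s, A t * whitenDev lam (a t ω) * (B t)ᵀ)‖} ≤
      2 * Real.exp (-(s.card * (ε / (η * r)) ^ 2 / 2)) := by
  have hη : 1 ≤ η := ha.one_le_eta ⟨0, by omega⟩
  have hr' : (2 : ℝ) ≤ r := by exact_mod_cast hr
  have hηr : 0 < η * r := by positivity
  set X : ℕ → Ω → EuclideanSpace ℝ (m × k) := fun t ω =>
    flatten (A t * whitenDev lam (a t ω) * (B t)ᵀ) with hX
  have hm : ∀ t, Measurable (X t) := fun t =>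
    (measurable_flatten_conj (A t) (B t)).comp (ha.measurable t)
  have hp1 : 0 ≤ p₁ := (norm_nonneg _).trans (hA 0)
  have hp2 : 0 ≤ p₂ := (norm_nonneg _).trans (hB 0)
  simp only [flatten_sum]
  refine ⟨measurableSet_lt measurable_const (Finset.measurable_sum s fun t _ => hm t).norm, ?_⟩
  -- Hoeffding's inequality needs a positive bound of the summands. If the bound is zero the sum
  -- vanishes, and the strict inequality makes the event empty.
  rcases (mul_nonneg hp1 hp2).eq_or_lt with hp | hp
  · have hempty : {ω | s.card * (ε * (p₁ * p₂)) <
        ‖∑ t ∈ s, flatten (A t * whitenDev lam (a t ω) * (B t)ᵀ)‖} = ∅ := by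
      refine Set.eq_empty_of_forall_notMem fun ω => ?_
      rw [Set.mem_ofPred_eq, not_lt, ← hp, mul_zero, mul_zero]
      refine (norm_sum_le _ _).trans (Finset.sum_nonpos fun t _ => ?_)
      refine (norm_flatten_mul_mul_transpose_le _ _ _).trans ?_
      have : ‖A t‖ * ‖B t‖ ≤ 0 := by
        rw [hp]; exact mul_le_mul (hA t) (hB t) (norm_nonneg _) hp1
      exact mul_nonpos_of_nonpos_of_nonneg this (norm_nonneg _)
    rw [hempty, measureReal_empty]
    positivity
  · have hb : ∀ t, ∀ᵐ ω ∂μ, ‖X t ω‖ ≤ p₁ * p₂ * (η * r) := by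
      intro t
      filter_upwards [ae_all_iff.mpr (ha.bounded t)] with ω hω
      refine (norm_flatten_mul_mul_transpose_le _ _ _).trans ?_
      exact mul_le_mul (mul_le_mul (hA t) (hB t) (norm_nonneg _) hp1)
        (norm_flatten_whitenDev_le ha.lam_pos hη hr hω) (norm_nonneg _) hp.le
    have hind : iIndepFun X μ :=
      ha.indep.comp _ fun t => measurable_flatten_conj (A t) (B t)
    have h0 : ∀ t i, ∫ ω, X t ω i ∂μ = 0 := by
      intro t p
      have heq : (fun ω => X t ω p) = fun ω =>
          ∑ j, (∑ i, A t p.1 i * whitenDev lam (a t ω) i j) * (B t)ᵀ j p.2 := by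
        ext ω
        simp only [hX, flatten_apply, Matrix.mul_apply]
      have hi : ∀ i j, Integrable (fun ω => A t p.1 i * whitenDev lam (a t ω) i j) μ :=
        fun i j => (ha.integral_whitenDev t i j).1.const_mul _
      rw [heq, integral_finsetSum _ fun j _ =>
        (integrable_finsetSum _ fun i _ => hi i j).mul_const _]
      refine Finset.sum_eq_zero fun j _ => ?_
      rw [integral_mul_const, integral_finsetSum _ fun i _ => hi i j]
      rw [Finset.sum_eq_zero, zero_mul]
      intro i _
      rw [integral_const_mul, (ha.integral_whitenDev t i j).2, mul_zero]
    have := measureReal_norm_sum_ge_le (mul_pos hp hηr) hm hb hind h0 s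
      (ε := ε / (η * r)) (by positivity)
    refine le_trans (measureReal_mono ?_ (measure_ne_top μ _)) this
    intro ω hω
    rw [Set.mem_ofPred_eq] at hω ⊢
    refine le_trans (le_of_eq ?_) hω.le
    field_simp

end whitening

/-! ### Repeated deflation -/

section deflation

variable {n : ℕ}

/-- The projection to the span of the columns of the first `k` matrices `G j`. -/
def cumProj {s : ℕ → ℕ} (G : ∀ k, Matrix (Fin n) (Fin (s k)) ℝ) (k : ℕ) :
    Matrix (Fin n) (Fin n) ℝ :=
  ∑ j ∈ Finset.range k, G j * (G j)ᵀ

/-- The deflated covariance matrix. -/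
def deflCov {s : ℕ → ℕ} (S : ℕ → Matrix (Fin n) (Fin n) ℝ)
    (G : ∀ k, Matrix (Fin n) (Fin (s k)) ℝ) (k : ℕ) : Matrix (Fin n) (Fin n) ℝ :=
  (1 - cumProj G k) * S k * (1 - cumProj G k)

/-- For `k < K`, the columns of `G k` span the top eigenvectors of the `k`-th deflated covariance
matrix, with positive eigenvalues. -/
structure IsDeflation {s : ℕ → ℕ} (S : ℕ → Matrix (Fin n) (Fin n) ℝ)
    (G : ∀ k, Matrix (Fin n) (Fin (s k)) ℝ) (K : ℕ) : Prop where
  psd : ∀ k, (S k).PosSemidef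
  top : ∀ k < K, IsTopEigenvectors (deflCov S G k) (G k)
  size_le : ∀ k < K, s k ≤ n
  pos : ∀ k < K, 0 < eigval (deflCov S G k) (s k - 1)

variable {s : ℕ → ℕ} {S : ℕ → Matrix (Fin n) (Fin n) ℝ}
  {G : ∀ k, Matrix (Fin n) (Fin (s k)) ℝ} {K : ℕ}

lemma cumProj_succ (k : ℕ) : cumProj G (k + 1) = cumProj G k + G k * (G k)ᵀ :=
  Finset.sum_range_succ _ _

lemma cumProj_zero : cumProj G 0 = 0 := Finset.sum_range_zero _

lemma cumProj_transpose (k : ℕ) : (cumProj G k)ᵀ = cumProj G k := by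
  rw [cumProj, Matrix.transpose_sum]
  exact Finset.sum_congr rfl fun j _ => mul_transpose_transpose _

lemma one_sub_cumProj_transpose (k : ℕ) : (1 - cumProj G k)ᵀ = 1 - cumProj G k := by
  rw [Matrix.transpose_sub, cumProj_transpose, Matrix.transpose_one]

lemma posSemidef_conj {A B : Matrix (Fin n) (Fin n) ℝ} (hA : A.PosSemidef) (hB : Bᵀ = B) :
    (B * A * B).PosSemidef := by
  have := hA.mul_mul_conjTranspose_same B
  rwa [Matrix.conjTranspose_eq_transpose_of_trivial, hB] at this

lemma IsDeflation.posSemidef (h : IsDeflation S G K) (k : ℕ) : (deflCov S G k).PosSemidef :=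
  posSemidef_conj (h.psd k) (one_sub_cumProj_transpose k)

lemma IsDeflation.mono (h : IsDeflation S G K) {K' : ℕ} (hK : K' ≤ K) : IsDeflation S G K' :=
  ⟨h.psd, fun k hk => h.top k (hk.trans_le hK), fun k hk => h.size_le k (hk.trans_le hK),
    fun k hk => h.pos k (hk.trans_le hK)⟩

lemma IsDeflation.exists_inverse (h : IsDeflation S G K) {k : ℕ} (hk : k < K) :
    ∃ R : Matrix (Fin n) (Fin n) ℝ, deflCov S G k * R = G k * (G k)ᵀ ∧
      R * (G k * (G k)ᵀ) = R ∧ (G k * (G k)ᵀ) * R = R ∧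
      ‖R‖ ≤ (eigval (deflCov S G k) (s k - 1))⁻¹ :=
  (h.top k hk).exists_inverse (h.posSemidef k).1 (h.size_le k hk) (h.pos k hk)

/-- The two claims feed each other. Idempotence of the cumulative projection Π_k makes it annihilate
the deflated matrix M_k from the left; positivity of the selected eigenvalues lets `G k * (G k)ᵀ` be
written as M_k R, so Π_k annihilates it too, and the next sum is again idempotent. -/
lemma IsDeflation.idem_aux (h : IsDeflation S G K) :
    ∀ k ≤ K, cumProj G k * cumProj G k = cumProj G k ∧
      (k < K → cumProj G k * (G k * (G k)ᵀ) = 0) := by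
  intro k
  induction k with
  | zero => intro _; simp [cumProj_zero]
  | succ k ih =>
    intro hk
    have hidem : cumProj G (k + 1) * cumProj G (k + 1) = cumProj G (k + 1) := by
      obtain ⟨h1, h2⟩ := ih (by omega)
      have h3 := h2 (by omega)
      have h4 := congrArg Matrix.transpose h3
      rw [Matrix.transpose_mul, mul_transpose_transpose, cumProj_transpose,
        Matrix.transpose_zero] at h4
      rw [cumProj_succ, Matrix.add_mul, Matrix.mul_add, Matrix.mul_add, h1, h3, h4,
        mul_transpose_idem (h.top k (by omega)).1]
      abel
    refine ⟨hidem, fun hk => ?_⟩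
    obtain ⟨R, hR, -⟩ := h.exists_inverse hk
    rw [← hR, deflCov]
    have h0 : cumProj G (k + 1) * (1 - cumProj G (k + 1)) = 0 := by
      rw [Matrix.mul_sub, hidem, Matrix.mul_one, sub_self]
    simp only [← Matrix.mul_assoc, h0, Matrix.zero_mul]

lemma IsDeflation.idem (h : IsDeflation S G K) {k : ℕ} (hk : k ≤ K) :
    cumProj G k * cumProj G k = cumProj G k := (h.idem_aux k hk).1

lemma IsDeflation.cumProj_mul (h : IsDeflation S G K) {k : ℕ} (hk : k < K) :
    cumProj G k * (G k * (G k)ᵀ) = 0 := (h.idem_aux k hk.le).2 hk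

lemma IsDeflation.mul_cumProj (h : IsDeflation S G K) {k : ℕ} (hk : k < K) :
    G k * (G k)ᵀ * cumProj G k = 0 := by
  have h4 := congrArg Matrix.transpose (h.cumProj_mul hk)
  rwa [Matrix.transpose_mul, mul_transpose_transpose, cumProj_transpose,
    Matrix.transpose_zero] at h4

lemma IsDeflation.one_sub_idem (h : IsDeflation S G K) {k : ℕ} (hk : k ≤ K) :
    (1 - cumProj G k) * (1 - cumProj G k) = 1 - cumProj G k := by
  rw [Matrix.mul_sub, Matrix.mul_one, Matrix.sub_mul, h.idem hk]
  simp

lemma IsDeflation.norm_one_sub_le (h : IsDeflation S G K) {k : ℕ} (hk : k ≤ K) :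
    ‖1 - cumProj G k‖ ≤ 1 :=
  norm_le_one_of_isIdempotent _ (one_sub_cumProj_transpose k) (h.one_sub_idem hk)

lemma IsDeflation.norm_gram_le (h : IsDeflation S G K) {k : ℕ} (hk : k < K) :
    ‖G k * (G k)ᵀ‖ ≤ 1 :=
  norm_le_one_of_isIdempotent _ (mul_transpose_transpose _) (mul_transpose_idem (h.top k hk).1)

lemma IsDeflation.mul_cumProj_of_lt (h : IsDeflation S G K) {j k : ℕ} (hjk : j < k)
    (hk : k ≤ K) : G j * (G j)ᵀ * cumProj G k = G j * (G j)ᵀ := by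
  induction k, hjk using Nat.le_induction with
  | base =>
    rw [Nat.succ_eq_add_one, cumProj_succ, Matrix.mul_add, h.mul_cumProj (by omega),
      mul_transpose_idem (h.top j (by omega)).1, zero_add]
  | succ k hjk ih =>
    have h1 := ih (by omega)
    rw [cumProj_succ, Matrix.mul_add, h1]
    nth_rw 2 [← h1]
    rw [Matrix.mul_assoc, h.cumProj_mul (by omega), Matrix.mul_zero, add_zero]

lemma IsDeflation.mul_one_sub_of_lt (h : IsDeflation S G K) {j k : ℕ} (hjk : j < k)
    (hk : k ≤ K) : G j * (G j)ᵀ * (1 - cumProj G k) = 0 := by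
  rw [Matrix.mul_sub, h.mul_cumProj_of_lt hjk hk, Matrix.mul_one, sub_self]

lemma IsDeflation.one_sub_mul_one_sub (h : IsDeflation S G K) {j k : ℕ} (hjk : j ≤ k)
    (hk : k ≤ K) : (1 - cumProj G j) * (1 - cumProj G k) = 1 - cumProj G k := by
  have : cumProj G j * (1 - cumProj G k) = 0 := by
    rw [cumProj, Finset.sum_mul]
    refine Finset.sum_eq_zero fun i hi => h.mul_one_sub_of_lt ?_ hk
    have := Finset.mem_range.mp hi
    omega
  rw [Matrix.sub_mul, this, Matrix.one_mul, sub_zero]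

/-- The span found in step `j` is invariant under the `j`-th covariance matrix, up to the spans
found before. -/
lemma IsDeflation.gram_mul_cov (h : IsDeflation S G K) {j k : ℕ} (hjk : j < k) (hk : k ≤ K) :
    G j * (G j)ᵀ * S j * (1 - cumProj G k) = 0 := by
  have h1 : G j * (G j)ᵀ * (1 - cumProj G j) = G j * (G j)ᵀ := by
    rw [Matrix.mul_sub, h.mul_cumProj (by omega), Matrix.mul_one, sub_zero]
  calc G j * (G j)ᵀ * S j * (1 - cumProj G k)
      = G j * (G j)ᵀ * (1 - cumProj G j) * S j *
          ((1 - cumProj G j) * (1 - cumProj G k)) := by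
        rw [h1, h.one_sub_mul_one_sub hjk.le hk]
    _ = G j * (G j)ᵀ * deflCov S G j * (1 - cumProj G k) := by
        rw [deflCov]; simp only [Matrix.mul_assoc]
    _ = 0 := by
        rw [(h.top j (by omega)).commute, Matrix.mul_assoc, h.mul_one_sub_of_lt hjk hk,
          Matrix.mul_zero]

/-- By `gram_mul_cov` the product vanishes for `A = S j`, so only the difference counts. Old
directions thus interact weakly with the remaining ones, whatever the gaps. -/
lemma IsDeflation.norm_gram_mul_le (h : IsDeflation S G K) {j k : ℕ} (hjk : j < k) (hk : k ≤ K)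
    (A : Matrix (Fin n) (Fin n) ℝ) :
    ‖G j * (G j)ᵀ * A * (1 - cumProj G k)‖ ≤ ‖A - S j‖ := by
  have h1 : G j * (G j)ᵀ * A * (1 - cumProj G k) =
      G j * (G j)ᵀ * (A - S j) * (1 - cumProj G k) := by
    rw [Matrix.mul_sub (G j * (G j)ᵀ), Matrix.sub_mul, h.gram_mul_cov hjk hk, sub_zero]
  rw [h1]
  calc _ ≤ 1 * ‖A - S j‖ * 1 :=
        norm_mul_le_of_le _ _ (norm_mul_le_of_le _ _ (h.norm_gram_le (by omega)) le_rfl)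
          (h.norm_one_sub_le hk)
    _ = _ := by ring

/-- The projected matrix is, up to the part already found, the whole matrix. -/
lemma IsDeflation.norm_mul_one_sub_le (h : IsDeflation S G K) {k : ℕ} (hk : k ≤ K)
    (A : Matrix (Fin n) (Fin n) ℝ) {d : ℝ} (hd : ∀ j < k, ‖A - S j‖ ≤ d) :
    ‖A * (1 - cumProj G k)‖ ≤ ‖(1 - cumProj G k) * A * (1 - cumProj G k)‖ + k * d := by
  have h1 : A * (1 - cumProj G k) = (1 - cumProj G k) * A * (1 - cumProj G k) +
      ∑ j ∈ Finset.range k, G j * (G j)ᵀ * A * (1 - cumProj G k) := by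
    rw [← Finset.sum_mul, ← Finset.sum_mul, ← cumProj, ← Matrix.add_mul, ← Matrix.add_mul]
    simp
  rw [h1]
  refine (norm_add_le _ _).trans (add_le_add le_rfl ?_)
  refine (norm_sum_le _ _).trans ?_
  calc _ ≤ ∑ _j ∈ Finset.range k, d := Finset.sum_le_sum fun j hj =>
        (h.norm_gram_mul_le (Finset.mem_range.mp hj) hk A).trans (hd j (Finset.mem_range.mp hj))
    _ = _ := by simp

end deflation

/-! ### The population covariance matrix -/

section population

variable {n r : ℕ} {P : Matrix (Fin n) (Fin r) ℝ} {lam : Fin r → ℝ}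

/-- The covariance matrix `P Λ P'`. -/
def popCov (P : Matrix (Fin n) (Fin r) ℝ) (lam : Fin r → ℝ) : Matrix (Fin n) (Fin n) ℝ :=
  P * Matrix.diagonal lam * Pᵀ

/-- The factor `P Λ^{1/2}`. -/
noncomputable def factor (P : Matrix (Fin n) (Fin r) ℝ) (lam : Fin r → ℝ) :
    Matrix (Fin n) (Fin r) ℝ :=
  P * Matrix.diagonal fun i => √(lam i)

lemma factor_mul_transpose (hl : ∀ i, 0 < lam i) :
    factor P lam * (factor P lam)ᵀ = popCov P lam := by
  rw [factor, Matrix.transpose_mul, Matrix.diagonal_transpose, popCov, Matrix.mul_assoc,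
    ← Matrix.mul_assoc (Matrix.diagonal _) (Matrix.diagonal _), Matrix.diagonal_mul_diagonal,
    ← Matrix.mul_assoc]
  congr 3
  ext i
  exact Real.mul_self_sqrt (hl i).le

lemma posSemidef_popCov (hl : ∀ i, 0 < lam i) : (popCov P lam).PosSemidef := by
  rw [← factor_mul_transpose hl, ← Matrix.conjTranspose_eq_transpose_of_trivial]
  exact Matrix.posSemidef_self_mul_conjTranspose _

lemma lamAt_of_lt {i : ℕ} (hi : i < r) : lamAt lam i = lam ⟨i, hi⟩ := by rw [lamAt, dif_pos hi]

lemma lamAt_of_le {i : ℕ} (hi : r ≤ i) : lamAt lam i = 0 := by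
  rw [lamAt, dif_neg (by omega)]

lemma lamAt_nonneg (hl : ∀ i, 0 < lam i) (i : ℕ) : 0 ≤ lamAt lam i := by
  rw [lamAt]; split_ifs
  · exact (hl _).le
  · exact le_rfl

lemma lamAt_anti (hl : ∀ i, 0 < lam i) (ha : Antitone lam) {i j : ℕ} (hij : i ≤ j) :
    lamAt lam j ≤ lamAt lam i := by
  rcases lt_or_ge j r with hj | hj
  · rw [lamAt_of_lt hj, lamAt_of_lt (hij.trans_lt hj)]
    exact ha hij
  · rw [lamAt_of_le hj]; exact lamAt_nonneg hl i

lemma sum_sq_transpose_mulVec_le (hP : Pᵀ * P = 1) (x : Fin n → ℝ) :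
    ∑ j, (Pᵀ *ᵥ x) j ^ 2 ≤ x ⬝ᵥ x := by
  have h1 := dotProduct_mulVec_self_le Pᵀ x
  have h2 : ‖Pᵀ‖ ≤ 1 := by rw [norm_transpose]; exact norm_le_one_of_transpose_mul_self P hP
  have h3 : ‖Pᵀ‖ ^ 2 * (x ⬝ᵥ x) ≤ 1 * (x ⬝ᵥ x) :=
    mul_le_mul_of_nonneg_right (pow_le_one₀ (norm_nonneg _) h2) (dotProduct_self_nonneg' x)
  have h4 : (Pᵀ *ᵥ x) ⬝ᵥ (Pᵀ *ᵥ x) = ∑ j, (Pᵀ *ᵥ x) j ^ 2 := by simp [dotProduct, sq]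
  rw [← h4]; linarith

lemma mulVecLin_injective (hP : Pᵀ * P = 1) : Function.Injective P.mulVecLin := by
  intro x y hxy
  have := congrArg (Pᵀ *ᵥ ·) hxy
  simpa [Matrix.mulVec_mulVec, hP] using this

lemma card_le_of_transpose_mul_self (hP : Pᵀ * P = 1) : r ≤ n := by
  have := LinearMap.finrank_le_finrank_of_injective (mulVecLin_injective hP)
  rwa [finrank_pi_fin, finrank_pi_fin] at this

/-- Truncated coordinates in the eigenbasis of the population covariance. -/
lemma eigval_popCov (hP : Pᵀ * P = 1) (hl : ∀ i, 0 < lam i) (ha : Antitone lam) (i : ℕ) :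
    eigval (popCov P lam) i = lamAt lam i := by
  have hrn : r ≤ n := card_le_of_transpose_mul_self hP
  have hpsd := posSemidef_popCov (P := P) hl
  rcases lt_or_ge i n with hi | hi
  swap
  · rw [eigval_of_le _ hi, lamAt_of_le (hrn.trans hi)]
  apply le_antisymm
  · let f : Fin i → (Fin n → ℝ) →ₗ[ℝ] ℝ := fun j =>
      if hj : (j : ℕ) < r then (LinearMap.proj ⟨j, hj⟩) ∘ₗ Pᵀ.mulVecLin else 0
    refine eigval_le_of_ker hpsd.1 (LinearMap.pi f) hi (finrank_pi_fin i).le fun x hx => ?_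
    have hxz : ∀ j : Fin r, (j : ℕ) < i → (Pᵀ *ᵥ x) j = 0 := by
      intro j h1
      have h3 := congrFun hx ⟨j, h1⟩
      simp only [LinearMap.pi_apply, f, j.2, dif_pos, Pi.zero_apply] at h3
      exact h3
    rw [popCov, dotProduct_conj_diagonal]
    calc ∑ j, lam j * (Pᵀ *ᵥ x) j ^ 2 ≤ ∑ j, lamAt lam i * (Pᵀ *ᵥ x) j ^ 2 := by
          refine Finset.sum_le_sum fun j _ => ?_
          rcases lt_or_ge (j : ℕ) i with hj | hj
          · simp [hxz j hj]
          · refine mul_le_mul_of_nonneg_right ?_ (sq_nonneg _)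
            have := lamAt_anti hl ha hj
            rwa [lamAt_of_lt j.2] at this
      _ ≤ lamAt lam i * (x ⬝ᵥ x) := by
          rw [← Finset.mul_sum]
          exact mul_le_mul_of_nonneg_left (sum_sq_transpose_mulVec_le hP x) (lamAt_nonneg hl i)
  · rcases lt_or_ge i r with hir | hir
    swap
    · rw [lamAt_of_le hir]; exact eigval_nonneg hpsd i
    let e : Fin (i + 1) → Fin r := Fin.castLE hir
    let W : Matrix (Fin n) (Fin (i + 1)) ℝ := P.submatrix id e
    have hPW : Pᵀ * W = (1 : Matrix (Fin r) (Fin r) ℝ).submatrix id e := by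
      rw [← hP]; rfl
    have hW : Wᵀ * W = 1 := by
      have : Wᵀ * W = (Pᵀ * P).submatrix e e := rfl
      rw [this, hP, Matrix.submatrix_one _ (Fin.castLE_injective _)]
    refine le_eigval_of_range hpsd.1 W.mulVecLin (mulVecLin_injective hW) hi
      (by rw [finrank_pi_fin]; omega) fun y => ?_
    have hnorm : (W.mulVecLin y) ⬝ᵥ (W.mulVecLin y) = ∑ j, (Pᵀ *ᵥ (W.mulVecLin y)) j ^ 2 := by
      have h2 : P *ᵥ (Pᵀ *ᵥ (W *ᵥ y)) = W *ᵥ y := by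
        rw [Matrix.mulVec_mulVec y, hPW, Matrix.mulVec_mulVec]
        congr 1
        ext a b
        simp [Matrix.mul_apply, W, Matrix.one_apply]
      have h1 : (Pᵀ *ᵥ (W *ᵥ y)) ⬝ᵥ (Pᵀ *ᵥ (W *ᵥ y)) = (W *ᵥ y) ⬝ᵥ (W *ᵥ y) := by
        have := dotProduct_mulVec_transpose Pᵀ (Pᵀ *ᵥ (W *ᵥ y)) (W *ᵥ y)
        rw [this, Matrix.transpose_transpose, h2]
      rw [Matrix.mulVecLin_apply, ← h1]
      simp [dotProduct, sq]
    rw [hnorm, popCov, dotProduct_conj_diagonal, Finset.mul_sum]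
    refine Finset.sum_le_sum fun j _ => ?_
    rcases le_or_gt (j : ℕ) i with hj | hj
    · refine mul_le_mul_of_nonneg_right ?_ (sq_nonneg _)
      have := lamAt_anti hl ha hj
      rwa [lamAt_of_lt j.2] at this
    · have : (Pᵀ *ᵥ (W.mulVecLin y)) j = 0 := by
        rw [Matrix.mulVecLin_apply, Matrix.mulVec_mulVec, hPW, Matrix.mulVec, dotProduct]
        refine Finset.sum_eq_zero fun l _ => ?_
        rw [Matrix.submatrix_apply, Matrix.one_apply_ne, zero_mul]
        intro h
        have : (j : ℕ) = l := congrArg Fin.val h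
        omega
      rw [this]; simp

end population

/-! ### Perturbations of the population covariance -/

section perturbation

variable {n r : ℕ} {P : Matrix (Fin n) (Fin r) ℝ} {lam : Fin r → ℝ} {ε τ δ c : ℝ}
  {A : Matrix (Fin n) (Fin n) ℝ}

/-- `A` differs from the population covariance `L L'` by `L E L' + F L' + L F' + Q`, where `E`
is bounded by `ε`, `Q` by `c`, and `F L'` by the two parameters `τ` and `δ`. -/
def IsPerturbation (P : Matrix (Fin n) (Fin r) ℝ) (lam : Fin r → ℝ) (ε τ δ c : ℝ)
    (A : Matrix (Fin n) (Fin n) ℝ) : Prop :=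
  ∃ (E : Matrix (Fin r) (Fin r) ℝ) (F : Matrix (Fin n) (Fin r) ℝ)
    (Q : Matrix (Fin n) (Fin n) ℝ),
    A = popCov P lam + factor P lam * E * (factor P lam)ᵀ + F * (factor P lam)ᵀ
      + factor P lam * Fᵀ + Q ∧ ‖E‖ ≤ ε ∧ ‖Q‖ ≤ c ∧
    ∀ Z : Matrix (Fin n) (Fin n) ℝ, ‖F * ((factor P lam)ᵀ * Z)‖ ≤
      τ * ‖popCov P lam * Z‖ + δ * ‖(factor P lam)ᵀ * Z‖

lemma norm_factor_mul_sq (hl : ∀ i, 0 < lam i) {Z : Matrix (Fin n) (Fin n) ℝ} (hZ : Zᵀ = Z) :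
    ‖(factor P lam)ᵀ * Z‖ ^ 2 = ‖Z * popCov P lam * Z‖ := by
  rw [← norm_transpose_mul_self, Matrix.transpose_mul, Matrix.transpose_transpose, hZ,
    ← factor_mul_transpose hl]
  simp only [Matrix.mul_assoc]

lemma norm_popCov_le (hP : Pᵀ * P = 1) (hl : ∀ i, 0 < lam i) (ha : Antitone lam) :
    ‖popCov P lam‖ ≤ lamAt lam 0 := by
  rw [← eigval_popCov hP hl ha]
  exact norm_le_eigval_zero (posSemidef_popCov hl)

/-- Apart from `c`, the error scales with the restrictions of N' and Σ to the range of `Z`. For the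
complement of the directions already found this is the fine estimate; `Z = 1` gives the coarse one
in terms of λ⁺. -/
lemma IsPerturbation.norm_conj_sub_le (h : IsPerturbation P lam ε τ δ c A)
    {Z : Matrix (Fin n) (Fin n) ℝ} (hZ : Zᵀ = Z) (hZ1 : ‖Z‖ ≤ 1) :
    ‖Z * (A - popCov P lam) * Z‖ ≤ ε * ‖(factor P lam)ᵀ * Z‖ ^ 2 +
      2 * (τ * ‖popCov P lam * Z‖ + δ * ‖(factor P lam)ᵀ * Z‖) + c := by
  obtain ⟨E, F, Q, hA, hE, hQ, hF⟩ := h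
  set N := factor P lam with hN
  have e1 : Z * (A - popCov P lam) * Z =
      (Nᵀ * Z)ᵀ * E * (Nᵀ * Z) + Z * (F * (Nᵀ * Z)) + (Z * (F * (Nᵀ * Z)))ᵀ + Z * Q * Z := by
    rw [hA]
    simp only [Matrix.transpose_mul, Matrix.transpose_transpose, hZ, Matrix.mul_add,
      Matrix.add_mul, Matrix.mul_assoc, Matrix.mul_sub, Matrix.sub_mul]
    abel
  have b1 : ‖(Nᵀ * Z)ᵀ * E * (Nᵀ * Z)‖ ≤ ε * ‖Nᵀ * Z‖ ^ 2 := by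
    calc _ ≤ ‖Nᵀ * Z‖ * ε * ‖Nᵀ * Z‖ :=
          norm_mul_le_of_le _ _ (norm_mul_le_of_le _ _ (norm_transpose _).le hE) le_rfl
      _ = _ := by ring
  have b2 : ‖Z * (F * (Nᵀ * Z))‖ ≤ τ * ‖popCov P lam * Z‖ + δ * ‖Nᵀ * Z‖ := by
    calc _ ≤ 1 * (τ * ‖popCov P lam * Z‖ + δ * ‖Nᵀ * Z‖) := norm_mul_le_of_le _ _ hZ1 (hF Z)
      _ = _ := one_mul _
  have b3 : ‖Z * Q * Z‖ ≤ c := by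
    calc _ ≤ 1 * c * 1 := norm_mul_le_of_le _ _ (norm_mul_le_of_le _ _ hZ1 hQ) hZ1
      _ = _ := by ring
  rw [e1]
  have n1 := norm_add_le ((Nᵀ * Z)ᵀ * E * (Nᵀ * Z) + Z * (F * (Nᵀ * Z)) +
    (Z * (F * (Nᵀ * Z)))ᵀ) (Z * Q * Z)
  have n2 := norm_add_le ((Nᵀ * Z)ᵀ * E * (Nᵀ * Z) + Z * (F * (Nᵀ * Z)))
    (Z * (F * (Nᵀ * Z)))ᵀ
  have n3 := norm_add_le ((Nᵀ * Z)ᵀ * E * (Nᵀ * Z)) (Z * (F * (Nᵀ * Z)))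
  rw [norm_transpose] at n2
  linarith

lemma IsPerturbation.norm_sub_le (h : IsPerturbation P lam ε τ δ c A) (hP : Pᵀ * P = 1)
    (hl : ∀ i, 0 < lam i) (ha : Antitone lam) (hε : 0 ≤ ε) (hτ : 0 ≤ τ) (hδ : 0 ≤ δ) :
    ‖A - popCov P lam‖ ≤ ε * lamAt lam 0 + 2 * (τ * lamAt lam 0 + δ * √(lamAt lam 0)) + c := by
  have h1 := h.norm_conj_sub_le (Z := 1) Matrix.transpose_one
    (norm_le_one_of_transpose_mul_self _ (by simp))
  have h2 := norm_factor_mul_sq (P := P) hl (Z := 1) Matrix.transpose_one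
  simp only [Matrix.one_mul, Matrix.mul_one] at h1 h2
  have h3 := norm_popCov_le hP hl ha
  have h4 : ‖(factor P lam)ᵀ‖ ≤ √(lamAt lam 0) := by
    apply Real.le_sqrt_of_sq_le; rw [h2]; exact h3
  rw [h2] at h1
  refine h1.trans ?_
  gcongr

/-- All terms that begin with a factor `P` disappear, so the relative fluctuation `E` of the signal
does not contribute to the subspace error. -/
lemma IsPerturbation.norm_perp_mul_le (h : IsPerturbation P lam ε τ δ c A) (hP : Pᵀ * P = 1)
    {Z : Matrix (Fin n) (Fin n) ℝ} (hZ1 : ‖Z‖ ≤ 1) :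
    ‖(1 - P * Pᵀ) * A * Z‖ ≤ τ * ‖popCov P lam * Z‖ + δ * ‖(factor P lam)ᵀ * Z‖ + c := by
  obtain ⟨E, F, Q, hA, hE, hQ, hF⟩ := h
  have hperp : (1 - P * Pᵀ) * P = 0 := by
    rw [Matrix.sub_mul, Matrix.mul_assoc, hP]; simp
  have hperpN : (1 - P * Pᵀ) * factor P lam = 0 := by
    rw [factor, ← Matrix.mul_assoc, hperp, Matrix.zero_mul]
  have hperpS : (1 - P * Pᵀ) * popCov P lam = 0 := by
    rw [popCov, Matrix.mul_assoc, ← Matrix.mul_assoc, hperp, Matrix.zero_mul]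
  set T := 1 - P * Pᵀ with hT
  have hTT : T * T = T := by
    nth_rw 2 [hT]
    rw [Matrix.mul_sub, Matrix.mul_one, ← Matrix.mul_assoc, hperp, Matrix.zero_mul, sub_zero]
  have hT1 : ‖T‖ ≤ 1 := norm_le_one_of_isIdempotent _
    (by rw [hT, Matrix.transpose_sub, mul_transpose_transpose, Matrix.transpose_one]) hTT
  set N := factor P lam with hN
  have e1 : T * A * Z = T * (F * (Nᵀ * Z)) + T * Q * Z := by
    have : T * A = T * (F * Nᵀ) + T * Q := by
      rw [hA]
      simp only [Matrix.mul_add]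
      rw [hperpS, ← Matrix.mul_assoc T (N * E), ← Matrix.mul_assoc T N E,
        ← Matrix.mul_assoc T N Fᵀ, hperpN]
      simp
    rw [this, Matrix.add_mul]
    simp only [Matrix.mul_assoc]
  rw [e1]
  refine (norm_add_le _ _).trans (add_le_add ?_ ?_)
  · calc _ ≤ 1 * (τ * ‖popCov P lam * Z‖ + δ * ‖Nᵀ * Z‖) := norm_mul_le_of_le _ _ hT1 (hF Z)
      _ = _ := one_mul _
  · calc _ ≤ 1 * c * 1 := norm_mul_le_of_le _ _ (norm_mul_le_of_le _ _ hT1 hQ) hZ1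
      _ = _ := by ring

end perturbation

/-! ### Eigenvalues and directions along the deflation -/

section tracking

variable {n r : ℕ} {P : Matrix (Fin n) (Fin r) ℝ} {lam : Fin r → ℝ} {ε τ δ c d : ℝ}
  {s : ℕ → ℕ} {S : ℕ → Matrix (Fin n) (Fin n) ℝ}
  {G : ∀ k, Matrix (Fin n) (Fin (s k)) ℝ} {K N : ℕ}

lemma start_succ (s : ℕ → ℕ) (k : ℕ) : start s (k + 1) = start s k + s k :=
  Finset.sum_range_succ _ _

lemma start_zero (s : ℕ → ℕ) : start s 0 = 0 := Finset.sum_range_zero _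

/-- The eigenvalues of the deflated matrices are close to the remaining population
eigenvalues, whether or not there are gaps. -/
lemma IsDeflation.abs_eigval_sub_le (h : IsDeflation S G K) (hP : Pᵀ * P = 1)
    (hl : ∀ i, 0 < lam i) (ha : Antitone lam) (hd : ∀ k < N, ‖S k - popCov P lam‖ ≤ d) :
    ∀ k ≤ K, k < N → ∀ i,
      |eigval (deflCov S G k) i - lamAt lam (start s k + i)| ≤ (2 * k + 1) * d := by
  have weyl : ∀ {A B : Matrix (Fin n) (Fin n) ℝ} (_ : A.IsHermitian) (_ : B.IsHermitian) (i : ℕ),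
      |eigval A i - eigval B i| ≤ ‖A - B‖ := by
    intro A B hA hB i
    have h1 := eigval_le_add_norm_sub hA hB i
    have h2 := eigval_le_add_norm_sub hB hA i
    rw [norm_sub_rev] at h2
    rw [abs_le]; constructor <;> linarith
  intro k
  induction k with
  | zero =>
    intro _ hN i
    rw [start_zero, zero_add, ← eigval_popCov hP hl ha]
    have hM : deflCov S G 0 = S 0 := by rw [deflCov, cumProj_zero]; simp
    rw [hM]
    refine (weyl (h.psd 0).1 (posSemidef_popCov hl).1 i).trans ?_
    simpa using hd 0 hN
  | succ k ih =>
    intro hk hN i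
    have hkK : k < K := by omega
    have h1 := ih hkK.le (by omega) (s k + i)
    rw [← add_assoc, ← start_succ] at h1
    set T := 1 - G k * (G k)ᵀ with hT
    have hT1 : (1 - cumProj G (k + 1)) = T * (1 - cumProj G k) := by
      rw [hT, cumProj_succ, Matrix.sub_mul, Matrix.one_mul, Matrix.mul_sub, Matrix.mul_one,
        h.mul_cumProj hkK]
      abel
    have hT2 : (1 - cumProj G (k + 1)) = (1 - cumProj G k) * T := by
      rw [hT, cumProj_succ, Matrix.sub_mul, Matrix.one_mul, Matrix.mul_sub, Matrix.mul_one,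
        h.cumProj_mul hkK]
      abel
    have hB : T * deflCov S G k * T
        = (1 - cumProj G (k + 1)) * S k * (1 - cumProj G (k + 1)) := by
      nth_rw 1 [hT1]
      rw [hT2, deflCov]
      simp only [Matrix.mul_assoc]
    -- Deflating with the same covariance `S k` shifts the spectrum exactly by `s k`. The only new
    -- error, at most `2 * d`, comes from replacing `S k` by `S (k + 1)` afterwards.
    have h2 := (h.top k hkK).eigval_deflate (h.posSemidef k) i
    rw [← hT, hB] at h2
    have hBpsd : ((1 - cumProj G (k + 1)) * S k * (1 - cumProj G (k + 1))).PosSemidef :=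
      posSemidef_conj (h.psd k) (one_sub_cumProj_transpose _)
    have h3 := weyl (h.posSemidef (k + 1)).1 hBpsd.1 i
    have h4 : ‖deflCov S G (k + 1) -
        (1 - cumProj G (k + 1)) * S k * (1 - cumProj G (k + 1))‖ ≤ 2 * d := by
      rw [deflCov, ← Matrix.sub_mul, ← Matrix.mul_sub]
      have h5 : ‖S (k + 1) - S k‖ ≤ 2 * d := by
        have : S (k + 1) - S k = (S (k + 1) - popCov P lam) - (S k - popCov P lam) := by abel
        rw [this]
        have := norm_sub_le (S (k + 1) - popCov P lam) (S k - popCov P lam)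
        linarith [hd (k + 1) hN, hd k (by omega)]
      calc _ ≤ 1 * (2 * d) * 1 := norm_mul_le_of_le _ _
            (norm_mul_le_of_le _ _ (h.norm_one_sub_le hk) h5) (h.norm_one_sub_le hk)
        _ = _ := by ring
    rw [h2] at h3
    rw [abs_le] at h1 h3 ⊢
    push_cast
    constructor <;> linarith [h1.1, h1.2, h3.1, h3.2]

/-- The one-sided product is what multiplies the noise, whereas the algorithm sees only the
two-sided compression of `S k`. The missing part lies in the `k` spans already found and costs `2 *
d` for each; replacing `S k` by the population covariance costs one more `d`. -/
lemma IsDeflation.norm_popCov_mul_le (h : IsDeflation S G K)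
    (hd : ∀ k < N, ‖S k - popCov P lam‖ ≤ d) {k : ℕ} (hk : k ≤ K) (hN : k < N) :
    ‖popCov P lam * (1 - cumProj G k)‖ ≤ eigval (deflCov S G k) 0 + (2 * k + 1) * d := by
  have h1 := h.norm_mul_one_sub_le hk (S k) (d := 2 * d) fun j hj => by
    have : S k - S j = (S k - popCov P lam) - (S j - popCov P lam) := by abel
    rw [this]
    have := norm_sub_le (S k - popCov P lam) (S j - popCov P lam)
    linarith [hd k hN, hd j (by omega)]
  have h2 := norm_le_eigval_zero (h.posSemidef k)
  have h3 : ‖popCov P lam * (1 - cumProj G k)‖ ≤ ‖S k * (1 - cumProj G k)‖ + d := by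
    have e : popCov P lam * (1 - cumProj G k) =
        S k * (1 - cumProj G k) - (S k - popCov P lam) * (1 - cumProj G k) := by
      rw [← Matrix.sub_mul]; congr 1; abel
    rw [e]
    refine (norm_sub_le _ _).trans (add_le_add le_rfl ?_)
    calc _ ≤ d * 1 := norm_mul_le_of_le _ _ (hd k hN) (h.norm_one_sub_le hk)
      _ = d := mul_one d
  rw [deflCov] at h2
  rw [deflCov]
  linarith

lemma norm_conj_le_norm_mul {A Z : Matrix (Fin n) (Fin n) ℝ} (hZ : ‖Z‖ ≤ 1) :
    ‖Z * A * Z‖ ≤ ‖A * Z‖ := by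
  rw [Matrix.mul_assoc]
  calc _ ≤ 1 * ‖A * Z‖ := norm_mul_le_of_le _ _ hZ le_rfl
    _ = _ := one_mul _

lemma norm_factor_mul_le_sqrt (hl : ∀ i, 0 < lam i) {Z : Matrix (Fin n) (Fin n) ℝ}
    (hZ : Zᵀ = Z) (hZ1 : ‖Z‖ ≤ 1) {b : ℝ} (hb : ‖popCov P lam * Z‖ ≤ b) :
    ‖(factor P lam)ᵀ * Z‖ ≤ √b := by
  apply Real.le_sqrt_of_sq_le
  rw [norm_factor_mul_sq hl hZ]
  exact (norm_conj_le_norm_mul hZ1).trans hb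

/-- The new directions are almost contained in the range of `P`. -/
lemma IsDeflation.norm_perp_gram_le (h : IsDeflation S G K) (hP : Pᵀ * P = 1)
    (hl : ∀ i, 0 < lam i) (hτ : 0 ≤ τ) (hδ : 0 ≤ δ)
    (hd : ∀ k < N, ‖S k - popCov P lam‖ ≤ d)
    {k : ℕ} (hk : k < K) (hN : k < N) (hS : IsPerturbation P lam ε τ δ c (S k))
    {b : ℝ} (hb : eigval (deflCov S G k) 0 + (2 * k + 1) * d ≤ b) :
    ‖(1 - P * Pᵀ) * (G k * (G k)ᵀ)‖ ≤
      (τ * b + δ * √b + c + 2 * d * ∑ j ∈ Finset.range k, ‖(1 - P * Pᵀ) * (G j * (G j)ᵀ)‖) /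
        eigval (deflCov S G k) (s k - 1) := by
  obtain ⟨R, hR1, -, -, hR⟩ := h.exists_inverse hk
  have hZ := one_sub_cumProj_transpose (G := G) k
  have hZ1 := h.norm_one_sub_le hk.le
  set Z := 1 - cumProj G k with hZdef
  set T := 1 - P * Pᵀ with hT
  have hb1 : ‖popCov P lam * Z‖ ≤ b := (h.norm_popCov_mul_le hd hk.le hN).trans hb
  have hb2 := norm_factor_mul_le_sqrt hl hZ hZ1 hb1
  -- The left factor of the deflated matrix is 1 minus the earlier projections. The correction
  -- carries the earlier errors `T * (G j * (G j)ᵀ)`, but each is multiplied by a small interaction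
  -- term.
  have e1 : T * deflCov S G k = T * S k * Z -
      ∑ j ∈ Finset.range k, (T * (G j * (G j)ᵀ)) * (G j * (G j)ᵀ * S k * Z) := by
    have e2 : ∀ j ∈ Finset.range k, (T * (G j * (G j)ᵀ)) * (G j * (G j)ᵀ * S k * Z) =
        T * (G j * (G j)ᵀ) * (S k * Z) := by
      intro j hj
      have : j < K := (Finset.mem_range.mp hj).trans hk
      calc _ = T * ((G j * (G j)ᵀ) * (G j * (G j)ᵀ)) * (S k * Z) := by
            simp only [Matrix.mul_assoc]
        _ = _ := by rw [mul_transpose_idem (h.top j this).1]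
    rw [Finset.sum_congr rfl e2, ← Finset.sum_mul, ← Finset.mul_sum, ← cumProj, deflCov,
      ← hZdef]
    have : cumProj G k = 1 - Z := by rw [hZdef]; abel
    rw [this]
    simp only [Matrix.mul_sub, Matrix.sub_mul, Matrix.mul_one, Matrix.mul_assoc]
    abel
  have b1 : ‖T * deflCov S G k‖ ≤
      τ * b + δ * √b + c + 2 * d * ∑ j ∈ Finset.range k, ‖T * (G j * (G j)ᵀ)‖ := by
    rw [e1]
    refine (norm_sub_le _ _).trans (add_le_add ?_ ?_)
    · refine (hS.norm_perp_mul_le hP hZ1).trans ?_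
      gcongr
    · rw [Finset.mul_sum]
      refine (norm_sum_le _ _).trans (Finset.sum_le_sum fun j hj => ?_)
      have hj := Finset.mem_range.mp hj
      have h5 : ‖S k - S j‖ ≤ 2 * d := by
        have : S k - S j = (S k - popCov P lam) - (S j - popCov P lam) := by abel
        rw [this]
        have := norm_sub_le (S k - popCov P lam) (S j - popCov P lam)
        linarith [hd k hN, hd j (by omega)]
      calc _ ≤ ‖T * (G j * (G j)ᵀ)‖ * (2 * d) := norm_mul_le_of_le _ _ le_rfl
            ((h.norm_gram_mul_le hj hk.le (S k)).trans h5)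
        _ = _ := mul_comm _ _
  rw [← hR1, ← Matrix.mul_assoc, div_eq_mul_inv]
  exact norm_mul_le_of_le _ _ b1 hR

/-- Lower bound for the largest eigenvalue of a deflated matrix. -/
lemma IsDeflation.le_eigval_zero (h : IsDeflation S G K) (hP : Pᵀ * P = 1)
    (ha : Antitone lam) {k : ℕ} (he : start s k < r) {φ : ℝ}
    (hφ : ‖(1 - cumProj G k) * (S k - popCov P lam) * (1 - cumProj G k)‖ ≤ φ) :
    lamAt lam (start s k) - φ ≤ eigval (deflCov S G k) 0 := by
  have hrn : r ≤ n := card_le_of_transpose_mul_self hP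
  let W : Matrix (Fin n) (Fin (start s k + 1)) ℝ := P.submatrix id (Fin.castLE he)
  have hPW : Pᵀ * W = (1 : Matrix (Fin r) (Fin r) ℝ).submatrix id (Fin.castLE he) := by
    rw [← hP]; rfl
  have hW : Wᵀ * W = 1 := by
    have : Wᵀ * W = (Pᵀ * P).submatrix (Fin.castLE he) (Fin.castLE he) := rfl
    rw [this, hP, Matrix.submatrix_one _ (Fin.castLE_injective _)]
  -- The first `start s k + 1` population eigenvectors outnumber the directions found so far, so
  -- some nonzero combination of them is orthogonal to all of those. Deflation leaves this vector
  -- fixed.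
  let T : (Fin (start s k + 1) → ℝ) →ₗ[ℝ] ((j : Fin k) → Fin (s j) → ℝ) :=
    LinearMap.pi fun j => (G j)ᵀ.mulVecLin ∘ₗ W.mulVecLin
  obtain ⟨y, hy0, hy⟩ := exists_ne_zero_ker T (by
    rw [Module.finrank_pi_fintype, finrank_pi_fin]
    simp only [finrank_pi_fin]
    rw [Fin.sum_univ_eq_sum_range, start]
    omega)
  set x := W *ᵥ y with hx
  have hx0 : x ≠ 0 := fun h0 => hy0 (mulVecLin_injective hW (by
    rw [Matrix.mulVecLin_apply, ← hx, h0, map_zero]))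
  have hGx : cumProj G k *ᵥ x = 0 := by
    rw [cumProj, Matrix.sum_mulVec]
    refine Finset.sum_eq_zero fun j hj => ?_
    have : (G j)ᵀ *ᵥ x = 0 := congrFun hy ⟨j, Finset.mem_range.mp hj⟩
    rw [← Matrix.mulVec_mulVec, this, Matrix.mulVec_zero]
  set Z := 1 - cumProj G k with hZ
  have hZx : Z *ᵥ x = x := by rw [hZ, Matrix.sub_mulVec, hGx, Matrix.one_mulVec, sub_zero]
  have hZt : Zᵀ = Z := one_sub_cumProj_transpose k
  have hconj : ∀ A : Matrix (Fin n) (Fin n) ℝ, x ⬝ᵥ (Z * A * Z) *ᵥ x = x ⬝ᵥ A *ᵥ x := by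
    intro A
    rw [← Matrix.mulVec_mulVec, ← Matrix.mulVec_mulVec, hZx, dotProduct_mulVec_transpose, hZt, hZx]
  have hPx : x ⬝ᵥ x = ∑ j, (Pᵀ *ᵥ x) j ^ 2 := by
    have h2 : P *ᵥ (Pᵀ *ᵥ x) = x := by
      rw [hx, Matrix.mulVec_mulVec y, hPW, Matrix.mulVec_mulVec]
      congr 1
      ext a b
      simp [Matrix.mul_apply, W, Matrix.one_apply]
    calc x ⬝ᵥ x = x ⬝ᵥ P *ᵥ (Pᵀ *ᵥ x) := by rw [h2]
      _ = _ := by rw [dotProduct_mulVec_transpose]; simp [dotProduct, sq]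
  have hq : lamAt lam (start s k) * (x ⬝ᵥ x) ≤ x ⬝ᵥ popCov P lam *ᵥ x := by
    rw [popCov, dotProduct_conj_diagonal, hPx, Finset.mul_sum]
    refine Finset.sum_le_sum fun j _ => ?_
    rcases le_or_gt (j : ℕ) (start s k) with hj | hj
    · refine mul_le_mul_of_nonneg_right ?_ (sq_nonneg _)
      rw [lamAt_of_lt he]
      exact ha hj
    · have : (Pᵀ *ᵥ x) j = 0 := by
        rw [hx, Matrix.mulVec_mulVec, hPW, Matrix.mulVec, dotProduct]
        refine Finset.sum_eq_zero fun l _ => ?_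
        rw [Matrix.submatrix_apply, Matrix.one_apply_ne, zero_mul]
        intro h
        have : (j : ℕ) = l := congrArg Fin.val h
        omega
      rw [this]; simp
  have hS : (lamAt lam (start s k) - φ) * (x ⬝ᵥ x) ≤ x ⬝ᵥ deflCov S G k *ᵥ x := by
    rw [deflCov, ← hZ]
    have h1 := (abs_le.mp (abs_dotProduct_mulVec_le (Z * (S k - popCov P lam) * Z) x)).1
    have h2 : ‖Z * (S k - popCov P lam) * Z‖ * (x ⬝ᵥ x) ≤ φ * (x ⬝ᵥ x) :=
      mul_le_mul_of_nonneg_right hφ (dotProduct_self_nonneg' x)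
    rw [hconj, Matrix.sub_mulVec, dotProduct_sub] at h1
    rw [hconj]
    linarith
  refine le_eigval_of_range (h.posSemidef k).1 (LinearMap.toSpanSingleton ℝ _ x)
    (fun a b hab => ?_) (by omega) (by simp) fun t => ?_
  · simpa [LinearMap.toSpanSingleton_apply, hx0] using hab
  · simp only [LinearMap.toSpanSingleton_apply, Matrix.mulVec_smul, dotProduct_smul,
      smul_dotProduct, smul_eq_mul]
    nlinarith [mul_nonneg (mul_self_nonneg t) (sub_nonneg.mpr hS)]

/-- The part of `Λ^{1/2} P' Ψ` that belongs to the first `e` eigenvalues. -/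
noncomputable def headFactor (P : Matrix (Fin n) (Fin r) ℝ) (lam : Fin r → ℝ) (e : ℕ) :
    Matrix (Fin r) (Fin n) ℝ :=
  Matrix.diagonal (fun j : Fin r => if (j : ℕ) < e then √(lam j) else 0) * Pᵀ

/-- Upper bound for an eigenvalue of a deflated matrix. -/
lemma IsDeflation.eigval_le (h : IsDeflation S G K) (hP : Pᵀ * P = 1) (hl : ∀ i, 0 < lam i)
    (ha : Antitone lam) {k : ℕ} (hk : k ≤ K) (e t : ℕ) {φ : ℝ}
    (hφ : ‖(1 - cumProj G k) * (S k - popCov P lam) * (1 - cumProj G k)‖ ≤ φ) :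
    eigval (deflCov S G k) t ≤
      lamAt lam (e + t) + φ + ‖headFactor P lam e * (1 - cumProj G k)‖ ^ 2 := by
  have hφ0 : 0 ≤ φ := (norm_nonneg _).trans hφ
  rcases lt_or_ge t n with ht | ht
  swap
  · rw [eigval_of_le _ ht]
    have := lamAt_nonneg hl (e + t)
    positivity
  set Z := 1 - cumProj G k with hZ
  have hZt : Zᵀ = Z := one_sub_cumProj_transpose k
  -- The `t` conditions annihilate the coordinates `e, …, e + t - 1` of `Pᵀ Z x`. The later ones
  -- carry eigenvalues at most `lamAt lam (e + t)`, and the first `e` form the leakage term.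
  let f : Fin t → (Fin n → ℝ) →ₗ[ℝ] ℝ := fun j =>
    if hj : e + j < r then (LinearMap.proj ⟨e + j, hj⟩) ∘ₗ (Pᵀ * Z).mulVecLin else 0
  refine eigval_le_of_ker (h.posSemidef k).1 (LinearMap.pi f) ht (finrank_pi_fin t).le fun x hx => ?_
  have hxz : ∀ j : Fin r, e ≤ (j : ℕ) → (j : ℕ) < e + t → (Pᵀ *ᵥ (Z *ᵥ x)) j = 0 := by
    intro j h1 h2
    have h3 := congrFun hx ⟨j - e, by omega⟩
    have h4 : e + ((j : ℕ) - e) = j := by omega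
    simp only [LinearMap.pi_apply, f, h4, j.2, dif_pos, Pi.zero_apply] at h3
    rw [Matrix.mulVec_mulVec]
    exact h3
  have hpop : x ⬝ᵥ (Z * popCov P lam * Z) *ᵥ x = ∑ j, lam j * (Pᵀ *ᵥ (Z *ᵥ x)) j ^ 2 := by
    rw [← Matrix.mulVec_mulVec, ← Matrix.mulVec_mulVec, dotProduct_mulVec_transpose, hZt, popCov,
      dotProduct_conj_diagonal]
  have hhead : ((headFactor P lam e * Z) *ᵥ x) ⬝ᵥ ((headFactor P lam e * Z) *ᵥ x) =
      ∑ j : Fin r, if (j : ℕ) < e then lam j * (Pᵀ *ᵥ (Z *ᵥ x)) j ^ 2 else 0 := by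
    rw [headFactor, ← Matrix.mulVec_mulVec, ← Matrix.mulVec_mulVec, dotProduct]
    simp only [Matrix.mulVec_diagonal]
    refine Finset.sum_congr rfl fun j _ => ?_
    split_ifs
    · calc _ = (√(lam j) * √(lam j)) * (Pᵀ *ᵥ (Z *ᵥ x)) j ^ 2 := by ring
        _ = _ := by rw [Real.mul_self_sqrt (hl j).le]
    · simp
  have hZx : (Z *ᵥ x) ⬝ᵥ (Z *ᵥ x) ≤ x ⬝ᵥ x := by
    have h1 := dotProduct_mulVec_self_le Z x
    have h2 : ‖Z‖ ^ 2 * (x ⬝ᵥ x) ≤ 1 * (x ⬝ᵥ x) :=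
      mul_le_mul_of_nonneg_right (pow_le_one₀ (norm_nonneg _) (h.norm_one_sub_le hk))
        (dotProduct_self_nonneg' x)
    linarith
  have hsplit : x ⬝ᵥ (Z * popCov P lam * Z) *ᵥ x ≤
      ((headFactor P lam e * Z) *ᵥ x) ⬝ᵥ ((headFactor P lam e * Z) *ᵥ x) +
        lamAt lam (e + t) * (x ⬝ᵥ x) := by
    calc _ ≤ ∑ j : Fin r, ((if (j : ℕ) < e then lam j * (Pᵀ *ᵥ (Z *ᵥ x)) j ^ 2 else 0) +
          lamAt lam (e + t) * (Pᵀ *ᵥ (Z *ᵥ x)) j ^ 2) := by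
          rw [hpop]
          refine Finset.sum_le_sum fun j _ => ?_
          have hnn := mul_nonneg (lamAt_nonneg hl (e + t)) (sq_nonneg ((Pᵀ *ᵥ (Z *ᵥ x)) j))
          split_ifs with hj
          · linarith
          · rw [zero_add]
            rcases lt_or_ge (j : ℕ) (e + t) with hj2 | hj2
            · rw [hxz j (by omega) hj2]; simp
            · refine mul_le_mul_of_nonneg_right ?_ (sq_nonneg _)
              have := lamAt_anti hl ha hj2
              rwa [lamAt_of_lt j.2] at this
      _ = ((headFactor P lam e * Z) *ᵥ x) ⬝ᵥ ((headFactor P lam e * Z) *ᵥ x) +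
          lamAt lam (e + t) * ∑ j, (Pᵀ *ᵥ (Z *ᵥ x)) j ^ 2 := by
          rw [Finset.sum_add_distrib, hhead, Finset.mul_sum]
      _ ≤ _ := by
          gcongr
          · exact lamAt_nonneg hl _
          · exact (sum_sq_transpose_mulVec_le hP _).trans hZx
  have hdev := quadratic_le_add (Z * S k * Z) (Z * popCov P lam * Z) x
  rw [← Matrix.sub_mul, ← Matrix.mul_sub] at hdev
  have h2 : ‖Z * (S k - popCov P lam) * Z‖ * (x ⬝ᵥ x) ≤ φ * (x ⬝ᵥ x) :=
    mul_le_mul_of_nonneg_right hφ (dotProduct_self_nonneg' x)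
  have h3 := dotProduct_mulVec_self_le (headFactor P lam e * Z) x
  rw [deflCov, ← hZ]
  linarith

/-- A bound for the leakage of the detected eigenvalues across a gap. -/
lemma IsDeflation.norm_headFactor_mul_le (h : IsDeflation S G K) (hP : Pᵀ * P = 1)
    (hl : ∀ i, 0 < lam i) (hd : ∀ k < N, ‖S k - popCov P lam‖ ≤ d) {k : ℕ} (hk : k ≤ K)
    (hN : k ≤ N) {e : ℕ} {v b : ℝ} (hv : 0 < v) (hve : ∀ j : Fin r, (j : ℕ) < e → v ≤ lam j)
    (hb : ‖(1 - cumProj G k) * popCov P lam * (1 - cumProj G k)‖ ≤ b) :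
    ‖headFactor P lam e * (1 - cumProj G k)‖ * (v - b) ≤ k * d * √v := by
  set Z := 1 - cumProj G k with hZ
  set Y := headFactor P lam e * Z with hY
  let D : Matrix (Fin r) (Fin r) ℝ :=
    Matrix.diagonal fun j : Fin r => if (j : ℕ) < e then (lam j)⁻¹ else 0
  have hD : ‖D‖ ≤ v⁻¹ := by
    rw [Matrix.l2_opNorm_diagonal, pi_norm_le_iff_of_nonneg (by positivity)]
    intro j
    split_ifs with hj
    · rw [Real.norm_of_nonneg (inv_nonneg.mpr (hl j).le)]
      exact inv_anti₀ hv (hve j hj)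
    · simpa using hv.le
  have hDH : ‖D * headFactor P lam e‖ ≤ (√v)⁻¹ := by
    have h1 : D * headFactor P lam e =
        Matrix.diagonal (fun j : Fin r => if (j : ℕ) < e then (√(lam j))⁻¹ else 0) * Pᵀ := by
      rw [headFactor, ← Matrix.mul_assoc, Matrix.diagonal_mul_diagonal]
      congr 2
      ext j
      split_ifs with hj
      · rw [← Real.sqrt_div_self, div_eq_mul_inv, mul_comm]
      · simp
    rw [h1]
    have h2 : ‖Matrix.diagonal
        (fun j : Fin r => if (j : ℕ) < e then (√(lam j))⁻¹ else 0)‖ ≤ (√v)⁻¹ := by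
      rw [Matrix.l2_opNorm_diagonal, pi_norm_le_iff_of_nonneg (by positivity)]
      intro j
      split_ifs with hj
      · rw [Real.norm_of_nonneg (by positivity)]
        exact inv_anti₀ (Real.sqrt_pos.mpr hv) (Real.sqrt_le_sqrt (hve j hj))
      · simp
    calc _ ≤ (√v)⁻¹ * 1 := norm_mul_le_of_le _ _ h2
          (by rw [norm_transpose]; exact norm_le_one_of_transpose_mul_self P hP)
      _ = _ := mul_one _
  have hDS : D * headFactor P lam e * popCov P lam = headFactor P lam e := by
    rw [headFactor, popCov]
    calc _ = D * Matrix.diagonal (fun j : Fin r => if (j : ℕ) < e then √(lam j) else 0) *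
          (Pᵀ * P) * Matrix.diagonal lam * Pᵀ := by simp only [Matrix.mul_assoc]
      _ = _ := by
        rw [hP, Matrix.mul_one, Matrix.diagonal_mul_diagonal, Matrix.diagonal_mul_diagonal]
        congr 2
        ext j
        split_ifs with hj
        · have := (hl j).ne'
          field_simp
        · simp
  have hpi : ‖cumProj G k * popCov P lam * Z‖ ≤ k * d := by
    rw [cumProj, Finset.sum_mul, Finset.sum_mul]
    refine (norm_sum_le _ _).trans ?_
    calc _ ≤ ∑ _j ∈ Finset.range k, d := Finset.sum_le_sum fun j hj => by
          have hj := Finset.mem_range.mp hj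
          refine (h.norm_gram_mul_le hj hk _).trans ?_
          rw [norm_sub_rev]
          exact hd j (by omega)
      _ = _ := by simp
  -- Here `D` inverts the leading eigenvalues, so `D * headFactor * popCov = headFactor`. Inserting
  -- cumProj + `Z` = 1 yields an identity with `Y` on both sides; taking norms bounds `Y` as soon as
  -- the remaining part `b` is smaller than `v`.
  have hmain : Y = D * headFactor P lam e * (cumProj G k * popCov P lam * Z) +
      D * (Y * (Z * popCov P lam * Z)) := by
    have hYZ : Y * (Z * popCov P lam * Z) = headFactor P lam e * (Z * popCov P lam * Z) := by
      rw [hY]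
      simp only [← Matrix.mul_assoc]
      rw [Matrix.mul_assoc _ Z Z, hZ, h.one_sub_idem hk]
    rw [hYZ, ← Matrix.mul_assoc D, ← Matrix.mul_add, ← Matrix.add_mul, ← Matrix.add_mul]
    have : cumProj G k + Z = 1 := by rw [hZ]; abel
    rw [this, Matrix.one_mul, ← Matrix.mul_assoc, hDS]
  have hbound : ‖Y‖ ≤ (√v)⁻¹ * (k * d) + v⁻¹ * (‖Y‖ * b) := by
    conv_lhs => rw [hmain]
    refine (norm_add_le _ _).trans (add_le_add ?_ ?_)
    · exact norm_mul_le_of_le _ _ hDH hpi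
    · exact norm_mul_le_of_le _ _ hD (norm_mul_le_of_le _ _ le_rfl hb)
  have hsv : v * (√v)⁻¹ = √v := by rw [← div_eq_mul_inv, Real.div_sqrt]
  have h2 := mul_le_mul_of_nonneg_left hbound hv.le
  have h3 : v * ((√v)⁻¹ * (k * d) + v⁻¹ * (‖Y‖ * b)) = k * d * √v + ‖Y‖ * b := by
    calc _ = (v * (√v)⁻¹) * (k * d) + (v * v⁻¹) * (‖Y‖ * b) := by ring
      _ = _ := by rw [hsv, mul_inv_cancel₀ hv.ne']; ring
  rw [h3] at h2
  linarith

end tracking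

/-! ### Clusters of population eigenvalues -/

section clusters

variable {r : ℕ} {lam : Fin r → ℝ} {gp χp : ℝ} {ϑ : ℕ} {size : ℕ → ℕ}

lemma start_mono (size : ℕ → ℕ) : Monotone (start size) := fun _ _ h =>
  Finset.sum_le_sum_of_subset (Finset.range_mono h)

lemma lamMin_le (i : Fin r) : lamMin lam ≤ lam i := ciInf_le (Set.finite_range lam).bddBelow i

lemma le_lamMax (i : Fin r) : lam i ≤ lamMax lam := le_ciSup (Set.finite_range lam).bddAbove i

lemma lamMin_pos (hr : 0 < r) (hl : ∀ i, 0 < lam i) : 0 < lamMin lam := by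
  have : Nonempty (Fin r) := ⟨⟨0, hr⟩⟩
  obtain ⟨i, hi⟩ := exists_eq_ciInf_of_finite (f := lam)
  rw [lamMin, ← hi]; exact hl i

lemma lamMax_eq (hr : 0 < r) (ha : Antitone lam) : lamMax lam = lamAt lam 0 := by
  have : Nonempty (Fin r) := ⟨⟨0, hr⟩⟩
  rw [lamAt_of_lt hr]
  exact le_antisymm (ciSup_le fun i => ha (Fin.mk_le_mk.mpr (Nat.zero_le _))) (le_lamMax _)

lemma lamMin_le_lamAt {i : ℕ} (hi : i < r) : lamMin lam ≤ lamAt lam i := by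
  rw [lamAt_of_lt hi]; exact lamMin_le _

lemma clusterMax_eq (ha : Antitone lam) {k : ℕ} (hs : 1 ≤ size k) (hk : start size k < r) :
    clusterMax lam size k = lamAt lam (start size k) := by
  rw [lamAt_of_lt hk, clusterMax]
  refine IsGreatest.csSup_eq ⟨⟨⟨_, hk⟩, ⟨le_rfl, by simp; omega⟩, rfl⟩, ?_⟩
  rintro _ ⟨i, hi, rfl⟩
  exact ha hi.1

lemma clusterMax_eq_zero {k : ℕ} (hk : r ≤ start size k) : clusterMax lam size k = 0 := by
  have : cluster r size k = ∅ := by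
    refine Set.eq_empty_of_forall_notMem fun i hi => ?_
    have h1 := hi.1
    have h2 := i.2
    omega
  rw [clusterMax, this, Set.image_empty, Real.sSup_empty]

lemma clusterMin_eq (ha : Antitone lam) {k : ℕ} (hs : 1 ≤ size k)
    (hk : start size (k + 1) ≤ r) :
    clusterMin lam size k = lamAt lam (start size (k + 1) - 1) := by
  rw [start_succ] at hk ⊢
  have h1 : start size k + size k - 1 < r := by omega
  rw [lamAt_of_lt h1, clusterMin]
  refine IsLeast.csInf_eq ⟨⟨⟨_, h1⟩, ⟨by simp; omega, by simp; omega⟩, rfl⟩, ?_⟩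
  rintro _ ⟨i, hi, rfl⟩
  refine ha ?_
  have := hi.2
  rw [Fin.le_def]
  simp only
  omega

/-- The properties of the clusters of eigenvalues that the algorithm relies on. -/
structure ClusterBounds (lam : Fin r → ℝ) (gp χ : ℝ) (ϑ : ℕ) (size : ℕ → ℕ) : Prop where
  size_pos : ∀ k < ϑ, 1 ≤ size k
  total : start size ϑ = r
  ratio : ∀ k < ϑ, lamAt lam (start size k) ≤ gp * lamAt lam (start size (k + 1) - 1)
  gap : ∀ k < ϑ, lamAt lam (start size (k + 1)) ≤ χ * lamAt lam (start size (k + 1) - 1)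

lemma ClusterBounds.start_succ_le {χ : ℝ} (h : ClusterBounds lam gp χ ϑ size) {k : ℕ}
    (hk : k < ϑ) : start size (k + 1) ≤ r := h.total ▸ start_mono size hk

lemma ClusterBounds.start_lt {χ : ℝ} (h : ClusterBounds lam gp χ ϑ size) {k : ℕ} (hk : k < ϑ) :
    start size k < r := by
  have h1 := h.start_succ_le hk
  have h2 := h.size_pos k hk
  rw [start_succ] at h1
  omega

lemma ClusterModel.clusterBounds (h : ClusterModel lam gp χp ϑ size) (hl : ∀ i, 0 < lam i)
    (ha : Antitone lam) : ClusterBounds lam gp χp ϑ size := by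
  obtain ⟨g, hg1, hg, hpart⟩ := h.partition
  have hle : ∀ k < ϑ, start size (k + 1) ≤ r := fun k hk => by
    have := start_mono size (Nat.succ_le_of_lt hk)
    rwa [hpart.total] at this
  refine ⟨hpart.size_pos, hpart.total, fun k hk => ?_, fun k hk => ?_⟩
  · rw [start_succ]
    refine (hpart.ratio_le k hk).trans ?_
    exact mul_le_mul_of_nonneg_right hg (lamAt_nonneg hl _)
  · have hsk := hpart.size_pos k hk
    have h1 := hle k hk
    have hmax : clusterMax lam size (k + 1) = lamAt lam (start size (k + 1)) := by
      rcases Nat.lt_or_ge (k + 1) ϑ with hk1 | hk1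
      · refine clusterMax_eq ha (hpart.size_pos _ hk1) ?_
        have := hle _ hk1
        have := hpart.size_pos _ hk1
        rw [start_succ size (k + 1)] at *
        omega
      · have : k + 1 = ϑ := by omega
        rw [this, hpart.total, clusterMax_eq_zero hpart.total.ge, lamAt_of_le le_rfl]
    have hmin := clusterMin_eq ha hsk h1
    have hgap : clusterMax lam size (k + 1) / clusterMin lam size k ≤ χp :=
      (le_ciSup (f := fun k : Fin ϑ => clusterMax lam size (k + 1) / clusterMin lam size k)
        (Set.finite_range _).bddAbove ⟨k, hk⟩).trans h.gapRatio_le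
    rw [hmax, hmin] at hgap
    have hpos : 0 < lamAt lam (start size (k + 1) - 1) := by
      rw [start_succ] at *
      rw [lamAt_of_lt (by omega)]
      exact hl _
    rwa [div_le_iff₀ hpos] at hgap

lemma ClusterBounds.le_of_same {χ : ℝ} (h : ClusterBounds lam gp χ ϑ size) (hgp : 0 ≤ gp)
    (hl : ∀ i, 0 < lam i) (ha : Antitone lam) {k i j : ℕ} (hk : k < ϑ) (hi : start size k ≤ i)
    (hj : j < start size (k + 1)) : lamAt lam i ≤ gp * lamAt lam j :=
  (lamAt_anti hl ha hi).trans ((h.ratio k hk).trans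
    (mul_le_mul_of_nonneg_left (lamAt_anti hl ha (by omega)) hgp))

lemma exists_start_le (size : ℕ → ℕ) {ϑ i : ℕ} (hi : i < start size ϑ) :
    ∃ k < ϑ, start size k ≤ i ∧ i < start size (k + 1) := by
  induction ϑ with
  | zero => simp [start_zero] at hi
  | succ m ih =>
    rcases lt_or_ge i (start size m) with h | h
    · obtain ⟨k, hk, h1⟩ := ih h
      exact ⟨k, by omega, h1⟩
    · exact ⟨m, by omega, h, hi⟩

/-- Two eigenvalues either are in the same cluster or are separated by a gap. -/
lemma ClusterBounds.le_or_le {χ : ℝ} (h : ClusterBounds lam gp χ ϑ size) (hgp : 0 ≤ gp)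
    (hχ : 0 ≤ χ) (hl : ∀ i, 0 < lam i) (ha : Antitone lam) {i j : ℕ} (hi : i < r) :
    lamAt lam i ≤ gp * lamAt lam j ∨ lamAt lam j ≤ χ * lamAt lam i := by
  obtain ⟨k, hk, h1, h2⟩ := exists_start_le size (i := i) (ϑ := ϑ) (by rwa [h.total])
  rcases lt_or_ge j (start size (k + 1)) with hj | hj
  · exact Or.inl (h.le_of_same hgp hl ha hk h1 hj)
  · refine Or.inr ((lamAt_anti hl ha hj).trans ((h.gap k hk).trans ?_))
    exact mul_le_mul_of_nonneg_left (lamAt_anti hl ha (by omega)) hχ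

end clusters

/-! ### The size of a detected cluster -/

/-- At the first index satisfying the stopping alternative, the ratio condition holds automatically,
since the preceding index failed that alternative (or is the top index). The search ends because
eigenvalues past `n` are zero, below the threshold. -/
lemma clusterSize_spec {n : ℕ} {M : Matrix (Fin n) (Fin n) ℝ}
    {ghat thresh : ℝ} (hg : 1 ≤ ghat) (ht : 0 < thresh) (h0 : thresh ≤ eigval M 0) :
    1 ≤ clusterSize ghat thresh M ∧
    eigval M 0 ≤ ghat * eigval M (clusterSize ghat thresh M - 1) ∧
    (ghat * eigval M (clusterSize ghat thresh M) < eigval M 0 ∨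
      eigval M (clusterSize ghat thresh M) < thresh) ∧
    ∀ t < clusterSize ghat thresh M, eigval M 0 ≤ ghat * eigval M t ∧ thresh ≤ eigval M t := by
  classical
  have hex : ∃ t, 1 ≤ t ∧ (ghat * eigval M t < eigval M 0 ∨ eigval M t < thresh) :=
    ⟨n + 1, by omega, Or.inr (by rw [eigval_of_le M (by omega)]; exact ht)⟩
  have hstart : eigval M 0 ≤ ghat * eigval M 0 := le_mul_of_one_le_left (ht.le.trans h0) hg
  have hbefore : ∀ t < Nat.find hex, eigval M 0 ≤ ghat * eigval M t ∧ thresh ≤ eigval M t := by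
    intro t htlt
    rcases Nat.eq_zero_or_pos t with rfl | htpos
    · exact ⟨hstart, h0⟩
    · have h1 := Nat.find_min hex htlt
      push Not at h1
      exact h1 htpos
  have h1 := (Nat.find_spec hex).1
  have hmem : Nat.find hex ∈ {s | 1 ≤ s ∧ eigval M 0 ≤ ghat * eigval M (s - 1) ∧
      (ghat * eigval M s < eigval M 0 ∨ eigval M s < thresh)} :=
    ⟨h1, (hbefore _ (by omega)).1, (Nat.find_spec hex).2⟩
  have heq : clusterSize ghat thresh M = Nat.find hex := by
    refine le_antisymm (Nat.sInf_le hmem) ?_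
    have h2 := Nat.sInf_mem ⟨_, hmem⟩
    exact Nat.find_min' hex ⟨h2.1, h2.2.2⟩
  rw [heq]
  exact ⟨h1, hmem.2.1, hmem.2.2, hbefore⟩

/-! ### The iterations of the algorithm -/

section run

variable {n r : ℕ} {P : Matrix (Fin n) (Fin r) ℝ} {lam : Fin r → ℝ}
  {s : ℕ → ℕ} {S : ℕ → Matrix (Fin n) (Fin n) ℝ}
  {G : ∀ k, Matrix (Fin n) (Fin (s k)) ℝ} {gp χ l d ghat thresh : ℝ} {ϑ : ℕ} {size : ℕ → ℕ}

/-- The matrices `G k` are computed by the algorithm from the covariance matrices `S k`. -/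
structure IsRun (ghat thresh : ℝ) (S : ℕ → Matrix (Fin n) (Fin n) ℝ)
    (G : ∀ k, Matrix (Fin n) (Fin (s k)) ℝ) : Prop where
  psd : ∀ k, (S k).PosSemidef
  size_eq : ∀ k, s k = clusterSize ghat thresh (deflCov S G k)
  top : ∀ k, s k ≤ n → IsTopEigenvectors (deflCov S G k) (G k)

/-- The standing assumptions: `P` has orthonormal columns, the population eigenvalues have
clusters with ratios at most `gp` and relative gaps at least `0.32`, and the covariance matrices
are within `d` of the population covariance. -/
structure RunModel (P : Matrix (Fin n) (Fin r) ℝ) (lam : Fin r → ℝ) (gp l d ghat thresh : ℝ)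
    (ϑ : ℕ) (size : ℕ → ℕ) (S : ℕ → Matrix (Fin n) (Fin n) ℝ)
    (G : ∀ k, Matrix (Fin n) (Fin (s k)) ℝ) : Prop where
  orth : Pᵀ * P = 1
  lam_pos : ∀ i, 0 < lam i
  lam_anti : Antitone lam
  r_pos : 0 < r
  clusters : ClusterBounds lam gp 0.68 ϑ size
  one_le_gp : 1 ≤ gp
  l_pos : 0 < l
  l_le : ∀ i, l ≤ lam i
  ghat_eq : ghat = 1.01 * gp + 0.0001
  thresh_eq : thresh = 0.95 * l
  run : IsRun ghat thresh S G
  dev : ∀ k < ϑ, ‖S k - popCov P lam‖ ≤ d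
  d_nonneg : 0 ≤ d
  d_le : (2 * (ϑ : ℝ) - 1) * d ≤ 0.0039 * l
  two_le : 2 ≤ ϑ

namespace RunModel

variable (h : RunModel P lam gp l d ghat thresh ϑ size S G)

include h

lemma l_le_lamAt {i : ℕ} (hi : i < r) : l ≤ lamAt lam i := by
  rw [lamAt_of_lt hi]; exact h.l_le _

lemma dev_le {k : ℕ} (hk : k < ϑ) : (2 * (k : ℝ) + 1) * d ≤ 0.0039 * l := by
  refine le_trans (mul_le_mul_of_nonneg_right ?_ h.d_nonneg) h.d_le
  have : (k : ℝ) + 1 ≤ ϑ := by exact_mod_cast hk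
  linarith

lemma eigval_close {k : ℕ} (hD : IsDeflation S G k) (hk : k < ϑ) (i : ℕ) :
    |eigval (deflCov S G k) i - lamAt lam (start s k + i)| ≤ 0.0039 * l :=
  (hD.abs_eigval_sub_le h.orth h.lam_pos h.lam_anti h.dev k le_rfl hk i).trans (h.dev_le hk)

lemma one_le_ghat : 1 ≤ ghat := by rw [h.ghat_eq]; linarith [h.one_le_gp]

lemma thresh_pos : 0 < thresh := by rw [h.thresh_eq]; linarith [h.l_pos]

lemma size_spec {k : ℕ} (hD : IsDeflation S G k) (hk : k < ϑ) (hr : start s k < r) :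
    1 ≤ s k ∧ eigval (deflCov S G k) 0 ≤ ghat * eigval (deflCov S G k) (s k - 1) ∧
    (ghat * eigval (deflCov S G k) (s k) < eigval (deflCov S G k) 0 ∨
      eigval (deflCov S G k) (s k) < thresh) ∧
    ∀ t < s k, eigval (deflCov S G k) 0 ≤ ghat * eigval (deflCov S G k) t ∧
      thresh ≤ eigval (deflCov S G k) t := by
  have h0 : thresh ≤ eigval (deflCov S G k) 0 := by
    have h1 := (abs_le.mp (h.eigval_close hD hk 0)).1
    have h2 := h.l_le_lamAt hr
    rw [add_zero] at h1
    rw [h.thresh_eq]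
    linarith [h.l_pos]
  have := clusterSize_spec (M := deflCov S G k) h.one_le_ghat h.thresh_pos h0
  rwa [← h.run.size_eq k] at this

lemma thresh_le {k : ℕ} (hD : IsDeflation S G k) (hk : k < ϑ) (hr : start s k < r) :
    thresh ≤ eigval (deflCov S G k) (s k - 1) := by
  obtain ⟨h1, -, -, h4⟩ := h.size_spec hD hk hr
  exact (h4 _ (by omega)).2

/-- Going beyond the rank would make an eigenvalue above the threshold `0.95 * l` lie within `0.0039
* l` of zero. -/
lemma start_succ_le {k : ℕ} (hD : IsDeflation S G k) (hk : k < ϑ) (hr : start s k < r) :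
    start s (k + 1) ≤ r := by
  have h1 := (h.size_spec hD hk hr).1
  have h2 := h.thresh_le hD hk hr
  have h3 := (abs_le.mp (h.eigval_close hD hk (s k - 1))).2
  rw [start_succ]
  by_contra hcon
  rw [lamAt_of_le (by omega)] at h3
  rw [h.thresh_eq] at h2
  linarith [h.l_pos]

lemma isDeflation_succ {k : ℕ} (hD : IsDeflation S G k) (hk : k < ϑ) (hr : start s k < r) :
    IsDeflation S G (k + 1) := by
  have h2 := h.thresh_le hD hk hr
  have hrn : r ≤ n := card_le_of_transpose_mul_self h.orth
  have h3 : s k ≤ n := by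
    have := h.start_succ_le hD hk hr
    rw [start_succ] at this
    omega
  refine ⟨hD.psd, fun j hj => ?_, fun j hj => ?_, fun j hj => ?_⟩ <;>
    rcases (Nat.lt_succ_iff_lt_or_eq.mp hj) with hj | rfl
  · exact hD.top j hj
  · exact h.run.top j h3
  · exact hD.size_le j hj
  · exact h3
  · exact hD.pos j hj
  · exact h.thresh_pos.trans_le h2

lemma thresh_le_next {k : ℕ} (hD : IsDeflation S G k) (hk : k < ϑ)
    (hr' : start s (k + 1) < r) : thresh ≤ eigval (deflCov S G k) (s k) := by
  have h3 := (abs_le.mp (h.eigval_close hD hk (s k))).1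
  rw [← start_succ] at h3
  have h4 := h.l_le_lamAt hr'
  rw [h.thresh_eq]
  linarith [h.l_pos]

lemma next_lt_thresh {k : ℕ} (hD : IsDeflation S G k) (hk : k < ϑ)
    (hr' : start s (k + 1) = r) : eigval (deflCov S G k) (s k) < thresh := by
  have h3 := (abs_le.mp (h.eigval_close hD hk (s k))).2
  rw [← start_succ, hr', lamAt_of_le le_rfl] at h3
  rw [h.thresh_eq]
  linarith [h.l_pos]

/-- Two successive detected clusters start in different clusters. -/
lemma separated {k : ℕ} (hD : IsDeflation S G k) (hk : k < ϑ) (hr : start s k < r)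
    (hr' : start s (k + 1) < r) :
    gp * lamAt lam (start s (k + 1)) < lamAt lam (start s k) := by
  obtain ⟨-, -, h3, -⟩ := h.size_spec hD hk hr
  have h4 := h.thresh_le_next hD hk hr'
  have h5 := h3.resolve_right (not_lt.mpr h4)
  have h6 := (abs_le.mp (h.eigval_close hD hk (s k))).1
  have h7 := (abs_le.mp (h.eigval_close hD hk 0)).2
  rw [← start_succ] at h6
  rw [add_zero] at h7
  have h8 := h.l_le_lamAt hr'
  have hgp := h.one_le_gp
  have hl := h.l_pos
  have hg0 : 0 ≤ ghat := zero_le_one.trans h.one_le_ghat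
  have h9 : ghat * (lamAt lam (start s (k + 1)) - 0.0039 * l) ≤
      ghat * eigval (deflCov S G k) (s k) := mul_le_mul_of_nonneg_left (by linarith) hg0
  rw [h.ghat_eq] at h5 h9
  -- The one percent by which `ghat` exceeds `gp` absorbs the estimation error `0.0039 * l * (1 +
  -- ghat)`, because `gp` is at least 1.
  have h10 : (0.01 * gp + 0.0001) * l ≤ (0.01 * gp + 0.0001) * lamAt lam (start s (k + 1)) := by
    gcongr
  nlinarith

/-- The true cluster boundary number `k` never lies beyond the detected one. Otherwise a detected
cluster would start and end inside one true cluster, where ratios are at most `gp`, contrary to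
`separated`. This bounds the number of iterations by `ϑ`. -/
lemma isDeflation : ∀ k, (∀ j < k, start s j < r) →
    IsDeflation S G k ∧ start size k ≤ start s k ∧ start s k ≤ r ∧ k ≤ ϑ := by
  intro k
  induction k with
  | zero =>
    intro _
    exact ⟨⟨h.run.psd, fun _ h => absurd h (Nat.not_lt_zero _),
      fun _ h => absurd h (Nat.not_lt_zero _), fun _ h => absurd h (Nat.not_lt_zero _)⟩,
      by simp [start_zero], by simp [start_zero], Nat.zero_le _⟩
  | succ k ih =>
    intro hj
    obtain ⟨hD, h1, h2, h3⟩ := ih fun j hjk => hj j (by omega)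
    have hr := hj k (by omega)
    have hk : k < ϑ := by
      refine lt_of_le_of_ne h3 ?_
      rintro rfl
      rw [h.clusters.total] at h1
      omega
    have h4 := h.start_succ_le hD hk hr
    refine ⟨h.isDeflation_succ hD hk hr, ?_, h4, hk⟩
    by_contra hcon
    push Not at hcon
    have h5 := h.clusters.start_succ_le hk
    have h6 := h.separated hD hk hr (by omega)
    have h7 := h.clusters.le_of_same (by linarith [h.one_le_gp]) h.lam_pos h.lam_anti hk h1 hcon
    linarith

/-- The number of iterations: all directions are found, and no more. -/
lemma exists_iterations : ∃ K, 1 ≤ K ∧ K ≤ ϑ ∧ IsDeflation S G K ∧ start s K = r ∧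
    ∀ j < K, start s j < r := by
  classical
  have hex : ∃ k, r ≤ start s k := by
    by_contra hcon
    push Not at hcon
    have := (h.isDeflation ϑ fun j _ => hcon j).2.1
    rw [h.clusters.total] at this
    exact absurd (hcon ϑ) (not_lt.mpr this)
  have hmin : ∀ j < Nat.find hex, start s j < r := fun j hj => not_le.mp (Nat.find_min hex hj)
  obtain ⟨hD, h1, h2, h3⟩ := h.isDeflation _ hmin
  refine ⟨Nat.find hex, ?_, h3, hD, le_antisymm h2 (Nat.find_spec hex), hmin⟩
  rw [Nat.one_le_iff_ne_zero]
  intro h0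
  have := Nat.find_spec hex
  rw [h0, start_zero] at this
  exact absurd h.r_pos (by omega)

end RunModel

end run

/-! ### Accumulated subspace error and recovery of the cluster sizes -/

section error

variable {n r : ℕ} {P : Matrix (Fin n) (Fin r) ℝ} {lam : Fin r → ℝ}
  {s : ℕ → ℕ} {S : ℕ → Matrix (Fin n) (Fin n) ℝ}
  {G : ∀ k, Matrix (Fin n) (Fin (s k)) ℝ} {gp l d ghat thresh ε τ δ c ρ u : ℝ} {ϑ : ℕ}
  {size : ℕ → ℕ}

/-- Bounds for the parameters of the perturbations: `u` is the allowed subspace error and `ρ`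
its share for the smallest cluster. -/
structure NoiseModel (P : Matrix (Fin n) (Fin r) ℝ) (lam : Fin r → ℝ) (gp l ε τ δ c ρ u : ℝ)
    (ϑ : ℕ) (S : ℕ → Matrix (Fin n) (Fin n) ℝ) : Prop where
  pert : ∀ k < ϑ, IsPerturbation P lam ε τ δ c (S k)
  ε_nonneg : 0 ≤ ε
  τ_nonneg : 0 ≤ τ
  δ_nonneg : 0 ≤ δ
  ρ_nonneg : 0 ≤ ρ
  u_pos : 0 < u
  u_le : u ≤ 0.00005
  share : ρ * ϑ ≤ u
  ε_le : ε * gp ≤ 0.001 * u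
  τ_le : τ * gp ≤ 0.247 * ρ
  δ_le : δ ^ 2 * gp ≤ (0.001 * u) ^ 2 * l
  c_le : c ≤ (0.25 * ρ + 0.001 * u) * l

/-- The error of one iteration splits by how it sums up. Terms with `ρ` or `u / ϑ` are affordable in
each of at most `ϑ` iterations. The terms from `δ` and from the `u` part of `c` carry √(l/μ), which
is summable over iterations. The `ρ` coefficient is 0.2506 from `τ` plus 0.2632 from `c`, and 1.03
bounds √(1/0.95). -/
lemma NoiseModel.step_le (h : NoiseModel P lam gp l ε τ δ c ρ u ϑ S) (hl : 0 < l)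
    (hϑ : 0 < ϑ) (hdϑ : d * ϑ ≤ 0.0026 * l) {μ b X : ℝ} (hμ : 0.95 * l ≤ μ) (hb0 : 0 ≤ b)
    (hd : 0 ≤ d) (hb : b ≤ 1.0143 * gp * μ) (hX : X ≤ u) :
    (τ * b + δ * √b + c + 2 * d * X) / μ ≤
      0.52 * ρ + 0.0055 * u / ϑ + 0.0021 * u * √(l / μ) := by
  have hμ0 : 0 < μ := by linarith
  have hϑ0 : (0 : ℝ) < ϑ := by exact_mod_cast hϑ
  have hu := h.u_pos
  have hρ := h.ρ_nonneg
  set w := √(l / μ) with hw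
  have hw0 : 0 ≤ w := Real.sqrt_nonneg _
  have hw2 : w ^ 2 * μ = l := by
    rw [hw, Real.sq_sqrt (by positivity)]; field_simp
  have hw1 : w ≤ 1.03 := by
    rw [hw]
    apply Real.sqrt_le_iff.mpr
    refine ⟨by norm_num, ?_⟩
    rw [div_le_iff₀ hμ0]
    linarith
  have t1 : τ * b ≤ 0.2506 * ρ * μ := by
    calc τ * b ≤ τ * (1.0143 * gp * μ) := mul_le_mul_of_nonneg_left hb h.τ_nonneg
      _ = 1.0143 * (τ * gp) * μ := by ring
      _ ≤ 1.0143 * (0.247 * ρ) * μ := by have := h.τ_le; gcongr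
      _ ≤ _ := by nlinarith [mul_nonneg hρ hμ0.le]
  have t2 : δ * √b ≤ 0.00101 * u * w * μ := by
    have hle : (δ * √b) ^ 2 ≤ (0.00101 * u * w * μ) ^ 2 := by
      rw [mul_pow, Real.sq_sqrt hb0]
      calc δ ^ 2 * b ≤ δ ^ 2 * (1.0143 * gp * μ) := mul_le_mul_of_nonneg_left hb (sq_nonneg _)
        _ = 1.0143 * (δ ^ 2 * gp) * μ := by ring
        _ ≤ 1.0143 * ((0.001 * u) ^ 2 * l) * μ := by have := h.δ_le; gcongr
        _ = 1.0143 * (0.001 * u) ^ 2 * (w ^ 2 * μ) * μ := by rw [hw2]; ring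
        _ = 1.0143 * 0.001 ^ 2 * (u * w * μ) ^ 2 := by ring
        _ ≤ 0.00101 ^ 2 * (u * w * μ) ^ 2 := by gcongr; norm_num
        _ = _ := by ring
    exact le_of_sq_le_sq hle (by positivity)
  have t3 : c ≤ 0.2632 * ρ * μ + 0.00103 * u * w * μ := by
    have h1 : ρ * l ≤ ρ * (μ / 0.95) := by
      gcongr; rw [le_div_iff₀ (by norm_num)]; linarith
    have h2 : u * l ≤ 1.03 * u * w * μ := by
      calc u * l = u * w * μ * w := by rw [← hw2]; ring
        _ ≤ u * w * μ * 1.03 := by gcongr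
        _ = _ := by ring
    have h3 : ρ * (μ / 0.95) * 0.25 ≤ 0.2632 * ρ * μ := by
      have := mul_nonneg hρ hμ0.le
      ring_nf; ring_nf at this; linarith
    calc c ≤ (0.25 * ρ + 0.001 * u) * l := h.c_le
      _ = 0.25 * (ρ * l) + 0.001 * (u * l) := by ring
      _ ≤ _ := by linarith
  have t4 : 2 * d * X ≤ 0.0055 * u / ϑ * μ := by
    have h1 : d ≤ 0.0026 * l / ϑ := by rw [le_div_iff₀ hϑ0]; exact hdϑ
    calc 2 * d * X ≤ 2 * d * u := by gcongr
      _ ≤ 2 * (0.0026 * l / ϑ) * u := by gcongr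
      _ = 0.0052 * (u / ϑ) * l := by ring
      _ ≤ 0.0052 * (u / ϑ) * (μ / 0.95) := by
        gcongr; rw [le_div_iff₀ (by norm_num)]; linarith
      _ = (0.0052 / 0.95) * (u / ϑ * μ) := by ring
      _ ≤ 0.0055 * (u / ϑ * μ) := by gcongr; norm_num
      _ = _ := by ring
  rw [div_le_iff₀ hμ0]
  have e0 := mul_nonneg hρ hμ0.le
  have e1 : 0 ≤ u * w * μ := by positivity
  nlinarith

namespace RunModel

variable (h : RunModel P lam gp l d ghat thresh ϑ size S G)

include h

lemma d_mul_le : d * ϑ ≤ 0.0026 * l := by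
  have h1 := h.d_le
  have h2 := h.d_nonneg
  have h3 : (2 : ℝ) ≤ ϑ := by exact_mod_cast h.two_le
  nlinarith

/-- Ratio of the error scales of two successive iterations. -/
lemma sqrt_ratio_le {k : ℕ} (hD : IsDeflation S G k) (hk : k < ϑ) (hr : start s k < r)
    (hr' : start s (k + 1) < r) :
    √(l / lamAt lam (start s k)) ≤ 0.83 * √(l / lamAt lam (start s (k + 1))) := by
  have h1 := h.separated hD hk hr hr'
  have h2 := (h.clusters.le_or_le (j := start s (k + 1)) (by linarith [h.one_le_gp])
    (by norm_num) h.lam_pos h.lam_anti hr).resolve_left (not_le.mpr h1)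
  have hl := h.l_pos
  have h3 := hl.trans_le (h.l_le_lamAt hr)
  have h4 := hl.trans_le (h.l_le_lamAt hr')
  have h5 : l / lamAt lam (start s k) ≤ 0.83 ^ 2 * (l / lamAt lam (start s (k + 1))) := by
    rw [← mul_div_assoc, div_le_div_iff₀ h3 h4]
    calc l * lamAt lam (start s (k + 1)) ≤ l * (0.68 * lamAt lam (start s k)) := by gcongr
      _ ≤ _ := by nlinarith [mul_pos hl h3]
  calc _ ≤ √(0.83 ^ 2 * (l / lamAt lam (start s (k + 1)))) := Real.sqrt_le_sqrt h5
    _ = _ := by rw [Real.sqrt_mul (by positivity), Real.sqrt_sq (by norm_num)]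

/-- A geometric sum: successive terms grow by a factor at least 1/0.83, so the last term dominates.
The constant 6 is self-reproducing since 6 · 0.83 + 1 ≤ 6. -/
lemma sum_sqrt_le {K : ℕ} (hD : IsDeflation S G K) (hK : K ≤ ϑ) (hj : ∀ j < K, start s j < r) :
    ∀ k < K, ∑ j ∈ Finset.range k, √(l / lamAt lam (start s (j + 1))) ≤
      6 * √(l / lamAt lam (start s k)) := by
  intro k
  induction k with
  | zero => intro _; simp
  | succ k ih =>
    intro hk
    rw [Finset.sum_range_succ]
    have h1 := ih (by omega)
    have h2 := h.sqrt_ratio_le (hD.mono (by omega : k ≤ K)) (by omega) (hj k (by omega)) (hj _ hk)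
    have h3 := Real.sqrt_nonneg (l / lamAt lam (start s (k + 1)))
    linarith

/-- Except in the last iteration, the smallest detected eigenvalue dominates the next one, which is
close to the population eigenvalue starting the next detected cluster. These terms sum to at most
1.01 · 6; the last is at most 1.03 by the threshold. -/
lemma sum_sqrt_eigval_le {K : ℕ} (hD : IsDeflation S G K) (hK : K ≤ ϑ)
    (hj : ∀ j < K, start s j < r) {k : ℕ} (hk : k ≤ K) :
    ∑ j ∈ Finset.range k, √(l / eigval (deflCov S G j) (s j - 1)) ≤ 7.2 := by
  have hl := h.l_pos
  rcases Nat.eq_zero_or_pos k with rfl | hk0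
  · simp only [Finset.range_zero, Finset.sum_empty]; norm_num
  obtain ⟨m, rfl⟩ : ∃ m, k = m + 1 := ⟨k - 1, by omega⟩
  rw [Finset.sum_range_succ]
  have hμ : ∀ j < K, 0.95 * l ≤ eigval (deflCov S G j) (s j - 1) := fun j hjK => by
    have := h.thresh_le (hD.mono hjK.le) (by omega) (hj j hjK)
    rwa [h.thresh_eq] at this
  have h1 : ∑ j ∈ Finset.range m, √(l / eigval (deflCov S G j) (s j - 1)) ≤
      1.01 * ∑ j ∈ Finset.range m, √(l / lamAt lam (start s (j + 1))) := by
    rw [Finset.mul_sum]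
    refine Finset.sum_le_sum fun j hjm => ?_
    have hjm := Finset.mem_range.mp hjm
    have hDj := hD.mono (by omega : j ≤ K)
    have hr' := hj (j + 1) (by omega)
    have h2 := h.l_le_lamAt hr'
    have h3 := (abs_le.mp (h.eigval_close hDj (by omega) (s j))).1
    rw [← start_succ] at h3
    have h4 := eigval_anti_of_posSemidef (hDj.posSemidef j) (by omega : s j - 1 ≤ s j)
    have h5 : 0 < eigval (deflCov S G j) (s j - 1) := by linarith [hμ j (by omega)]
    have h6 : l / eigval (deflCov S G j) (s j - 1) ≤
        1.01 ^ 2 * (l / lamAt lam (start s (j + 1))) := by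
      rw [← mul_div_assoc, div_le_div_iff₀ h5 (by linarith)]
      nlinarith
    calc _ ≤ √(1.01 ^ 2 * (l / lamAt lam (start s (j + 1)))) := Real.sqrt_le_sqrt h6
      _ = _ := by rw [Real.sqrt_mul (by positivity), Real.sqrt_sq (by norm_num)]
  have h2 := h.sum_sqrt_le hD hK hj m (by omega)
  have h3 : √(l / lamAt lam (start s m)) ≤ 1 := by
    rw [Real.sqrt_le_one]
    have := h.l_le_lamAt (hj m (by omega))
    exact div_le_one_of_le₀ this (by linarith)
  have h4 : √(l / eigval (deflCov S G m) (s m - 1)) ≤ 1.03 := by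
    have := hμ m (by omega)
    rw [Real.sqrt_le_iff]
    refine ⟨by norm_num, ?_⟩
    rw [div_le_iff₀ (by linarith)]
    linarith
  linarith

/-- The step estimate needs the accumulated error to be at most `u` already, so the explicit bound
and this consequence are proved in one induction. The total is below (0.52 + 0.0055 + 0.0021 · 7.2)
`u`, which leaves room. -/
lemma sum_norm_perp_le (hN : NoiseModel P lam gp l ε τ δ c ρ u ϑ S) {K : ℕ}
    (hD : IsDeflation S G K) (hK : K ≤ ϑ) (hj : ∀ j < K, start s j < r) :
    ∀ k ≤ K, ∑ j ∈ Finset.range k, ‖(1 - P * Pᵀ) * (G j * (G j)ᵀ)‖ ≤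
      k * (0.52 * ρ + 0.0055 * u / ϑ) +
        0.0021 * u * ∑ j ∈ Finset.range k, √(l / eigval (deflCov S G j) (s j - 1)) ∧
      ∑ j ∈ Finset.range k, ‖(1 - P * Pᵀ) * (G j * (G j)ᵀ)‖ ≤ u := by
  have hϑ0 : (0 : ℝ) < ϑ := by
    have := h.two_le
    exact_mod_cast (by omega : 0 < ϑ)
  have hu := hN.u_pos
  have hρ := hN.ρ_nonneg
  have total : ∀ k ≤ K, (k : ℝ) * (0.52 * ρ + 0.0055 * u / ϑ) +
        0.0021 * u * ∑ j ∈ Finset.range k, √(l / eigval (deflCov S G j) (s j - 1)) ≤ u := by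
    intro k hk
    have h1 := h.sum_sqrt_eigval_le hD hK hj hk
    have h2 : (k : ℝ) ≤ ϑ := by exact_mod_cast hk.trans hK
    have h3 : (k : ℝ) * (0.52 * ρ + 0.0055 * u / ϑ) ≤ ϑ * (0.52 * ρ + 0.0055 * u / ϑ) := by
      gcongr
    have h4 : (ϑ : ℝ) * (0.52 * ρ + 0.0055 * u / ϑ) = 0.52 * (ρ * ϑ) + 0.0055 * u := by
      field_simp
    have h5 : 0.0021 * u * ∑ j ∈ Finset.range k, √(l / eigval (deflCov S G j) (s j - 1)) ≤
        0.0021 * u * 7.2 := by gcongr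
    have := hN.share
    linarith
  intro k
  induction k with
  | zero => intro _; simpa using hu.le
  | succ k ih =>
    intro hk
    have hIH := ih (by omega)
    have hDk := hD.mono (by omega : k ≤ K)
    have hr := hj k (by omega)
    have hkϑ : k < ϑ := by omega
    have hμ := h.thresh_le hDk hkϑ hr
    rw [h.thresh_eq] at hμ
    have hl := h.l_pos
    obtain ⟨-, hg, -, -⟩ := h.size_spec hDk hkϑ hr
    have h0 := eigval_nonneg (hDk.posSemidef k) 0
    have hgp := h.one_le_gp
    -- The factor collects 1.01 and 0.0001 from `ghat` and 0.0039 / 0.95 from the threshold, using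
    -- `gp ≥ 1`.
    have hb : eigval (deflCov S G k) 0 + 0.0039 * l ≤
        1.0143 * gp * eigval (deflCov S G k) (s k - 1) := by
      rw [h.ghat_eq] at hg
      nlinarith
    have hstep := hD.norm_perp_gram_le h.orth h.lam_pos hN.τ_nonneg hN.δ_nonneg h.dev
      (by omega : k < K) hkϑ (hN.pert k hkϑ) (b := eigval (deflCov S G k) 0 + 0.0039 * l)
      (by linarith [h.dev_le hkϑ])
    have hle := hN.step_le (d := d) hl (by omega) h.d_mul_le hμ (by linarith) h.d_nonneg hb
      hIH.2
    have hfirst : ∑ j ∈ Finset.range (k + 1), ‖(1 - P * Pᵀ) * (G j * (G j)ᵀ)‖ ≤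
      ((k + 1 : ℕ) : ℝ) * (0.52 * ρ + 0.0055 * u / ϑ) +
        0.0021 * u * ∑ j ∈ Finset.range (k + 1), √(l / eigval (deflCov S G j) (s j - 1)) := by
      rw [Finset.sum_range_succ, Finset.sum_range_succ, mul_add]
      push_cast
      linarith [hIH.1]
    exact ⟨hfirst, hfirst.trans (total _ hk)⟩

/-- If the clusters are separated relative to their own condition numbers, then the detected
clusters are the true ones. -/
lemma size_eq_of_separated (hN : NoiseModel P lam gp l ε τ δ c ρ u ϑ S)
    (hsep : ∀ k, k + 1 < ϑ → lamAt lam (start size (k + 1)) * ghat ≤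
      lamAt lam (start size k) - 0.0001 * (1 + ghat) * lamAt lam (start size (k + 1) - 1)) :
    ∀ k ≤ ϑ, start s k = start size k ∧ ∀ j < k, s j = size j := by
  intro k
  induction k with
  | zero => intro _; simp [start_zero]
  | succ k ih =>
    intro hk
    have hkϑ : k < ϑ := hk
    obtain ⟨he, hsz⟩ := ih (by omega)
    have hsame : ∀ j ≤ k, start s j = start size j := fun j hj =>
      Finset.sum_congr rfl fun i hi => hsz i (by have := Finset.mem_range.mp hi; omega)
    have hlt : ∀ j < k + 1, start s j < r := fun j hj => by
      rw [hsame j (by omega)]; exact h.clusters.start_lt (by omega)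
    obtain ⟨hD1, hge, hler, -⟩ := h.isDeflation (k + 1) hlt
    have hD := hD1.mono (Nat.le_succ k)
    have hr := hlt k (by omega)
    suffices hskk : s k = size k by
      refine ⟨by rw [start_succ, start_succ, he, hskk], fun j hj => ?_⟩
      rcases Nat.lt_succ_iff_lt_or_eq.mp hj with hj | rfl
      · exact hsz j hj
      · exact hskk
    -- Detected boundaries never lag behind true ones, so only an overlong cluster remains to be
    -- excluded. Such a cluster would have accepted the first eigenvalue past the true cluster.
    have hge' : size k ≤ s k := by rw [start_succ, start_succ, he] at hge; omega
    by_contra hne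
    have hlts : size k < s k := lt_of_le_of_ne hge' (Ne.symm hne)
    have hk1 : k + 1 < ϑ := by
      by_contra hcon
      have : k + 1 = ϑ := by omega
      have h1 := h.clusters.total
      rw [← this, start_succ] at h1
      rw [start_succ, he] at hler
      omega
    have hnot := ((h.size_spec hD hkϑ hr).2.2.2 (size k) hlts).1
    have hl := h.l_pos
    have hgp := h.one_le_gp
    set x := lamAt lam (start size k) with hx
    set v := lamAt lam (start size (k + 1) - 1) with hv
    have hvl : l ≤ v := by
      have h1 := h.clusters.start_succ_le hkϑ
      have h2 := h.clusters.size_pos k hkϑ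
      refine h.l_le_lamAt ?_
      have := h.r_pos
      omega
    have hv0 : 0 < v := hl.trans_le hvl
    have hxv : x ≤ gp * v := h.clusters.ratio k hkϑ
    have hxl : l ≤ x := h.l_le_lamAt (h.clusters.start_lt hkϑ)
    have hclose := (abs_le.mp (h.eigval_close hD hkϑ 0)).2
    rw [add_zero, he, ← hx] at hclose
    have hpop : ‖popCov P lam * (1 - cumProj G k)‖ ≤ x + 0.0078 * l :=
      (hD.norm_popCov_mul_le h.dev le_rfl hkϑ).trans (by linarith [h.dev_le hkϑ])
    have hZ := one_sub_cumProj_transpose (G := G) k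
    have hZ1 := hD.norm_one_sub_le le_rfl
    have hu := hN.u_pos
    have hρ := hN.ρ_nonneg
    have hϑ2 : (2 : ℝ) ≤ ϑ := by exact_mod_cast h.two_le
    have hρu : 2 * ρ ≤ u := by nlinarith [hN.share]
    set b := x + 0.0078 * l with hb
    have hb0 : 0 ≤ b := by linarith
    have hbv : b ≤ 1.008 * (gp * v) := by linarith
    have hgv : 0 < gp * v := by nlinarith
    -- The fine error: after deflation the top population scale is at most a multiple of `gp * v`,
    -- so all terms are proportional to `v`. The main contribution is about 0.748 · ρ with ρ ≤ u/2 ≤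
    -- 0.000025.
    have hφ : ‖(1 - cumProj G k) * (S k - popCov P lam) * (1 - cumProj G k)‖ ≤
        2e-5 * v := by
      refine ((hN.pert k hkϑ).norm_conj_sub_le hZ hZ1).trans ?_
      have hfac := norm_factor_mul_le_sqrt (P := P) h.lam_pos hZ hZ1 hpop
      have hfac2 : ‖(factor P lam)ᵀ * (1 - cumProj G k)‖ ^ 2 ≤ b := by
        rw [norm_factor_mul_sq h.lam_pos hZ]
        exact (norm_conj_le_norm_mul hZ1).trans hpop
      have t1 : ε * ‖(factor P lam)ᵀ * (1 - cumProj G k)‖ ^ 2 ≤ 0.00101 * u * v := by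
        calc _ ≤ ε * (1.008 * (gp * v)) :=
              mul_le_mul_of_nonneg_left (hfac2.trans hbv) hN.ε_nonneg
          _ = 1.008 * (ε * gp) * v := by ring
          _ ≤ 1.008 * (0.001 * u) * v := by have := hN.ε_le; gcongr
          _ ≤ _ := by nlinarith
      have t2 : τ * ‖popCov P lam * (1 - cumProj G k)‖ ≤ 0.249 * ρ * v := by
        calc _ ≤ τ * (1.008 * (gp * v)) :=
              mul_le_mul_of_nonneg_left (hpop.trans hbv) hN.τ_nonneg
          _ = 1.008 * (τ * gp) * v := by ring
          _ ≤ 1.008 * (0.247 * ρ) * v := by have := hN.τ_le; gcongr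
          _ ≤ _ := by nlinarith
      have t3 : δ * ‖(factor P lam)ᵀ * (1 - cumProj G k)‖ ≤ 0.00101 * u * v := by
        refine le_of_sq_le_sq ?_ (by positivity)
        rw [mul_pow]
        calc _ ≤ δ ^ 2 * (1.008 * (gp * v)) :=
              mul_le_mul_of_nonneg_left (hfac2.trans hbv) (sq_nonneg _)
          _ = 1.008 * (δ ^ 2 * gp) * v := by ring
          _ ≤ 1.008 * ((0.001 * u) ^ 2 * l) * v := by have := hN.δ_le; gcongr
          _ ≤ 1.008 * ((0.001 * u) ^ 2 * v) * v := by gcongr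
          _ = 1.008 * 0.001 ^ 2 * (u * v) ^ 2 := by ring
          _ ≤ 0.00101 ^ 2 * (u * v) ^ 2 := by gcongr; norm_num
          _ = _ := by ring
      have t4 : c ≤ (0.25 * ρ + 0.001 * u) * v := by
        refine hN.c_le.trans ?_
        gcongr
      have t5 : ρ * v ≤ 0.000025 * v := by
        have : ρ ≤ 0.000025 := by linarith [hN.u_le]
        gcongr
      have t6 : u * v ≤ 0.00005 * v := by
        have := hN.u_le
        gcongr
      nlinarith
    have hlow := hD.le_eigval_zero h.orth h.lam_anti hr hφ
    rw [he, ← hx] at hlow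
    -- Leakage of earlier true clusters. The gap gives `v' - b ≥ 0.31 * v'`, the interaction is at
    -- most half of `0.0039 * l`, and (0.00195 / 0.31)² is below 4e-5. Together with `hφ` the first
    -- eigenvalue past the cluster is known up to `6e-5 * v`, inside the margin 0.0001.
    have hY : ‖headFactor P lam (start size k) * (1 - cumProj G k)‖ ^ 2 ≤ 4e-5 * l := by
      rcases Nat.eq_zero_or_pos k with hk0 | hk0
      · have : headFactor P lam (start size k) = 0 := by
          rw [hk0, start_zero, headFactor]; simp
        rw [this]; simp; linarith
      · obtain ⟨m, rfl⟩ : ∃ m, k = m + 1 := ⟨k - 1, by omega⟩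
        set v' := lamAt lam (start size (m + 1) - 1) with hv'
        have hgap : x ≤ 0.68 * v' := h.clusters.gap m (by omega)
        have hpos := h.clusters.start_lt hkϑ
        have hspos := h.clusters.size_pos m (by omega)
        have hv'x : x ≤ v' := lamAt_anti h.lam_pos h.lam_anti (Nat.sub_le _ _)
        have hv'0 : 0 < v' := by linarith
        have hve : ∀ j : Fin r, (j : ℕ) < start size (m + 1) → v' ≤ lam j := by
          intro j hj
          have := lamAt_anti h.lam_pos h.lam_anti (by omega : (j : ℕ) ≤ start size (m + 1) - 1)
          rwa [lamAt_of_lt j.2] at this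
        have h1 := hD.norm_headFactor_mul_le (N := ϑ) h.orth h.lam_pos h.dev le_rfl (by omega)
          (by linarith : 0 < v') hve ((norm_conj_le_norm_mul hZ1).trans hpop)
        set y := ‖headFactor P lam (start size (m + 1)) * (1 - cumProj G (m + 1))‖ with hy
        have hy0 : 0 ≤ y := norm_nonneg _
        have h2 : 0.31 * v' ≤ v' - b := by linarith
        have h3 : ((m + 1 : ℕ) : ℝ) * d ≤ 0.00195 * l := by
          have h4 := h.d_le
          have h5 : ((m + 1 : ℕ) : ℝ) + 1 ≤ ϑ := by exact_mod_cast hkϑ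
          nlinarith [h.d_nonneg, mul_le_mul_of_nonneg_right h5 h.d_nonneg]
        have h6 : y * (0.31 * v') ≤ 0.00195 * l * √v' := by
          calc _ ≤ y * (v' - b) := by gcongr
            _ ≤ _ := h1
            _ ≤ _ := by gcongr
        have h7 : y ^ 2 * (0.31 * v') ^ 2 ≤ (0.00195 * l) ^ 2 * v' := by
          have := pow_le_pow_left₀ (by positivity) h6 2
          rwa [mul_pow, mul_pow _ (√v'), Real.sq_sqrt (by linarith)] at this
        have h8 : y ^ 2 * (0.31 ^ 2 * v') ≤ (0.00195 * l) ^ 2 := by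
          refine le_of_mul_le_mul_right ?_ hv'0
          calc _ = y ^ 2 * (0.31 * v') ^ 2 := by ring
            _ ≤ _ := h7
        have h9 : y ^ 2 * (0.31 ^ 2 * l) ≤ y ^ 2 * (0.31 ^ 2 * v') := by
          gcongr; linarith
        have h10 : y ^ 2 * (0.31 ^ 2) ≤ 0.00195 ^ 2 * l := by
          refine le_of_mul_le_mul_right ?_ hl
          calc _ = y ^ 2 * (0.31 ^ 2 * l) := by ring
            _ ≤ _ := h9.trans h8
            _ = _ := by ring
        linarith
    have hup := hD.eigval_le h.orth h.lam_pos h.lam_anti le_rfl (start size k) (size k) hφ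
    rw [← start_succ] at hup
    have hs := hsep k hk1
    rw [← hx, ← hv] at hs
    have hg1 := h.one_le_ghat
    have h1 : ghat * eigval (deflCov S G k) (size k) ≤
        ghat * (lamAt lam (start size (k + 1)) + 6e-5 * v) :=
      mul_le_mul_of_nonneg_left (by linarith) (by linarith)
    have h2 : 0 < ghat * v := mul_pos (by linarith) hv0
    have h3 : ghat * (lamAt lam (start size (k + 1)) + 6e-5 * v) =
      lamAt lam (start size (k + 1)) * ghat + 6e-5 * (ghat * v) := by ring
    have h4 : 0.0001 * (1 + ghat) * v = 0.0001 * v + 0.0001 * (ghat * v) := by ring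
    linarith

end RunModel

end error

/-! ### The output of the algorithm -/

section output

variable {n r : ℕ} {P : Matrix (Fin n) (Fin r) ℝ} {lam : Fin r → ℝ}
  {eig : Matrix (Fin n) (Fin n) ℝ → (s : ℕ) → Matrix (Fin n) (Fin s) ℝ} {α : ℕ}
  {ghat thresh : ℝ} {y : ℕ → Fin n → ℝ} {gp l d ε τ δ c ρ u : ℝ} {ϑ : ℕ} {size : ℕ → ℕ}

lemma detProj_eq_cumProj (k : ℕ) :
    detProj eig α ghat thresh y k = cumProj (Ghat eig α ghat thresh y) k := by
  induction k with
  | zero => rw [cumProj_zero]; rfl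
  | succ k ih => rw [cumProj_succ, ← ih]; rfl

lemma iterCov_eq_deflCov (k : ℕ) :
    iterCov eig α ghat thresh y k = deflCov (empCov α y) (Ghat eig α ghat thresh y) k := by
  rw [iterCov, projCov, deflCov, detProj_eq_cumProj]

lemma posSemidef_empCov (k : ℕ) : (empCov α y k).PosSemidef := by
  refine Matrix.PosSemidef.smul ?_ (by positivity)
  refine Matrix.posSemidef_sum _ fun t _ => ?_
  exact Matrix.posSemidef_vecMulVec_self_star (y t)

lemma isRun (heig : IsEigenvectorRoutine eig) :
    IsRun ghat thresh (empCov α y) (Ghat eig α ghat thresh y) := by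
  refine ⟨posSemidef_empCov, fun k => ?_, fun k hk => ?_⟩
  · rw [← iterCov_eq_deflCov]; rfl
  · have hM : (iterCov eig α ghat thresh y k).IsHermitian := by
      rw [iterCov_eq_deflCov]
      exact (posSemidef_conj (posSemidef_empCov k) (one_sub_cumProj_transpose k)).1
    have := heig _ _ hM hk
    rwa [← iterCov_eq_deflCov]

lemma Phat_mul_transpose (K : ℕ) :
    Phat eig α ghat thresh y K * (Phat eig α ghat thresh y K)ᵀ =
      cumProj (Ghat eig α ghat thresh y) K := by
  ext i j
  rw [Matrix.mul_apply, cumProj, Matrix.sum_apply, Finset.sum_range, Fintype.sum_sigma]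
  rfl

lemma Phat_transpose_mul {K : ℕ}
    (hD : IsDeflation (empCov α y) (Ghat eig α ghat thresh y) K) :
    (Phat eig α ghat thresh y K)ᵀ * Phat eig α ghat thresh y K = 1 := by
  set G := Ghat eig α ghat thresh y with hG
  have horth : ∀ {j k : ℕ}, j < k → k < K → (G j)ᵀ * G k = 0 := by
    intro j k hjk hk
    have h1 : G j * (G j)ᵀ * (G k * (G k)ᵀ) = 0 := by
      rw [← hD.mul_cumProj_of_lt hjk hk.le, Matrix.mul_assoc, hD.cumProj_mul hk, Matrix.mul_zero]
    calc (G j)ᵀ * G k = ((G j)ᵀ * G j) * (G j)ᵀ * (G k * ((G k)ᵀ * G k)) := by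
          rw [(hD.top j (by omega)).1, (hD.top k hk).1]; simp
      _ = (G j)ᵀ * (G j * (G j)ᵀ * (G k * (G k)ᵀ)) * G k := by simp only [Matrix.mul_assoc]
      _ = 0 := by rw [h1]; simp
  ext ⟨j, a⟩ ⟨k, b⟩
  have e : ((Phat eig α ghat thresh y K)ᵀ * Phat eig α ghat thresh y K) ⟨j, a⟩ ⟨k, b⟩ =
      ((G j)ᵀ * G k) a b := rfl
  rw [e]
  rcases lt_trichotomy j k with hjk | hjk | hjk
  · rw [horth hjk k.2, Matrix.one_apply_ne (fun h => hjk.ne (congrArg Sigma.fst h))]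
    rfl
  · subst hjk
    rw [(hD.top j j.2).1, Matrix.one_apply, Matrix.one_apply]
    simp
  · have : (G j)ᵀ * G k = ((G k)ᵀ * G j)ᵀ := by simp [Matrix.transpose_mul]
    rw [this, horth hjk j.2, Matrix.one_apply_ne (fun h => hjk.ne' (congrArg Sigma.fst h))]
    rfl

lemma RunModel.output (h : RunModel P lam gp l d ghat thresh ϑ size (empCov α y)
      (Ghat eig α ghat thresh y))
    (hN : NoiseModel P lam gp l ε τ δ c ρ u ϑ (empCov α y)) :
    ∃ K, HaltsAfter eig α ghat thresh y K ∧ SE (Phat eig α ghat thresh y K) P ≤ u ∧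
      ∑ k ∈ Finset.range K, rhat eig α ghat thresh y k = r ∧
      ((∀ k, k + 1 < ϑ → lamAt lam (start size (k + 1)) * ghat ≤
        lamAt lam (start size k) - 0.0001 * (1 + ghat) * lamAt lam (start size (k + 1) - 1)) →
        K = ϑ ∧ ∀ k < ϑ, rhat eig α ghat thresh y k = size k) := by
  obtain ⟨K, hK1, hKϑ, hD, hr, hlt⟩ := h.exists_iterations
  refine ⟨K, ?_, ?_, hr, fun hsep => ?_⟩
  · obtain ⟨k, rfl⟩ : ∃ k, K = k + 1 := ⟨K - 1, by omega⟩
    refine ⟨k, rfl, ?_, fun j hj => ?_⟩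
    · rw [Stop, iterCov_eq_deflCov]
      exact h.next_lt_thresh (hD.mono (Nat.le_succ k)) hKϑ hr
    · rw [Stop, iterCov_eq_deflCov, not_lt]
      exact h.thresh_le_next (hD.mono (by omega)) (by omega) (hlt (j + 1) (by omega))
  · set A := Phat eig α ghat thresh y K with hA
    have hAA : Aᵀ * A = 1 := Phat_transpose_mul hD
    have hsum := (h.sum_norm_perp_le hN hD hKϑ hlt K le_rfl).2
    have hcard : Fintype.card (Σ k : Fin K, Fin (rhat eig α ghat thresh y k)) =
        Fintype.card (Fin r) := by
      rw [Fintype.card_sigma, Fintype.card_fin, ← hr, start, Finset.sum_range]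
      simp
    -- The estimates control the part of P̂ outside the range of `P`; the exact column count allows
    -- the exchange of the two ranges.
    refine norm_one_sub_mul_le hcard A P hAA h.orth hN.u_pos.le (by linarith [hN.u_le]) ?_
    have hAeq : (1 - P * Pᵀ) * A =
        (1 - P * Pᵀ) * cumProj (Ghat eig α ghat thresh y) K * A := by
      rw [← Phat_mul_transpose, ← hA, Matrix.mul_assoc _ (A * Aᵀ), Matrix.mul_assoc A, hAA,
        Matrix.mul_one]
    rw [hAeq]
    have h1 : ‖(1 - P * Pᵀ) * cumProj (Ghat eig α ghat thresh y) K‖ ≤ u := by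
      rw [cumProj, Finset.mul_sum]
      exact (norm_sum_le _ _).trans hsum
    calc _ ≤ u * 1 := norm_mul_le_of_le _ _ h1 (norm_le_one_of_transpose_mul_self A hAA)
      _ = u := mul_one u
  · have hall := h.size_eq_of_separated hN hsep
    refine ⟨le_antisymm hKϑ ?_, (hall ϑ le_rfl).2⟩
    by_contra hcon
    push Not at hcon
    have h1 := (hall K hKϑ).1
    have h2 := h.clusters.start_lt hcon
    omega

end output

/-! ### The empirical covariance matrices -/

section decomposition

variable {n r : ℕ} {m : ℕ → ℕ} {P : Matrix (Fin n) (Fin r) ℝ} {lam : Fin r → ℝ}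
  {M1 : (t : ℕ) → Matrix (Fin (m t)) (Fin n) ℝ} {M2 : (t : ℕ) → Matrix (Fin n) (Fin (m t)) ℝ}
  {q β ε : ℝ} {α : ℕ}

lemma card_batch (α k : ℕ) : (batch α k).card = α := by
  rw [batch, Nat.card_Ico, Nat.succ_mul, Nat.add_sub_cancel_left]

lemma CorrModel.q_nonneg (h : CorrModel P M1 M2 q α β) : 0 ≤ q :=
  (norm_nonneg _).trans (h.norm_M1 0)

lemma norm_one_le (k : ℕ) : ‖(1 : Matrix (Fin k) (Fin k) ℝ)‖ ≤ 1 :=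
  norm_le_one_of_transpose_mul_self _ (by simp)

lemma CorrModel.norm_avg_le (h : CorrModel P M1 M2 q α β) (k : ℕ) :
    ‖(1 / (α : ℝ)) • ∑ t ∈ batch α k, M2 t * (M2 t)ᵀ‖ ≤ β / α := by
  have := h.average_le k (fun t => 1) 1 (fun t _ => Matrix.PosSemidef.one)
    (fun t _ => norm_one_le _)
  simpa using this

lemma CorrModel.ratio_nonneg (h : CorrModel P M1 M2 q α β) : 0 ≤ β / α :=
  (norm_nonneg _).trans (h.norm_avg_le 0)

/-- The average of `M_{2,t} B_t` is small by the Cauchy-Schwarz inequality. -/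
lemma CorrModel.norm_avg_mul_le (h : CorrModel P M1 M2 q α β) (k : ℕ) {N : ℕ}
    (B : (t : ℕ) → Matrix (Fin (m t)) (Fin N) ℝ) {w : ℝ} (hw : 0 ≤ w) (hB : ∀ t, ‖B t‖ ≤ w) :
    ‖(1 / (α : ℝ)) • ∑ t ∈ batch α k, M2 t * B t‖ ≤ √(β / α) * w := by
  rcases Nat.eq_zero_or_pos α with h0 | h0
  · subst h0
    simp only [Nat.cast_zero, div_zero, zero_smul, norm_zero, Real.sqrt_zero, zero_mul, le_refl]
  have hα : (0 : ℝ) < α := by exact_mod_cast h0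
  rw [← norm_transpose]
  refine norm_le_of_dotProduct_mulVec_self_le _ (by positivity) fun x => ?_
  set ν : ℕ → ℝ := fun t => √(((M2 t)ᵀ *ᵥ x) ⬝ᵥ ((M2 t)ᵀ *ᵥ x)) with hν
  have hν2 : ∀ t, ν t ^ 2 = x ⬝ᵥ (M2 t * (M2 t)ᵀ) *ᵥ x := fun t => by
    rw [hν, ← Matrix.mulVec_mulVec, dotProduct_mulVec_transpose]
    exact Real.sq_sqrt (dotProduct_self_nonneg' _)
  have hterm : ∀ t, ‖WithLp.toLp 2 ((B t)ᵀ *ᵥ ((M2 t)ᵀ *ᵥ x))‖ ≤ w * ν t := by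
    intro t
    refine le_of_sq_le_sq ?_ (by positivity)
    rw [← dotProduct_self_eq_norm_sq, mul_pow, hν, Real.sq_sqrt (dotProduct_self_nonneg' _)]
    refine (dotProduct_mulVec_self_le _ _).trans ?_
    refine mul_le_mul_of_nonneg_right ?_ (dotProduct_self_nonneg' _)
    rw [norm_transpose]
    exact pow_le_pow_left₀ (norm_nonneg _) (hB t) 2
  have hvec : ((1 / (α : ℝ)) • ∑ t ∈ batch α k, M2 t * B t)ᵀ *ᵥ x =
      (1 / (α : ℝ)) • ∑ t ∈ batch α k, (B t)ᵀ *ᵥ ((M2 t)ᵀ *ᵥ x) := by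
    rw [Matrix.transpose_smul, Matrix.transpose_sum, Matrix.smul_mulVec, Matrix.sum_mulVec]
    simp only [Matrix.transpose_mul, Matrix.mulVec_mulVec]
  have hnorm : ‖WithLp.toLp 2 (((1 / (α : ℝ)) • ∑ t ∈ batch α k, M2 t * B t)ᵀ *ᵥ x)‖ ≤
      (1 / (α : ℝ)) * (w * ∑ t ∈ batch α k, ν t) := by
    rw [hvec, WithLp.toLp_smul, norm_smul, Real.norm_of_nonneg (by positivity), WithLp.toLp_sum,
      Finset.mul_sum]
    refine mul_le_mul_of_nonneg_left ?_ (by positivity)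
    exact (norm_sum_le _ _).trans (Finset.sum_le_sum fun t _ => hterm t)
  have hcs : (∑ t ∈ batch α k, ν t) ^ 2 ≤ α * ∑ t ∈ batch α k, ν t ^ 2 := by
    have := sq_sum_le_card_mul_sum_sq (s := batch α k) (f := ν)
    rwa [card_batch] at this
  have havg : (1 / (α : ℝ)) * ∑ t ∈ batch α k, ν t ^ 2 ≤ β / α * (x ⬝ᵥ x) := by
    have h1 := (abs_le.mp (abs_dotProduct_mulVec_le
      ((1 / (α : ℝ)) • ∑ t ∈ batch α k, M2 t * (M2 t)ᵀ) x)).2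
    rw [Matrix.smul_mulVec, Matrix.sum_mulVec, dotProduct_smul, dotProduct_sum, smul_eq_mul] at h1
    simp_rw [hν2]
    exact h1.trans (mul_le_mul_of_nonneg_right (h.norm_avg_le k) (dotProduct_self_nonneg' x))
  rw [dotProduct_self_eq_norm_sq]
  calc _ ≤ ((1 / (α : ℝ)) * (w * ∑ t ∈ batch α k, ν t)) ^ 2 :=
        pow_le_pow_left₀ (norm_nonneg _) hnorm 2
    _ = w ^ 2 * (1 / (α : ℝ)) ^ 2 * (∑ t ∈ batch α k, ν t) ^ 2 := by ring
    _ ≤ w ^ 2 * (1 / (α : ℝ)) ^ 2 * (α * ∑ t ∈ batch α k, ν t ^ 2) := by gcongr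
    _ = w ^ 2 * ((1 / (α : ℝ)) * ∑ t ∈ batch α k, ν t ^ 2) := by field_simp
    _ ≤ w ^ 2 * (β / α * (x ⬝ᵥ x)) := by gcongr
    _ = _ := by rw [mul_pow, Real.sq_sqrt h.ratio_nonneg]; ring

/-- The factor `M_t P Λ^{1/2}` of the noise. -/
noncomputable def noiseFactor (P : Matrix (Fin n) (Fin r) ℝ) (lam : Fin r → ℝ)
    (M1 : (t : ℕ) → Matrix (Fin (m t)) (Fin n) ℝ) (M2 : (t : ℕ) → Matrix (Fin n) (Fin (m t)) ℝ)
    (t : ℕ) : Matrix (Fin n) (Fin r) ℝ :=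
  M2 t * (M1 t * factor P lam)

lemma norm_diagonal_sqrt_le (hl : ∀ i, 0 < lam i) (ha : Antitone lam) :
    ‖Matrix.diagonal fun i => √(lam i)‖ ≤ √(lamAt lam 0) := by
  rw [Matrix.l2_opNorm_diagonal, pi_norm_le_iff_of_nonneg (Real.sqrt_nonneg _)]
  intro i
  rw [Real.norm_of_nonneg (Real.sqrt_nonneg _)]
  have := lamAt_anti hl ha (Nat.zero_le i)
  rw [lamAt_of_lt i.2] at this
  exact Real.sqrt_le_sqrt this

lemma CorrModel.norm_M1_factor_le (h : CorrModel P M1 M2 q α β) (hl : ∀ i, 0 < lam i)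
    (ha : Antitone lam) (t : ℕ) : ‖M1 t * factor P lam‖ ≤ q * √(lamAt lam 0) := by
  rw [factor, ← Matrix.mul_assoc]
  exact norm_mul_le_of_le _ _ (h.norm_M1 t) (norm_diagonal_sqrt_le hl ha)

lemma CorrModel.norm_noiseFactor_le (h : CorrModel P M1 M2 q α β) (hl : ∀ i, 0 < lam i)
    (ha : Antitone lam) (t : ℕ) : ‖noiseFactor P lam M1 M2 t‖ ≤ q * √(lamAt lam 0) := by
  calc _ ≤ 1 * (q * √(lamAt lam 0)) :=
        norm_mul_le_of_le _ _ (h.norm_M2 t) (h.norm_M1_factor_le hl ha t)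
    _ = _ := one_mul _

lemma vecMulVec_mulVec {k : ℕ} (A : Matrix (Fin n) (Fin k) ℝ) (b : Fin k → ℝ) :
    Matrix.vecMulVec (A *ᵥ b) (A *ᵥ b) = A * Matrix.vecMulVec b b * Aᵀ := by
  rw [Matrix.mul_vecMulVec, Matrix.vecMulVec_mul, Matrix.vecMul_transpose]

lemma mulVec_eq_factor_mulVec (hl : ∀ i, 0 < lam i) (x : Fin r → ℝ) :
    P *ᵥ x = factor P lam *ᵥ whiten lam x := by
  rw [factor, ← Matrix.mulVec_mulVec]
  congr 1
  ext i
  rw [Matrix.mulVec_diagonal, whiten, mul_div_cancel₀ _ (Real.sqrt_pos.mpr (hl i)).ne']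

lemma whitenDev_transpose (x : Fin r → ℝ) : (whitenDev lam x)ᵀ = whitenDev lam x := by
  rw [whitenDev, Matrix.transpose_sub, Matrix.transpose_vecMulVec, Matrix.transpose_one]

/-- Expand (N + C_t)(I + W_t)(N + C_t)' with W_t = b_t b_t' - I. The terms without W_t are means,
bounded by the assumption on M_{2,t}; those with W_t are bounded by `h1`, `h2`, `h3`. -/
lemma CorrModel.isPerturbation_empCov {Ω : Type*} (h : CorrModel P M1 M2 q α β)
    (hP : Pᵀ * P = 1) (hl : ∀ i, 0 < lam i) (ha : Antitone lam) (hα : 0 < α)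
    (a : ℕ → Ω → Fin r → ℝ) (ω : Ω) (k : ℕ)
    (h1 : ‖∑ t ∈ batch α k, whitenDev lam (a t ω)‖ ≤ α * ε)
    (h2 : ‖∑ t ∈ batch α k, noiseFactor P lam M1 M2 t * whitenDev lam (a t ω)‖ ≤
      α * (ε * (q * √(lamAt lam 0))))
    (h3 : ‖∑ t ∈ batch α k, noiseFactor P lam M1 M2 t * whitenDev lam (a t ω) *
      (noiseFactor P lam M1 M2 t)ᵀ‖ ≤ α * (ε * (q * √(lamAt lam 0)) ^ 2)) :
    IsPerturbation P lam ε (√(β / α) * q) (ε * (q * √(lamAt lam 0)))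
      ((β / α + ε) * (q * √(lamAt lam 0)) ^ 2) (empCov α (obs P M1 M2 a ω) k) := by
  have hα' : (0 : ℝ) < α := by exact_mod_cast hα
  set p := q * √(lamAt lam 0) with hp
  have hp0 : 0 ≤ p := mul_nonneg h.q_nonneg (Real.sqrt_nonneg _)
  set C := noiseFactor P lam M1 M2 with hC
  set W : ℕ → Matrix (Fin r) (Fin r) ℝ := fun t => whitenDev lam (a t ω) with hW
  set N := factor P lam with hN
  have havg : ∀ {A : Matrix (Fin n) (Fin r) ℝ} {x : ℝ}, ‖A‖ ≤ α * x → ‖(1 / (α : ℝ)) • A‖ ≤ x := by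
    intro A x hA
    rw [norm_smul, Real.norm_of_nonneg (by positivity), one_div, inv_mul_le_iff₀ hα']
    exact hA
  have hobs : ∀ t, Matrix.vecMulVec (obs P M1 M2 a ω t) (obs P M1 M2 a ω t) =
      N * Nᵀ + N * W t * Nᵀ + (C t + C t * W t) * Nᵀ + N * (C t + C t * W t)ᵀ +
        (C t * (C t)ᵀ + C t * W t * (C t)ᵀ) := by
    intro t
    have e1 : obs P M1 M2 a ω t = (N + C t) *ᵥ whiten lam (a t ω) := by
      rw [obs, mulVec_eq_factor_mulVec hl, Matrix.mulVec_mulVec, Matrix.add_mulVec, hC,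
        noiseFactor, Matrix.mul_assoc]
    have e2 : Matrix.vecMulVec (whiten lam (a t ω)) (whiten lam (a t ω)) = 1 + W t := by
      simp only [hW, whitenDev]; abel
    have e3 : (W t)ᵀ = W t := whitenDev_transpose _
    rw [e1, vecMulVec_mulVec, e2]
    simp only [Matrix.transpose_add, Matrix.transpose_mul, e3, Matrix.mul_add, Matrix.add_mul,
      Matrix.mul_one, Matrix.mul_assoc]
    abel
  refine ⟨(1 / (α : ℝ)) • ∑ t ∈ batch α k, W t,
    (1 / (α : ℝ)) • ∑ t ∈ batch α k, (C t + C t * W t),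
    (1 / (α : ℝ)) • ∑ t ∈ batch α k, (C t * (C t)ᵀ + C t * W t * (C t)ᵀ), ?_, ?_, ?_, ?_⟩
  · rw [empCov]
    simp_rw [hobs]
    rw [← factor_mul_transpose hl, ← hN]
    simp only [Finset.sum_add_distrib, smul_add, Finset.sum_const, card_batch, Matrix.mul_add,
      Matrix.add_mul, Matrix.transpose_add, Matrix.transpose_smul, Matrix.transpose_sum,
      Matrix.mul_smul, Matrix.smul_mul, Matrix.mul_sum, Matrix.sum_mul]
    have e4 : (1 / (α : ℝ)) • α • (N * Nᵀ) = N * Nᵀ := by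
      rw [← Nat.cast_smul_eq_nsmul ℝ, smul_smul, one_div, inv_mul_cancel₀ hα'.ne', one_smul]
    rw [e4]
  · rw [norm_smul, Real.norm_of_nonneg (by positivity), one_div, inv_mul_le_iff₀ hα']
    exact h1
  · rw [Finset.sum_add_distrib, smul_add, add_mul]
    refine (norm_add_le _ _).trans (add_le_add ?_ ?_)
    · have := h.average_le k (fun t => (M1 t * N) * (M1 t * N)ᵀ) (p ^ 2)
        (fun t _ => by
          have := Matrix.posSemidef_self_mul_conjTranspose (M1 t * N)
          rwa [Matrix.conjTranspose_eq_transpose_of_trivial] at this)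
        (fun t _ => by
          rw [sq]
          exact norm_mul_le_of_le _ _ (h.norm_M1_factor_le hl ha t)
            ((norm_transpose _).le.trans (h.norm_M1_factor_le hl ha t)))
      have e : ∑ t ∈ batch α k, C t * (C t)ᵀ =
          ∑ t ∈ batch α k, M2 t * ((M1 t * N) * (M1 t * N)ᵀ) * (M2 t)ᵀ := by
        refine Finset.sum_congr rfl fun t _ => ?_
        have : C t = M2 t * (M1 t * N) := rfl
        rw [this, Matrix.transpose_mul (M2 t)]
        simp only [Matrix.mul_assoc]
      rw [e]
      exact this
    · rw [norm_smul, Real.norm_of_nonneg (by positivity), one_div, inv_mul_le_iff₀ hα']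
      exact h3
  · intro Z
    rw [Finset.sum_add_distrib, smul_add, Matrix.add_mul]
    refine (norm_add_le _ _).trans (add_le_add ?_ ?_)
    -- C_t N' Z is M_{2,t} M_{1,t} Σ Z. Factoring Σ Z as `P * X` brings in the bound `q` of M_{1,t}
    -- P and leaves the size of Σ Z, not its square root times √λ⁺.
    · set X := Pᵀ * (popCov P lam * Z) with hX
      have hX1 : ‖X‖ ≤ ‖popCov P lam * Z‖ := by
        calc _ ≤ 1 * ‖popCov P lam * Z‖ := norm_mul_le_of_le _ _
              (by rw [norm_transpose]; exact norm_le_one_of_transpose_mul_self P hP) le_rfl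
          _ = _ := one_mul _
      have hPX : P * X = popCov P lam * Z := by
        rw [hX, popCov]
        calc _ = P * (Pᵀ * P) * Matrix.diagonal lam * Pᵀ * Z := by simp only [Matrix.mul_assoc]
          _ = _ := by rw [hP, Matrix.mul_one]
      have e5 : ((1 / (α : ℝ)) • ∑ t ∈ batch α k, C t) * (Nᵀ * Z) =
          (1 / (α : ℝ)) • ∑ t ∈ batch α k, M2 t * (M1 t * P * X) := by
        rw [Matrix.smul_mul, Matrix.sum_mul]
        congr 1
        refine Finset.sum_congr rfl fun t _ => ?_
        calc C t * (Nᵀ * Z) = M2 t * (M1 t * ((N * Nᵀ) * Z)) := by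
              rw [hC, noiseFactor]; simp only [Matrix.mul_assoc]; rfl
          _ = M2 t * (M1 t * (P * X)) := by rw [hN, factor_mul_transpose hl, hPX]
          _ = _ := by rw [Matrix.mul_assoc (M1 t)]
      rw [e5, mul_assoc]
      exact h.norm_avg_mul_le k _ (mul_nonneg h.q_nonneg (norm_nonneg _)) fun t =>
        norm_mul_le_of_le _ _ (h.norm_M1 t) hX1
    · exact norm_mul_le_of_le _ _ (havg h2) le_rfl

end decomposition

/-! ### The concentration event -/

/-- A union bound over three sums for each of `ϑ` batches, every one failing with probability at
most 2 exp(-x). -/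
lemma CoeffModel.exists_event {Ω : Type*} [MeasurableSpace Ω] {μ : Measure Ω}
    [IsProbabilityMeasure μ] {n r : ℕ} {lam : Fin r → ℝ} {η : ℝ} {a : ℕ → Ω → Fin r → ℝ}
    (ha : CoeffModel μ lam η a) (hr : 2 ≤ r) (C : ℕ → Matrix (Fin n) (Fin r) ℝ) {p ε x : ℝ}
    (hC : ∀ t, ‖C t‖ ≤ p) (hε : 0 ≤ ε) (α ϑ : ℕ) (hx : x ≤ α * (ε / (η * r)) ^ 2 / 2) :
    ∃ E : Set Ω, MeasurableSet E ∧ 1 - 6 * ϑ * Real.exp (-x) ≤ μ.real E ∧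
      ∀ ω ∈ E, ∀ k < ϑ,
        ‖∑ t ∈ batch α k, whitenDev lam (a t ω)‖ ≤ α * ε ∧
        ‖∑ t ∈ batch α k, C t * whitenDev lam (a t ω)‖ ≤ α * (ε * p) ∧
        ‖∑ t ∈ batch α k, C t * whitenDev lam (a t ω) * (C t)ᵀ‖ ≤ α * (ε * p ^ 2) := by
  have h1 : ∀ t : ℕ, ‖(fun _ => 1 : ℕ → Matrix (Fin r) (Fin r) ℝ) t‖ ≤ 1 := fun t => norm_one_le r
  have c1 := fun k => ha.concentration hr _ _ h1 h1 (batch α k) hε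
  have c2 := fun k => ha.concentration hr C _ hC h1 (batch α k) hε
  have c3 := fun k => ha.concentration hr C C hC hC (batch α k) hε
  simp only [card_batch, Matrix.transpose_one, Matrix.mul_one, Matrix.one_mul, mul_one] at c1 c2 c3
  set B1 := fun k => {ω | α * ε < ‖flatten (∑ t ∈ batch α k, whitenDev lam (a t ω))‖} with hB1
  set B2 := fun k => {ω | α * (ε * p) <
    ‖flatten (∑ t ∈ batch α k, C t * whitenDev lam (a t ω))‖} with hB2
  set B3 := fun k => {ω | α * (ε * (p * p)) <
    ‖flatten (∑ t ∈ batch α k, C t * whitenDev lam (a t ω) * (C t)ᵀ)‖} with hB3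
  set B := ⋃ k ∈ Finset.range ϑ, (B1 k ∪ B2 k ∪ B3 k) with hB
  have hBm : MeasurableSet B := Finset.measurableSet_biUnion _ fun k _ =>
    ((c1 k).1.union (c2 k).1).union (c3 k).1
  have hexp : 2 * Real.exp (-(α * (ε / (η * r)) ^ 2 / 2)) ≤ 2 * Real.exp (-x) := by
    gcongr
  refine ⟨Bᶜ, hBm.compl, ?_, fun ω hω k hk => ?_⟩
  · rw [probReal_compl_eq_one_sub hBm]
    have : μ.real B ≤ ∑ k ∈ Finset.range ϑ, 6 * Real.exp (-x) := by
      refine (measureReal_biUnion_finset_le _ _).trans (Finset.sum_le_sum fun k _ => ?_)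
      have u1 := measureReal_union_le (μ := μ) (B1 k ∪ B2 k) (B3 k)
      have u2 := measureReal_union_le (μ := μ) (B1 k) (B2 k)
      linarith [(c1 k).2, (c2 k).2, (c3 k).2]
    rw [Finset.sum_const, Finset.card_range, nsmul_eq_mul] at this
    linarith
  · have hω' : ω ∉ B1 k ∪ B2 k ∪ B3 k := fun hmem =>
      hω (Set.mem_biUnion (Finset.mem_coe.mpr (Finset.mem_range.mpr hk)) hmem)
    simp only [Set.mem_union, not_or, hB1, hB2, hB3, Set.mem_ofPred_eq, not_lt] at hω'
    obtain ⟨⟨w1, w2⟩, w3⟩ := hω'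
    refine ⟨(norm_le_norm_flatten _).trans w1, (norm_le_norm_flatten _).trans w2, ?_⟩
    rw [sq]
    exact (norm_le_norm_flatten _).trans w3

/-! ### Numerical consequences of the parameter choices -/

/-- With relative accuracy `0.001 * u / G` the constant 32 · 16 / 0.01² of the sample size leaves
2.56 times the required exponent. -/
lemma le_exponent {η r u G x α : ℝ} (hη : 0 < η) (hr : 0 < r) (hu : 0 < u) (hG : 0 < G)
    (hx : 0 ≤ x) (hα : 32 * 16 / 0.01 ^ 2 * η ^ 2 * (r ^ 2 * x / u ^ 2) * G ^ 2 ≤ α) :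
    x ≤ α * (0.001 * u / G / (η * r)) ^ 2 / 2 := by
  have h : 32 * 16 / 0.01 ^ 2 * η ^ 2 * (r ^ 2 * x / u ^ 2) * G ^ 2 *
      (0.001 * u / G / (η * r)) ^ 2 / 2 = 2.56 * x := by
    field_simp
    ring
  have h2 : 2.56 * x ≤ α * (0.001 * u / G / (η * r)) ^ 2 / 2 := by
    rw [← h]
    gcongr
  linarith

/-- The summand log ϑ in the exponent cancels the number of batches, leaving 6 / n¹¹. -/
lemma failure_le {n ϑ : ℕ} (hn : 1 ≤ n) (hϑ : 1 ≤ ϑ) :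
    6 * ϑ * Real.exp (-(11 * Real.log n + Real.log ϑ)) ≤ 12 / (n : ℝ) ^ 10 := by
  have hn' : (1 : ℝ) ≤ n := by exact_mod_cast hn
  have hϑ' : (1 : ℝ) ≤ ϑ := by exact_mod_cast hϑ
  have e : Real.exp (11 * Real.log n + Real.log ϑ) = (n : ℝ) ^ 11 * ϑ := by
    rw [Real.exp_add, Real.exp_log (by linarith)]
    congr 1
    rw [show (11 : ℝ) = ((11 : ℕ) : ℝ) by norm_num, Real.exp_nat_mul, Real.exp_log (by linarith)]
  rw [Real.exp_neg, e]
  have : 6 * (ϑ : ℝ) * ((n : ℝ) ^ 11 * ϑ)⁻¹ = 6 / (n : ℝ) ^ 11 := by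
    field_simp
  rw [this]
  exact div_le_div₀ (by norm_num) (by norm_num) (by positivity)
    (pow_le_pow_right₀ hn' (by norm_num))

section numerics

variable {f l gp q u ε R ρ : ℝ}

/-- The constant 0.247 is an upper bound for √(0.25 / 4.1). -/
lemma sqrt_mul_le_of_average_le (hR : 0 ≤ R) (hρ : 0 ≤ ρ)
    (h : R * (4.1 * (q * gp) ^ 2) ≤ 0.25 * ρ ^ 2) : √R * q * gp ≤ 0.247 * ρ := by
  refine le_of_sq_le_sq ?_ (by positivity)
  have : (√R * q * gp) ^ 2 = R * (q * gp) ^ 2 := by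
    rw [mul_assoc, mul_pow, Real.sq_sqrt hR]
  rw [this]
  nlinarith [sq_nonneg ρ]

lemma sq_mul_le_of_sqrt_le (hq : 0 ≤ q) (hε : 0 ≤ ε) (hf : 0 ≤ f) (hg : 0 ≤ gp) (hl : 0 ≤ l)
    (h : ε * (q * √(f * gp)) ≤ 0.001 * u) :
    (ε * (q * √(f * l))) ^ 2 * gp ≤ (0.001 * u) ^ 2 * l := by
  have : (ε * (q * √(f * l))) ^ 2 * gp = (ε * (q * √(f * gp))) ^ 2 * l := by
    simp only [mul_pow]
    rw [Real.sq_sqrt (by positivity), Real.sq_sqrt (by positivity)]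
    ring
  rw [this]
  gcongr

lemma remainder_le (hf : 0 ≤ f) (hl : 0 ≤ l) (h1 : R * (q ^ 2 * f) ≤ 0.25 * ρ)
    (h2 : ε * (q ^ 2 * f) ≤ 0.001 * u) :
    (R + ε) * (q * √(f * l)) ^ 2 ≤ (0.25 * ρ + 0.001 * u) * l := by
  rw [mul_pow, Real.sq_sqrt (by positivity)]
  calc _ = (R * (q ^ 2 * f) + ε * (q ^ 2 * f)) * l := by ring
    _ ≤ _ := by gcongr

/-- This is where the restrictions on r²ζ and r²ζf enter: the coarse deviation is of order (ρ +
0.01u) λ⁺, it is multiplied by 2ϑ - 1, and the product has to stay well below λ⁻. -/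
lemma total_deviation_le {τ c ϑ r : ℝ} (hq1 : q ≤ 1) (hg : 1 ≤ gp) (hf : 1 ≤ f)
    (hl : 0 ≤ l) (hε : 0 ≤ ε) (hτ : 0 ≤ τ) (hρ : 0 ≤ ρ) (hu : 0 ≤ u)
    (hεg : ε * gp ≤ 0.001 * u) (hτg : τ * gp ≤ 0.247 * ρ)
    (hc : c ≤ (0.25 * ρ + 0.001 * u) * l) (hϑ : 2 ≤ ϑ) (hϑr : ϑ ≤ r) (hρϑ : ρ * ϑ ≤ u)
    (hru : r * u ≤ 0.0001) (hruf : r * u * f ≤ 0.01) :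
    (2 * ϑ - 1) * (ε * (f * l) + 2 * (τ * (f * l) + ε * (q * √(f * l)) * √(f * l)) + c) ≤
      0.0039 * l := by
  have e : ε * (q * √(f * l)) * √(f * l) = ε * q * (f * l) := by
    rw [← mul_assoc, mul_assoc, Real.mul_self_sqrt (by positivity)]
  rw [e]
  have h1 : ε ≤ 0.001 * u := le_trans (by nlinarith) hεg
  have h2 : τ ≤ 0.247 * ρ := le_trans (by nlinarith) hτg
  have h3 : ε * q ≤ 0.001 * u := by nlinarith
  have hfl : 0 ≤ f * l := by positivity
  have hlf : l ≤ f * l := by nlinarith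
  have hd : ε * (f * l) + 2 * (τ * (f * l) + ε * q * (f * l)) + c ≤
      (0.494 * (ρ * f) + 0.25 * ρ + 0.004 * (u * f)) * l := by
    have a1 := mul_le_mul_of_nonneg_right h1 hfl
    have a2 := mul_le_mul_of_nonneg_right h2 hfl
    have a3 := mul_le_mul_of_nonneg_right h3 hfl
    have a4 := mul_le_mul_of_nonneg_left hlf hu
    linarith
  have hcoef : (2 * ϑ - 1) * (0.494 * (ρ * f) + 0.25 * ρ + 0.004 * (u * f)) ≤ 0.0039 := by
    -- Equivalent to (3ϑ - 2)(ϑ - 2) ≥ 0. The quadratic form pairs one factor `ϑ` with `ρ ϑ ≤ u` and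
    -- the other with `ϑ ≤ r`.
    have b0 : 2 * ϑ - 1 ≤ 0.75 * ϑ * ϑ := by nlinarith
    have b1 : (2 * ϑ - 1) * ρ ≤ 0.75 * (r * u) := by
      calc _ ≤ 0.75 * ϑ * ϑ * ρ := by gcongr
        _ = 0.75 * (ϑ * (ρ * ϑ)) := by ring
        _ ≤ _ := mul_le_mul_of_nonneg_left
            (mul_le_mul hϑr hρϑ (by positivity) (by linarith)) (by norm_num)
    have b2 : (2 * ϑ - 1) * ρ * f ≤ 0.75 * (r * u) * f := by gcongr
    have b3 : (2 * ϑ - 1) * (u * f) ≤ 2 * r * (u * f) := by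
      gcongr
      linarith
    linarith
  calc _ ≤ (2 * ϑ - 1) * ((0.494 * (ρ * f) + 0.25 * ρ + 0.004 * (u * f)) * l) :=
        mul_le_mul_of_nonneg_left hd (by linarith)
    _ = (2 * ϑ - 1) * (0.494 * (ρ * f) + 0.25 * ρ + 0.004 * (u * f)) * l := by ring
    _ ≤ _ := by gcongr

end numerics

lemma le_of_quotient_le {A B v g : ℝ} (hv : 0 < v) (hg : 0 < g)
    (h : A / v ≤ (B / v - 0.0001) / g - 0.0001) : A * g ≤ B - 0.0001 * (1 + g) * v := by
  have h1 : A / v + 0.0001 ≤ (B / v - 0.0001) / g := by linarith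
  rw [le_div_iff₀ hg] at h1
  have h2 := mul_le_mul_of_nonneg_right h1 hv.le
  have e1 : (A / v + 0.0001) * g * v = A * g + 0.0001 * g * v := by field_simp
  have e2 : (B / v - 0.0001) * v = B - 0.0001 * v := by field_simp
  rw [e1, e2] at h2
  linarith

/-! ### The number of clusters -/

section clusters

variable {r : ℕ} {lam : Fin r → ℝ} {gp χp : ℝ} {ϑ : ℕ} {size : ℕ → ℕ}

lemma ClusterModel.pos (h : ClusterModel lam gp χp ϑ size) : 0 < r := by
  rcases Nat.eq_zero_or_pos r with h0 | h0
  · subst h0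
    have h1 := h.one_le_gp.trans_lt h.gp_lt
    -- Over the empty index set the supremum is 0 by convention, so the condition number would be 0,
    -- contrary to exceeding 1.
    rw [condNum, lamMax, lamMin, Real.iSup_of_isEmpty, zero_div] at h1
    linarith
  · exact h0

/-- A single cluster would bound the full condition number `f` by `gp`, which is excluded by `gp <
f`. -/
lemma ClusterModel.two_le (h : ClusterModel lam gp χp ϑ size) (hl : ∀ i, 0 < lam i)
    (ha : Antitone lam) : 2 ≤ ϑ := by
  have hr := h.pos
  have hb := h.clusterBounds hl ha
  have hϑ0 : ϑ ≠ 0 := by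
    rintro rfl
    have := hb.total
    rw [start_zero] at this
    omega
  have hϑ1 : ϑ ≠ 1 := by
    rintro rfl
    have h1 := hb.ratio 0 one_pos
    rw [start_zero, hb.total, ← lamMax_eq hr ha] at h1
    have h2 := h.gp_lt
    rw [condNum, lt_div_iff₀ (lamMin_pos hr hl)] at h2
    have h3 : lamAt lam (r - 1) ≤ lamMin lam := by
      have : Nonempty (Fin r) := ⟨⟨0, hr⟩⟩
      refine le_ciInf fun i => ?_
      have := lamAt_anti hl ha (show (i : ℕ) ≤ r - 1 by omega)
      rwa [lamAt_of_lt i.2] at this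
    have := mul_le_mul_of_nonneg_left h3 (zero_le_one.trans h.one_le_gp)
    linarith
  omega

lemma ClusterBounds.card_le (h : ClusterBounds lam gp χp ϑ size) : ϑ ≤ r := by
  rw [← h.total, start]
  calc ϑ = ∑ _k ∈ Finset.range ϑ, 1 := by simp
    _ ≤ _ := Finset.sum_le_sum fun k hk => h.size_pos k (Finset.mem_range.mp hk)

lemma ClusterBounds.exists_size_mul_le (h : ClusterBounds lam gp χp ϑ size) (hϑ : 0 < ϑ) :
    ∃ k < ϑ, size k * ϑ ≤ r := by
  obtain ⟨k, hk, hmin⟩ := Finset.exists_min_image (Finset.range ϑ) size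
    ⟨0, Finset.mem_range.mpr hϑ⟩
  refine ⟨k, Finset.mem_range.mp hk, ?_⟩
  rw [← h.total, start, mul_comm]
  calc _ = ∑ _j ∈ Finset.range ϑ, size k := by simp
    _ ≤ _ := Finset.sum_le_sum hmin

lemma ClusterBounds.mono {χ χ' : ℝ} (h : ClusterBounds lam gp χ ϑ size) (hχ : χ ≤ χ')
    (hl : ∀ i, 0 < lam i) : ClusterBounds lam gp χ' ϑ size :=
  ⟨h.size_pos, h.total, h.ratio, fun k hk =>
    (h.gap k hk).trans (mul_le_mul_of_nonneg_right hχ (lamAt_nonneg hl _))⟩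

end clusters

end ClusterEVD

/-! ### Assembling the estimates -/

theorem theorem2 {Ω : Type*} [MeasurableSpace Ω] (μ : Measure Ω) [IsProbabilityMeasure μ]
    {n r : ℕ}
    -- the signal
    (P : Matrix (Fin n) (Fin r) ℝ) (hP : Pᵀ * P = 1)
    (lam : Fin r → ℝ) (η : ℝ) (a : ℕ → Ω → Fin r → ℝ)
    (ha : ClusterEVD.CoeffModel μ lam η a)
    -- the clusters of eigenvalues
    (gp χp : ℝ) (ϑ : ℕ) (size : ℕ → ℕ)
    (hcluster : ClusterEVD.ClusterModel lam gp χp ϑ size)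
    -- the error level
    (ζ : ℝ) (hζ : 0 < ζ) (hζ1 : (r : ℝ) ^ 2 * ζ ≤ 0.0001)
    (hζ2 : (r : ℝ) ^ 2 * ζ * ClusterEVD.condNum lam ≤ 0.01)
    (hχ : χp ≤ min (1 - r * ζ - 0.08 / 0.25)
      ((gp - 0.0001) / (1.01 * gp + 0.0001) - 0.0001))
    -- the data-dependent noise and the number of samples per iteration
    {m : ℕ → ℕ} (M1 : (t : ℕ) → Matrix (Fin (m t)) (Fin n) ℝ)
    (M2 : (t : ℕ) → Matrix (Fin n) (Fin (m t)) ℝ)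
    (q : ℝ) (α : ℕ) (β : ℝ) (hM : ClusterEVD.CorrModel P M1 M2 q α β)
    (hα : ClusterEVD.alpha0 n r ϑ η ζ q gp (ClusterEVD.condNum lam) ≤ α)
    -- the two upper bounds on `β / α`, multiplied out because `q` may be `0`
    (hβ1 : ∀ k < ϑ, β / α * (4.1 * (q * gp) ^ 2) ≤
      ((1 - r * ζ - χp) / 2) ^ 2 * (size k * ζ) ^ 2)
    (hβ2 : ∀ k < ϑ, β / α * (q ^ 2 * ClusterEVD.condNum lam) ≤
      ((1 - r * ζ - χp) / 2) ^ 2 * (size k * ζ))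
    -- the algorithm
    (eig : Matrix (Fin n) (Fin n) ℝ → (s : ℕ) → Matrix (Fin n) (Fin s) ℝ)
    (heig : ClusterEVD.IsEigenvectorRoutine eig)
    (ghat thresh : ℝ) (hghat : ghat = 1.01 * gp + 0.0001)
    (hthresh : thresh = 0.95 * ClusterEVD.lamMin lam) :
    ∃ E : Set Ω, MeasurableSet E ∧ ENNReal.ofReal (1 - 12 / (n : ℝ) ^ 10) ≤ μ E ∧
      ∀ ω ∈ E, ∃ K : ℕ,
        -- the algorithm stops, after `K` iterations
        ClusterEVD.HaltsAfter eig α ghat thresh (ClusterEVD.obs P M1 M2 a ω) K ∧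
        -- the error bound
        ClusterEVD.SE
          (ClusterEVD.Phat eig α ghat thresh (ClusterEVD.obs P M1 M2 a ω) K) P ≤ r * ζ ∧
        -- the output has `r` columns
        ∑ k ∈ Finset.range K,
          ClusterEVD.rhat eig α ghat thresh (ClusterEVD.obs P M1 M2 a ω) k = r ∧
        -- the sizes of all clusters are recovered when each cluster is separated from the next
        -- one according to its own condition number
        ((∀ k, k + 1 < ϑ →
            ClusterEVD.clusterMax lam size (k + 1) / ClusterEVD.clusterMin lam size k ≤
              (ClusterEVD.clusterMax lam size k / ClusterEVD.clusterMin lam size k - 0.0001) /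
                (1.01 * gp + 0.0001) - 0.0001) →
          K = ϑ ∧ ∀ k < ϑ,
            ClusterEVD.rhat eig α ghat thresh (ClusterEVD.obs P M1 M2 a ω) k = size k) := by
  have hl := ha.lam_pos
  have hanti := ha.lam_antitone
  have hr0 := hcluster.pos
  have hϑ2 := hcluster.two_le hl hanti
  have hb := hcluster.clusterBounds hl hanti
  have hϑr := hb.card_le
  have hr2 : 2 ≤ r := hϑ2.trans hϑr
  have hrn := ClusterEVD.card_le_of_transpose_mul_self hP
  have hr2' : (2 : ℝ) ≤ r := by exact_mod_cast hr2
  have hϑ2' : (2 : ℝ) ≤ ϑ := by exact_mod_cast hϑ2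
  have hϑr' : (ϑ : ℝ) ≤ r := by exact_mod_cast hϑr
  have hn2' : (2 : ℝ) ≤ n := by exact_mod_cast hr2.trans hrn
  have hg := hcluster.one_le_gp
  set f := ClusterEVD.condNum lam with hf
  set l := ClusterEVD.lamMin lam with hldef
  set u := (r : ℝ) * ζ with hu
  have hl0 : 0 < l := ClusterEVD.lamMin_pos hr0 hl
  have hgf : gp < f := hcluster.gp_lt
  have hf1 : 1 ≤ f := hg.trans hgf.le
  have hL : ClusterEVD.lamAt lam 0 = f * l := by
    rw [hf, ClusterEVD.condNum, ClusterEVD.lamMax_eq hr0 hanti, div_mul_cancel₀ _ hl0.ne']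
  have hu0 : 0 < u := by positivity
  have hru : (r : ℝ) * u ≤ 0.0001 := by rw [hu, ← mul_assoc, ← sq]; exact hζ1
  have hruf : (r : ℝ) * u * f ≤ 0.01 := by rw [hu, ← mul_assoc, ← sq]; exact hζ2
  have hu1 : u ≤ 0.00005 := by nlinarith
  have hq0 := hM.q_nonneg
  have hq1 := hM.q_lt_one
  have hη := ha.one_le_eta ⟨0, hr0⟩
  -- The conditions on β/α are used for a cluster of at most average size. Its share ρ of the error
  -- budget can then be spent once in each of ϑ iterations.
  obtain ⟨k₀, hk₀, hsize⟩ := hb.exists_size_mul_le (by omega)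
  set ρ := (size k₀ : ℝ) * ζ with hρ
  have hρ0 : 0 ≤ ρ := by positivity
  have hρϑ : ρ * ϑ ≤ u := by
    have : (size k₀ : ℝ) * ϑ ≤ r := by exact_mod_cast hsize
    calc ρ * ϑ = size k₀ * ϑ * ζ := by rw [hρ]; ring
      _ ≤ _ := by rw [hu]; gcongr
  have hχ1 : χp ≤ 1 - u - 0.08 / 0.25 := hχ.trans (min_le_left _ _)
  have hχ0 := hcluster.chip_nonneg
  have hκ : ((1 - u - χp) / 2) ^ 2 ≤ 0.25 := by
    have : 0 ≤ 1 - u - χp := by norm_num at hχ1; linarith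
    nlinarith
  have hb' : ClusterEVD.ClusterBounds lam gp 0.68 ϑ size :=
    hb.mono (by norm_num at hχ1 ⊢; linarith) hl
  set R := β / α with hR
  have hR0 : 0 ≤ R := hM.ratio_nonneg
  have hβ1' : R * (4.1 * (q * gp) ^ 2) ≤ 0.25 * ρ ^ 2 :=
    (hβ1 k₀ hk₀).trans (mul_le_mul_of_nonneg_right hκ (sq_nonneg _))
  have hβ2' : R * (q ^ 2 * f) ≤ 0.25 * ρ :=
    (hβ2 k₀ hk₀).trans (mul_le_mul_of_nonneg_right hκ hρ0)
  -- the relative accuracy of the empirical covariance of the rescaled coefficients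
  rw [ClusterEVD.alpha0] at hα
  set G := max gp <| max (q * gp) <| max (q ^ 2 * f) <| max (q * u * f) <|
      max (u ^ 2 * f) <| max (q * √(f * gp)) (u * √(f * gp)) with hG
  have hG1 : gp ≤ G := le_max_left _ _
  have hG2 : q ^ 2 * f ≤ G := by simp [hG]
  have hG3 : q * √(f * gp) ≤ G := by simp [hG]
  have hG0 : 0 < G := by linarith
  set ε := 0.001 * u / G with hε
  have hε0 : 0 ≤ ε := by positivity
  have hεG : ∀ {x}, x ≤ G → ε * x ≤ 0.001 * u := fun {x} hx => by
    calc ε * x ≤ ε * G := by gcongr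
      _ = _ := by rw [hε]; field_simp
  have hlogn : 0 < Real.log n := Real.log_pos (by linarith)
  have hlogϑ : 0 < Real.log ϑ := Real.log_pos (by linarith)
  have hα0 : 0 < α := by
    have : (0 : ℝ) < α := lt_of_lt_of_le (by positivity) hα
    exact_mod_cast this
  have hx := ClusterEVD.le_exponent (zero_lt_one.trans_le hη) (by linarith) hu0 hG0
    (by positivity) hα
  obtain ⟨E, hEm, hEμ, hE⟩ := ha.exists_event hr2 (ClusterEVD.noiseFactor P lam M1 M2)
    (hM.norm_noiseFactor_le hl hanti) hε0 α ϑ hx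
  have hfail := ClusterEVD.failure_le (n := n) (ϑ := ϑ) (by omega) (by omega)
  refine ⟨E, hEm, ?_, fun ω hω => ?_⟩
  · rw [← ENNReal.ofReal_toReal (measure_ne_top μ E)]
    exact ENNReal.ofReal_le_ofReal (by rw [← measureReal_def]; linarith)
  have hτ0 : 0 ≤ √R * q := by positivity
  have hτg := ClusterEVD.sqrt_mul_le_of_average_le hR0 hρ0 hβ1'
  have hpert : ∀ k < ϑ, ClusterEVD.IsPerturbation P lam ε (√R * q) (ε * (q * √(f * l)))
      ((R + ε) * (q * √(f * l)) ^ 2) (ClusterEVD.empCov α (ClusterEVD.obs P M1 M2 a ω) k) := by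
    intro k hk
    obtain ⟨h1, h2, h3⟩ := hE ω hω k hk
    have := hM.isPerturbation_empCov hP hl hanti hα0 a ω k h1 h2 h3
    rwa [hL] at this
  have hδ0 : 0 ≤ ε * (q * √(f * l)) := by positivity
  have hc := ClusterEVD.remainder_le (by linarith) hl0.le hβ2' (hεG hG2)
  have hnoise : ClusterEVD.NoiseModel P lam gp l ε (√R * q) (ε * (q * √(f * l)))
      ((R + ε) * (q * √(f * l)) ^ 2) ρ u ϑ
      (ClusterEVD.empCov α (ClusterEVD.obs P M1 M2 a ω)) :=
    ⟨hpert, hε0, hτ0, hδ0, hρ0, hu0, hu1, hρϑ, hεG hG1, hτg,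
      ClusterEVD.sq_mul_le_of_sqrt_le hq0 hε0 (by linarith) (by linarith) hl0.le (hεG hG3), hc⟩
  have hrun : ClusterEVD.RunModel P lam gp l
      (ε * (f * l) + 2 * (√R * q * (f * l) + ε * (q * √(f * l)) * √(f * l)) +
        (R + ε) * (q * √(f * l)) ^ 2) ghat thresh ϑ size
      (ClusterEVD.empCov α (ClusterEVD.obs P M1 M2 a ω))
      (ClusterEVD.Ghat eig α ghat thresh (ClusterEVD.obs P M1 M2 a ω)) :=
    ⟨hP, hl, hanti, hr0, hb', hg, hl0, ClusterEVD.lamMin_le, hghat, hthresh,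
      ClusterEVD.isRun heig,
      fun k hk => by
        have := (hpert k hk).norm_sub_le hP hl hanti hε0 hτ0 hδ0
        rwa [hL] at this,
      by positivity,
      ClusterEVD.total_deviation_le hq1.le hg hf1 hl0.le hε0 hτ0 hρ0 hu0.le (hεG hG1) hτg hc
        hϑ2' hϑr' hρϑ hru hruf,
      hϑ2⟩
  obtain ⟨K, hhalt, hSE, hsum, hrec⟩ := hrun.output hnoise
  refine ⟨K, hhalt, hSE, hsum, fun hsep => hrec fun k hk => ?_⟩
  have hs := hsep k hk
  rw [ClusterEVD.clusterMax_eq hanti (hb.size_pos _ hk) (hb.start_lt hk),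
    ClusterEVD.clusterMax_eq hanti (hb.size_pos k (by omega)) (hb.start_lt (by omega)),
    ClusterEVD.clusterMin_eq hanti (hb.size_pos k (by omega)) (hb.start_succ_le (by omega)),
    ← hghat] at hs
  have hv : 0 < ClusterEVD.lamAt lam (ClusterEVD.start size (k + 1) - 1) := by
    have := hb.start_lt hk
    exact hl0.trans_le (ClusterEVD.lamMin_le_lamAt (by omega))
  exact ClusterEVD.le_of_quotient_le hv (by rw [hghat]; linarith) hs
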